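/- **Orbispaces.** All spaces are locally connected. A $G$-structure on a set $U$ is a triple $(\widehat U,G_U,\pi_U)$, where $\widehat U$ is a connected, locally connected space with a continuous action of a topological group $G_U$ and $\pi_U:\widehat U\to U$ induces a homeomorphism $\widehat U/G_U\cong U$. For a connected open $W\subset U$, an induced $G$-structure on $W$ is a connected component $\widehat W$ of $\pi_U^{-1}(W)$ with its setwise stabilizer $G_W\subset G_U$ and $\pi_U|_{\widehat W}$. An *orbispace* is a locally connected space $X$ with a base $\mathcal U$ of connected open sets ("basic open sets"), each with a $G$-structure, and sets $Tran(U,V)$, $U,V\in\mathcal U$, of transition maps, such that: 1. each transition map has an underlying isomorphism $(\phi,\lambda)$ over $X$ from a $G$-structure induced from $\widehat U$ to one induced from $\widehat V$, both on the same connected component of $U\cap V$, and every component of $U\cap V$ occurs; 2. $G_U$ and $G_V$ act on $Tran(U,V)$ by composition $h\circ\phi\circ g$ with the automorphisms $(x\mapsto gx,\ k\mapsto gkg^{-1})$; two transition maps over the same component differ by such a composition, and $h^{-1}\circ(\phi,\lambda)\circ g=(\phi,\lambda)$ in $Tran(U,V)$ if and only if $g$ is in the domain of $\lambda$ and $\lambda(g)=h$;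 3. the identity of the $G$-structure of $U$ lies in $Tran(U,U)$ (so that $Tran(U,U)=G_U$); 4. for $t\in Tran(U,V)$ and $s\in Tran(V,W)$, on each connected component of the set where $s\circ t$ is defined as a map there is a composition $s\circ t\in Tran(U,W)$ which restricts to the composition of the underlying isomorphisms there; composition is associative, and composition with $G_U=Tran(U,U)$ or $G_V=Tran(V,V)$ is the action in 2. $Tran(U,V)$ has the finest topology for which all maps $G_V\to Tran(U,V)$, $h\mapsto h\circ t$, are continuous. A locally connected space is an orbispace with the trivial structure: all connected open sets are basic, with trivial groups. **Morphisms.** A system from $X$ to $X'$ consists of a cover $\{U_\alpha\}$ of $X$ by basic open sets, basic open sets $U'_\alpha$ of $X'$ (same index set), continuous maps $f_\alpha:\widehat{U_\alpha}\to\widehat{U'_\alpha}$ and continuous maps $\rho_{\beta\alpha}:Tran(U_\alpha,U_\beta)\to Tran(U'_\alpha,U'_\beta)$ with $f_\beta\circ t=\rho_{\beta\alpha}(t)\circ f_\alpha$ and $\rho_{\gamma\alpha}(s\circ t)=\rho_{\gamma\beta}(s)\circ\rho_{\beta\alpha}(t)$. Two systems over the same $(\{U_\alpha\},\{U'_\alpha\})$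 are isomorphic if $f_{\alpha,2}=\delta_\alpha f_{\alpha,1}$ and $\rho_{\beta\alpha,2}(t)=\delta_\beta\circ\rho_{\beta\alpha,1}(t)\circ\delta_\alpha^{-1}$ for some $\delta_\alpha\in G_{U'_\alpha}$. If $V_k\subset U_{\theta(k)}$, a refinement over $(\{V_k\},\{V'_k\})$ of a system over $(\{U_\alpha\},\{U'_\alpha\})$ is a system of the form $f_k=(i'_k)^{-1}\circ f_{\theta(k)}\circ i_k$, $\rho_{lk}(t)=(i'_l)^{-1}\circ\rho_{\theta(l)\theta(k)}(i_l\circ t\circ i_k^{-1})\circ i'_k$ with $i_k\in Tran(V_k,U_{\theta(k)})$, $i'_k\in Tran(V'_k,U'_{\theta(k)})$. Two systems are directly equivalent if they have isomorphic refinements over a common pair of families. A *morphism* is a class of systems for the equivalence relation generated by direct equivalence. **Free loop space.** $S^1=\mathbb R/\mathbb Z$ has the trivial orbispace structure, and $\mathcal LX$ is the set of morphisms $S^1\to X$. Its topology (the compact-open topology) has as a subbase the sets of all loops represented by some system $(\{I_k\},\{U_k\},\{f_k\},\{\rho_{lk}\})$ with $f_k(K_k)\subset V_k$ and $\rho_{lk}(C)\in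 A_{lk}(C)$ for all components $C$ of $I_k\cap I_l$, where a cover of $S^1$ by open intervals $I_0,\dots,I_n$ in which only cyclically consecutive ones meet, basic open sets $U_k$, compact $K_k\subset I_k$, open $V_k\subset\widehat{U_k}$ and open $A_{lk}(C)\subset Tran(U_k,U_l)$ are given. $S^1$ acts on $\mathcal LX$ by rotation of the domain, $(s\cdot\gamma)(t)=\gamma(t+s)$. For a basic open set $U$, $x\in\widehat U$ and $g\in G_U$ with $gx=x$, let $c_{U,x,g}\in\mathcal LX$ be the constant loop at $x$ with holonomy $g$: it is represented by the intervals $I_a=(a-\frac14,a+\frac14)$ mod $\mathbb Z$, $a\in\mathbb R$, with $U_a=U$, $f_a\equiv x$ and $\rho_{ba}=g^{n}$ on $I_a\cap I_b\ne\emptyset$, where $n$ is the integer nearest to $b-a$. **Twisted sectors.** For $p\in X$ let $G_p$, the isotropy group of $p$, be the stabilizer in $G_U$ of a point $x_p\in\widehat U$ over $p$, for some chosen basic open $U\ni p$ and $x_p$. Let $\widetilde X=\{(p,(g)_{G_p}) : p\in X,\ g\in G_p\}$, where $(g)_{G_p}$ is the conjugacy class of $g$ in $G_p$. Each triple $(U,x,g)$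 with $x\in\widehat U$, $g\in G_U$, $gx=x$ defines a point $[U,x,g]=(p,(\lambda(g))_{G_p})$ of $\widetilde X$, where $p=\pi_U(x)$ and $(\phi,\lambda)$ is a transition map with $\phi(x)=x_p$. $\widetilde X$ has the quotient topology from $\bigsqcup_U\{(x,g)\in\widehat U\times G_U : gx=x\}$. **Proposition.** Let $X$ be an orbispace such that for every basic open set $U$ the group $G_U$ is finite and the space $\widehat U$ is $T_1$. Then there is a homeomorphism $\Phi$ from $\widetilde X$ onto the fixed-point set of the $S^1$-action on $\mathcal LX$, such that $\Phi([U,x,g])=c_{U,x,g}$ for every basic open set $U$, every $x\in\widehat U$ and every $g\in G_U$ with $gx=x$. -/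

import Mathlib

open Set Topology TopologicalSpace
open scoped Pointwise

universe u v

/-- A `G`-structure on a set `U ⊆ X`: a connected, locally connected space `Cov` with a continuous
action of a topological group `Grp` and a map `proj` that induces a homeomorphism of the orbit
space with `U` (a quotient map whose fibres are the orbits). -/
structure GStructure {X : Type u} [TopologicalSpace X] (U : Set X) where
  Cov : Type u
  Grp : Type u
  [topCov : TopologicalSpace Cov]
  [connCov : ConnectedSpace Cov]
  [locConnCov : LocallyConnectedSpace Cov]
  [group : Group Grp]
  [topGrp : TopologicalSpace Grp]
  [isTopGrp : IsTopologicalGroup Grp]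
  [action : MulAction Grp Cov]
  [contAction : ContinuousSMul Grp Cov]
  proj : Cov → U
  isQuotientMap_proj : IsQuotientMap proj
  proj_eq_iff : ∀ x y, proj x = proj y ↔ ∃ g : Grp, g • x = y

attribute [instance] GStructure.topCov GStructure.connCov GStructure.locConnCov GStructure.group
  GStructure.topGrp GStructure.isTopGrp GStructure.action GStructure.contAction

/-- An isomorphism `(φ, λ)` from a `G`-structure induced from `A` to a `G`-structure induced from
`B`, over one connected component `base` of `U ∩ V`. The induced `G`-structures over `base` are
given by a connected component of the preimage of `base` (here `map.source`, `map.target`) with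
its setwise stabilizer. `map` is `φ` and `hom` is `λ`. -/
structure InducedIso {X : Type u} [TopologicalSpace X] {U V : Set X}
    (A : GStructure U) (B : GStructure V) where
  base : Set X
  map : OpenPartialHomeomorph A.Cov B.Cov
  hom : MulAction.stabilizer A.Grp map.source ≃ₜ* MulAction.stabilizer B.Grp map.target
  base_eq : ∃ p ∈ U ∩ V, base = connectedComponentIn (U ∩ V) p
  source_eq : ∃ x, (A.proj x : X) ∈ base ∧
    map.source = connectedComponentIn {y | (A.proj y : X) ∈ base} x
  target_eq : ∃ x, (B.proj x : X) ∈ base ∧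
    map.target = connectedComponentIn {y | (B.proj y : X) ∈ base} x
  proj_map : ∀ x ∈ map.source, (B.proj (map x) : X) = A.proj x
  map_smul : ∀ (g : MulAction.stabilizer A.Grp map.source), ∀ x ∈ map.source,
    map ((g : A.Grp) • x) = (hom g : B.Grp) • map x

namespace GStructure

variable {X : Type u} [TopologicalSpace X] {U : Set X} (A : GStructure U)

lemma proj_smul (g : A.Grp) (y : A.Cov) : A.proj (g • y) = A.proj y :=
  ((A.proj_eq_iff y (g • y)).2 ⟨g, rfl⟩).symm

/-- If `g` maps a point of the preimage of `W` to `y`, it maps the component of this point in the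
preimage to that of `y`. -/
lemma smul_connectedComponentIn (W : Set X) (g : A.Grp) {x : A.Cov} (hx : (A.proj x : X) ∈ W) :
    g • connectedComponentIn {y | (A.proj y : X) ∈ W} x
      = connectedComponentIn {y | (A.proj y : X) ∈ W} (g • x) := by
  have hP : (Homeomorph.smul g) '' {y | (A.proj y : X) ∈ W} = {y | (A.proj y : X) ∈ W} := by
    ext y
    constructor
    · rintro ⟨w, hw, rfl⟩
      simpa [proj_smul] using hw
    · intro hy
      exact ⟨g⁻¹ • y, by simpa [proj_smul] using hy, by simp⟩
  have := (Homeomorph.smul (α := A.Cov) g).image_connectedComponentIn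
    (s := {y | (A.proj y : X) ∈ W}) hx
  rw [hP] at this
  exact this

/-- Each component of the preimage of a connected open set projects onto this set. -/
lemma exists_mem_component (hU : IsOpen U) {W : Set X} (hW : IsOpen W) (hWc : IsPreconnected W)
    {x : A.Cov} (hx : (A.proj x : X) ∈ W) {p : X} (hp : p ∈ W) (hWU : W ⊆ U) :
    ∃ z ∈ connectedComponentIn {y | (A.proj y : X) ∈ W} x, (A.proj z : X) = p := by
  set P : Set A.Cov := {y | (A.proj y : X) ∈ W} with hPdef
  have hcont : Continuous fun y => (A.proj y : X) :=
    continuous_subtype_val.comp A.isQuotientMap_proj.continuous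
  have hP : IsOpen P := hW.preimage hcont
  have hopen : ∀ S : Set A.Cov, IsOpen S → IsOpen ((fun y => (A.proj y : X)) '' S) := by
    intro S hS
    have h1 : IsOpen (A.proj '' S) := by
      rw [← A.isQuotientMap_proj.isOpen_preimage]
      have : A.proj ⁻¹' (A.proj '' S) = ⋃ g : A.Grp, g • S := by
        ext y
        simp only [mem_preimage, mem_image, mem_iUnion]
        constructor
        · rintro ⟨s, hs, h⟩
          obtain ⟨g, hg⟩ := (A.proj_eq_iff s y).1 h
          exact ⟨g, s, hs, hg⟩
        · rintro ⟨g, s, hs, h⟩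
          exact ⟨s, hs, (A.proj_eq_iff s y).2 ⟨g, h⟩⟩
      rw [this]
      exact isOpen_iUnion fun g => hS.smul g
    have h2 := hU.isOpenMap_subtype_val _ h1
    rwa [image_image] at h2
  let Q : Set A.Cov := {y ∈ P | ¬ ∃ z ∈ connectedComponentIn P x, (A.proj z : X) = A.proj y}
  have hQ : IsOpen Q := by
    rw [isOpen_iff_mem_nhds]
    intro y hy
    refine Filter.mem_of_superset ((hP.connectedComponentIn).mem_nhds
      (mem_connectedComponentIn hy.1)) fun w hw => ⟨connectedComponentIn_subset _ _ hw, ?_⟩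
    rintro ⟨z, hz, hzw⟩
    refine hy.2 ?_
    obtain ⟨g, hg⟩ := (A.proj_eq_iff w z).1 (Subtype.ext hzw.symm)
    refine ⟨g • y, ?_, congrArg Subtype.val (A.proj_smul g y)⟩
    have hwP : w ∈ P := connectedComponentIn_subset _ _ hw
    rw [connectedComponentIn_eq hz, ← hg, ← A.smul_connectedComponentIn W g hwP,
      ← connectedComponentIn_eq hw]
    exact smul_mem_smul_set (mem_connectedComponentIn hy.1)
  by_contra hcon
  obtain ⟨y, hy⟩ := A.isQuotientMap_proj.surjective ⟨p, hWU hp⟩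
  have hyp : (A.proj y : X) = p := congrArg Subtype.val hy
  have hne := hWc _ _ (hopen _ (hP.connectedComponentIn (x := x))) (hopen _ hQ) ?_
    ⟨_, hx, x, mem_connectedComponentIn hx, rfl⟩
    ⟨p, hp, y, ⟨by rwa [← hyp] at hp, by rwa [hyp]⟩, hyp⟩
  · obtain ⟨q, -, ⟨z, hz, rfl⟩, w, hw, hwz⟩ := hne
    exact hw.2 ⟨z, hz, hwz.symm⟩
  · intro q hq
    obtain ⟨w, hw⟩ := A.isQuotientMap_proj.surjective ⟨q, hWU hq⟩
    have hwq : (A.proj w : X) = q := congrArg Subtype.val hw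
    by_cases hz : ∃ z ∈ connectedComponentIn P x, (A.proj z : X) = q
    · exact Or.inl hz
    · exact Or.inr ⟨w, ⟨by rwa [← hwq] at hq, by rwa [hwq]⟩, hwq⟩

end GStructure

namespace InducedIso

variable {X : Type u} [TopologicalSpace X] {U V W : Set X}
  {A : GStructure U} {B : GStructure V} {C : GStructure W}

/-- `t.HomRel g h` says that `g` is in the domain of `λ` and `λ g = h`. -/
def HomRel (t : InducedIso A B) (g : A.Grp) (h : B.Grp) : Prop :=
  ∃ hg : g ∈ MulAction.stabilizer A.Grp t.map.source, (t.hom ⟨g, hg⟩ : B.Grp) = h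

/-- The set where the composition `s ∘ t` of the underlying maps is defined. -/
def overlap (s : InducedIso B C) (t : InducedIso A B) : Set A.Cov :=
  {x | x ∈ t.map.source ∧ t.map x ∈ s.map.source}

/-- An element fixing a point of the domain of `t` is in the domain of `λ`. -/
lemma mem_stabilizer (t : InducedIso A B) {x : A.Cov} (hx : x ∈ t.map.source) {g : A.Grp}
    (hg : g • x = x) : g ∈ MulAction.stabilizer A.Grp t.map.source := by
  obtain ⟨z, hz, hs⟩ := t.source_eq
  rw [hs] at hx
  have hxP : x ∈ {y | (A.proj y : X) ∈ t.base} := connectedComponentIn_subset _ _ hx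
  rw [MulAction.mem_stabilizer_iff, hs, connectedComponentIn_eq hx,
    A.smul_connectedComponentIn t.base g hxP, hg]

/-- The domain of `t` lies over the whole of `t.base`. -/
lemma exists_mem_source [LocallyConnectedSpace X] (t : InducedIso A B) (hU : IsOpen U)
    (hV : IsOpen V) (p : X) (hp : p ∈ t.base) : ∃ z ∈ t.map.source, (A.proj z : X) = p := by
  obtain ⟨z, hz, hs⟩ := t.source_eq
  obtain ⟨q, hq, hb⟩ := t.base_eq
  rw [hs]
  refine A.exists_mem_component hU ?_ ?_ hz hp ?_
  · exact hb ▸ (hU.inter hV).connectedComponentIn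
  · exact hb ▸ isPreconnected_connectedComponentIn
  · exact hb ▸ (connectedComponentIn_subset _ _).trans inter_subset_left

end InducedIso

/-- An orbispace structure on a locally connected space `X`. The elements of `Tran U V` are the
transition maps; `iso` gives the underlying isomorphism `(φ, λ)` of a transition map. As the local
actions need not be effective, different transition maps may have the same underlying maps. -/
structure Orbispace (X : Type u) [TopologicalSpace X] [LocallyConnectedSpace X] where
  /-- the basic open sets -/
  basic : Set (Set X)
  isConnected_basic : ∀ U ∈ basic, IsConnected U
  isTopologicalBasis : IsTopologicalBasis basic
  chart : ∀ U : basic, GStructure (U : Set X)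
  Tran : basic → basic → Type u
  iso : ∀ {U V : basic}, Tran U V → InducedIso (chart U) (chart V)
  exists_tran : ∀ (U V : basic) (p : X), p ∈ (U : Set X) ∩ V → ∃ t : Tran U V, p ∈ (iso t).base
  /-- `act h t g` is the composition `h ∘ t ∘ g` with automorphisms of the two `G`-structures. -/
  act : ∀ {U V : basic}, (chart V).Grp → Tran U V → (chart U).Grp → Tran U V
  act_one : ∀ {U V : basic} (t : Tran U V), act 1 t 1 = t
  act_act : ∀ {U V : basic} (t : Tran U V) (h' h : (chart V).Grp) (g g' : (chart U).Grp),
    act h' (act h t g) g' = act (h' * h) t (g * g')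
  source_act : ∀ {U V : basic} (t : Tran U V) (h : (chart V).Grp) (g : (chart U).Grp),
    (iso (act h t g)).map.source = {x | g • x ∈ (iso t).map.source}
  map_act : ∀ {U V : basic} (t : Tran U V) (h : (chart V).Grp) (g : (chart U).Grp)
    (x : (chart U).Cov), g • x ∈ (iso t).map.source →
      (iso (act h t g)).map x = h • (iso t).map (g • x)
  hom_act : ∀ {U V : basic} (t : Tran U V) (h : (chart V).Grp) (g : (chart U).Grp)
    (k : (chart U).Grp) (l : (chart V).Grp),
      (iso (act h t g)).HomRel k l ↔ (iso t).HomRel (g * k * g⁻¹) (h⁻¹ * l * h)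
  exists_eq_act : ∀ {U V : basic} (t₁ t₂ : Tran U V), (iso t₁).base = (iso t₂).base →
    ∃ (h : (chart V).Grp) (g : (chart U).Grp), t₂ = act h⁻¹ t₁ g
  act_eq_self_iff : ∀ {U V : basic} (t : Tran U V) (h : (chart V).Grp) (g : (chart U).Grp),
    act h⁻¹ t g = t ↔ (iso t).HomRel g h
  /-- the identity of the `G`-structure of `U` -/
  one : ∀ U : basic, Tran U U
  source_one : ∀ U : basic, (iso (one U)).map.source = univ
  map_one : ∀ (U : basic) (x : (chart U).Cov), (iso (one U)).map x = x
  hom_one : ∀ (U : basic) (g h : (chart U).Grp), (iso (one U)).HomRel g h ↔ g = h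
  /-- `comp s t x hx` is the composition `s ∘ t`, taken on the connected component of the point
  `x` in the set where `s ∘ t` is defined as a map. -/
  comp : ∀ {U V W : basic} (s : Tran V W) (t : Tran U V) (x : (chart U).Cov),
    x ∈ (iso s).overlap (iso t) → Tran U W
  comp_const : ∀ {U V W : basic} (s : Tran V W) (t : Tran U V) (x y : (chart U).Cov)
    (hx : x ∈ (iso s).overlap (iso t)) (hy : y ∈ (iso s).overlap (iso t)),
      y ∈ connectedComponentIn ((iso s).overlap (iso t)) x → comp s t y hy = comp s t x hx
  source_comp : ∀ {U V W : basic} (s : Tran V W) (t : Tran U V) (x : (chart U).Cov)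
    (hx : x ∈ (iso s).overlap (iso t)), x ∈ (iso (comp s t x hx)).map.source
  map_comp : ∀ {U V W : basic} (s : Tran V W) (t : Tran U V) (x : (chart U).Cov)
    (hx : x ∈ (iso s).overlap (iso t)),
      (iso (comp s t x hx)).map x = (iso s).map ((iso t).map x)
  hom_comp : ∀ {U V W : basic} (s : Tran V W) (t : Tran U V) (x : (chart U).Cov)
    (hx : x ∈ (iso s).overlap (iso t)) (g : (chart U).Grp) (h : (chart V).Grp)
    (k : (chart W).Grp),
      g • connectedComponentIn ((iso s).overlap (iso t)) x
        = connectedComponentIn ((iso s).overlap (iso t)) x →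
      (iso t).HomRel g h → (iso s).HomRel h k → (iso (comp s t x hx)).HomRel g k
  comp_assoc : ∀ {U V W Z : basic} (r : Tran W Z) (s : Tran V W) (t : Tran U V)
    (x : (chart U).Cov) (h₁ : x ∈ (iso s).overlap (iso t))
    (h₂ : x ∈ (iso r).overlap (iso (comp s t x h₁)))
    (h₃ : (iso t).map x ∈ (iso r).overlap (iso s))
    (h₄ : x ∈ (iso (comp r s ((iso t).map x) h₃)).overlap (iso t)),
      comp r (comp s t x h₁) x h₂ = comp (comp r s ((iso t).map x) h₃) t x h₄
  comp_one : ∀ {U V : basic} (t : Tran U V) (g : (chart U).Grp) (x : (chart U).Cov)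
    (hx : x ∈ (iso t).overlap (iso (act g (one U) 1))),
      comp t (act g (one U) 1) x hx = act 1 t g
  one_comp : ∀ {U V : basic} (t : Tran U V) (h : (chart V).Grp) (x : (chart U).Cov)
    (hx : x ∈ (iso (act h (one V) 1)).overlap (iso t)),
      comp (act h (one V) 1) t x hx = act h t 1

namespace Orbispace

variable {X : Type u} [TopologicalSpace X] [LocallyConnectedSpace X]

/-- The local cover `Û`. -/
abbrev Cov (O : Orbispace X) (U : O.basic) : Type u := (O.chart U).Cov

/-- The local group `G_U`. -/
abbrev Grp (O : Orbispace X) (U : O.basic) : Type u := (O.chart U).Grp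

/-- The projection `π_U : Û → U`, as a map to `X`. -/
def proj (O : Orbispace X) (U : O.basic) (x : O.Cov U) : X := (O.chart U).proj x

/-- The domain of a transition map. -/
abbrev src (O : Orbispace X) {U V : O.basic} (t : O.Tran U V) : Set (O.Cov U) :=
  (O.iso t).map.source

/-- The map underlying a transition map (meaningful on its domain). -/
abbrev app (O : Orbispace X) {U V : O.basic} (t : O.Tran U V) (x : O.Cov U) : O.Cov V :=
  (O.iso t).map x

/-- `O.CompAt s t x r`: the composition `s ∘ t` is defined at `x` and is `r` there. -/
def CompAt (O : Orbispace X) {U V W : O.basic} (s : O.Tran V W) (t : O.Tran U V) (x : O.Cov U)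
    (r : O.Tran U W) : Prop :=
  ∃ hx : x ∈ (O.iso s).overlap (O.iso t), O.comp s t x hx = r

/-- The topology on transition maps inherited from the local groups: the finest one for which
all maps `h ↦ h ∘ t` are continuous. -/
instance (O : Orbispace X) (U V : O.basic) : TopologicalSpace (O.Tran U V) :=
  ⨆ t : O.Tran U V, TopologicalSpace.coinduced (fun h : O.Grp V => O.act h t 1) inferInstance

/-- The element of `G_U`, as an element of `Tran U U`. -/
def ofGrp (O : Orbispace X) (U : O.basic) (g : O.Grp U) : O.Tran U U := O.act g (O.one U) 1

end Orbispace

/-- A compatible system of local equivariant maps between two orbispaces, defined over the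
families `U` and `U'` of basic open sets. -/
@[ext]
structure OrbiSystem {X : Type u} [TopologicalSpace X] [LocallyConnectedSpace X]
    {Y : Type v} [TopologicalSpace Y] [LocallyConnectedSpace Y]
    (O : Orbispace X) (P : Orbispace Y) {L : Type u} (U : L → O.basic) (U' : L → P.basic) where
  f : ∀ a, C(O.Cov (U a), P.Cov (U' a))
  rho : ∀ a b, O.Tran (U a) (U b) → P.Tran (U' a) (U' b)
  cover : ⋃ a, (U a : Set X) = univ
  continuous_rho : ∀ a b, Continuous (rho a b)
  f_app : ∀ a b (t : O.Tran (U a) (U b)), ∀ x ∈ O.src t,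
    f a x ∈ P.src (rho a b t) ∧ f b (O.app t x) = P.app (rho a b t) (f a x)
  rho_comp : ∀ a b c (t : O.Tran (U a) (U b)) (s : O.Tran (U b) (U c)) (x : O.Cov (U a))
    (r : O.Tran (U a) (U c)), O.CompAt s t x r →
      P.CompAt (rho b c s) (rho a b t) (f a x) (rho a c r)

namespace OrbiSystem

variable {X : Type u} [TopologicalSpace X] [LocallyConnectedSpace X]
  {Y : Type v} [TopologicalSpace Y] [LocallyConnectedSpace Y]
  {O : Orbispace X} {P : Orbispace Y} {L : Type u} {U : L → O.basic} {U' : L → P.basic}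

/-- Two systems over the same families are isomorphic if they differ by automorphisms `d a` of
the `G`-structures of the `U' a`. -/
def Isomorphic (σ τ : OrbiSystem O P U U') : Prop :=
  ∃ d : ∀ a, P.Grp (U' a),
    (∀ a x, τ.f a x = d a • σ.f a x) ∧
    ∀ a b (t : O.Tran (U a) (U b)), τ.rho a b t = P.act (d b) (σ.rho a b t) (d a)⁻¹

/-- `τ` is a refinement of `σ`: with the injections `i k` and transition maps `i' k`,
`τ.f k = (i' k)⁻¹ ∘ σ.f (θ k) ∘ i k` and, where `s = i l ∘ t ∘ (i k)⁻¹`,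
`τ.rho t = (i' l)⁻¹ ∘ σ.rho s ∘ i' k`. Both equations are written without inverses. -/
def IsRefinement (σ : OrbiSystem O P U U') {K : Type u} {V : K → O.basic} {V' : K → P.basic}
    (τ : OrbiSystem O P V V') : Prop :=
  ∃ θ : K → L, (∀ k, (V k : Set X) ⊆ U (θ k)) ∧
    ∃ (i : ∀ k, O.Tran (V k) (U (θ k))) (i' : ∀ k, P.Tran (V' k) (U' (θ k))),
      (∀ k x, τ.f k x ∈ P.src (i' k) ∧ P.app (i' k) (τ.f k x) = σ.f (θ k) (O.app (i k) x)) ∧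
      ∀ k l (t : O.Tran (V k) (V l)) (s : O.Tran (U (θ k)) (U (θ l))) (x : O.Cov (V k))
        (r : O.Tran (V k) (U (θ l))), O.CompAt (i l) t x r → O.CompAt s (i k) x r →
          ∃ r' : P.Tran (V' k) (U' (θ l)),
            P.CompAt (i' l) (τ.rho k l t) (τ.f k x) r' ∧
            P.CompAt (σ.rho (θ k) (θ l) s) (i' k) (τ.f k x) r'

end OrbiSystem

/-- A system of maps together with the families of basic open sets it is defined over. -/
structure SomeSystem {X : Type u} [TopologicalSpace X] [LocallyConnectedSpace X]
    {Y : Type v} [TopologicalSpace Y] [LocallyConnectedSpace Y]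
    (O : Orbispace X) (P : Orbispace Y) where
  L : Type u
  U : L → O.basic
  U' : L → P.basic
  sys : OrbiSystem O P U U'

/-- Two systems are directly equivalent if they have isomorphic refinements over some common pair
of families of basic open sets. -/
def DirectlyEquivalent {X : Type u} [TopologicalSpace X] [LocallyConnectedSpace X]
    {Y : Type v} [TopologicalSpace Y] [LocallyConnectedSpace Y]
    {O : Orbispace X} {P : Orbispace Y} (σ τ : SomeSystem O P) : Prop :=
  ∃ (K : Type u) (V : K → O.basic) (V' : K → P.basic) (σ' τ' : OrbiSystem O P V V'),
    σ.sys.IsRefinement σ' ∧ τ.sys.IsRefinement τ' ∧ σ'.Isomorphic τ'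

/-- Morphisms of orbispaces: equivalence classes of systems. -/
def OrbiMorphism {X : Type u} [TopologicalSpace X] [LocallyConnectedSpace X]
    {Y : Type v} [TopologicalSpace Y] [LocallyConnectedSpace Y]
    (O : Orbispace X) (P : Orbispace Y) :=
  Quot (DirectlyEquivalent (O := O) (P := P))

section Trivial

lemma eq_component_inter_self {M : Type u} [TopologicalSpace M] {W : Set M} (hc : IsConnected W) :
    ∃ p ∈ W ∩ W, W = connectedComponentIn (W ∩ W) p := by
  obtain ⟨p, hp⟩ := hc.nonempty
  refine ⟨p, ⟨hp, hp⟩, ?_⟩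
  rw [inter_self]
  exact (hc.isPreconnected.connectedComponentIn hp).symm

variable {M : Type u} [TopologicalSpace M] [LocallyConnectedSpace M]

/-- The trivial `G`-structure on a connected open set. -/
def trivialGStructure (W : Set M) (hW : IsOpen W) (hc : IsConnected W) : GStructure W :=
  letI : MulAction PUnit.{u+1} W :=
    { smul := fun _ x => x, one_smul := fun _ => rfl, mul_smul := fun _ _ _ => rfl }
  haveI : ConnectedSpace W := isConnected_iff_connectedSpace.1 hc
  haveI : LocallyConnectedSpace W := hW.isOpenEmbedding_subtypeVal.locallyConnectedSpace
  { Cov := W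
    Grp := PUnit.{u+1}
    contAction := ⟨continuous_snd⟩
    proj := id
    isQuotientMap_proj := .id
    proj_eq_iff := fun _ _ => ⟨fun h => ⟨1, h⟩, fun ⟨_, h⟩ => h⟩ }

/-- The inclusions of a connected component `C` of `W ∩ W'` into `W` and `W'`, as an isomorphism
of (induced) trivial `G`-structures. -/
noncomputable def trivialIso {W W' : Set M} (hW : IsOpen W) (hc : IsConnected W)
    (hW' : IsOpen W') (hc' : IsConnected W') (C : Set M)
    (hC : ∃ p ∈ W ∩ W', C = connectedComponentIn (W ∩ W') p) :
    InducedIso (trivialGStructure W hW hc) (trivialGStructure W' hW' hc') :=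
  let e : OpenPartialHomeomorph W M :=
    Opens.openPartialHomeomorphSubtypeCoe ⟨W, hW⟩ hc.nonempty.to_subtype
  let e' : OpenPartialHomeomorph W' M :=
    Opens.openPartialHomeomorphSubtypeCoe ⟨W', hW'⟩ hc'.nonempty.to_subtype
  have hCo : IsOpen C := by
    obtain ⟨p, -, rfl⟩ := hC
    exact (hW.inter hW').connectedComponentIn
  have hCs : C ⊆ W ∩ W' := by
    obtain ⟨p, -, rfl⟩ := hC
    exact connectedComponentIn_subset _ _
  have hCc : IsConnected C := by
    obtain ⟨p, hp, rfl⟩ := hC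
    exact isConnected_connectedComponentIn_iff.2 hp
  let m : OpenPartialHomeomorph W W' :=
    (e.trans e'.symm).restrOpen (Subtype.val ⁻¹' C) (hCo.preimage continuous_subtype_val)
  have hsrc : m.source = Subtype.val ⁻¹' C := by
    ext x
    have : e x = x := rfl
    simp only [m, OpenPartialHomeomorph.restrOpen_source, OpenPartialHomeomorph.trans_source,
      mem_inter_iff, mem_preimage]
    constructor
    · exact fun h => h.2
    · intro h
      refine ⟨⟨trivial, ?_⟩, h⟩
      simp [e', this, (hCs h).2]
  have hval : ∀ x ∈ m.source, ((m x : W') : M) = x := by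
    intro x hx
    have h1 : (x : M) ∈ e'.target := by
      rw [hsrc] at hx
      simp [e', (hCs hx).2]
    exact e'.right_inv h1
  have htgt : m.target = Subtype.val ⁻¹' C := by
    ext y
    constructor
    · intro hy
      have h1 := m.map_target hy
      have h2 := hval _ h1
      rw [m.right_inv hy] at h2
      rw [hsrc] at h1
      simpa [h2] using h1
    · intro hy
      have h1 : (⟨y, (hCs hy).1⟩ : W) ∈ m.source := by rw [hsrc]; exact hy
      have h2 : m ⟨y, (hCs hy).1⟩ = y := Subtype.ext (hval _ h1)
      rw [← h2]
      exact m.map_source h1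
  have hconn : ∀ {Z : Set M} (_ : C ⊆ Z), IsPreconnected (Subtype.val ⁻¹' C : Set Z) := by
    intro Z hZ
    rw [← IsInducing.subtypeVal.isPreconnected_image, Subtype.image_preimage_coe,
      inter_eq_right.2 hZ]
    exact hCc.isPreconnected
  { base := C
    map := m
    hom :=
      { toFun := fun _ => 1
        invFun := fun _ => 1
        left_inv := fun _ => Subtype.ext rfl
        right_inv := fun _ => Subtype.ext rfl
        map_mul' := fun _ _ => Subtype.ext rfl
        continuous_toFun := continuous_const
        continuous_invFun := continuous_const }
    base_eq := hC
    source_eq := by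
      obtain ⟨p, hp⟩ := hCc.nonempty
      refine ⟨⟨p, (hCs hp).1⟩, hp, ?_⟩
      rw [hsrc]
      exact ((hconn fun _ h => (hCs h).1).connectedComponentIn hp).symm
    target_eq := by
      obtain ⟨p, hp⟩ := hCc.nonempty
      refine ⟨⟨p, (hCs hp).2⟩, hp, ?_⟩
      rw [htgt]
      exact ((hconn fun _ h => (hCs h).2).connectedComponentIn hp).symm
    proj_map := hval
    map_smul := fun _ _ _ => rfl }

lemma mem_source_trivialIso {W W' : Set M} (hW : IsOpen W) (hc : IsConnected W)
    (hW' : IsOpen W') (hc' : IsConnected W') (C : Set M)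
    (hC : ∃ p ∈ W ∩ W', C = connectedComponentIn (W ∩ W') p) (x : W) :
    x ∈ (trivialIso hW hc hW' hc' C hC).map.source ↔ (x : M) ∈ C := by
  obtain ⟨z, hz, hs⟩ := (trivialIso hW hc hW' hc' C hC).source_eq
  constructor
  · intro hx
    rw [hs] at hx
    have := connectedComponentIn_subset _ _ hx
    exact this
  · intro hx
    have hCs : C ⊆ W ∩ W' := by
      obtain ⟨p, -, rfl⟩ := hC
      exact connectedComponentIn_subset _ _
    change x ∈ ((Opens.openPartialHomeomorphSubtypeCoe ⟨W, hW⟩ hc.nonempty.to_subtype).trans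
      (Opens.openPartialHomeomorphSubtypeCoe ⟨W', hW'⟩ hc'.nonempty.to_subtype).symm).source
        ∩ Subtype.val ⁻¹' C
    refine ⟨?_, hx⟩
    rw [OpenPartialHomeomorph.trans_source]
    refine ⟨trivial, ?_⟩
    simp [(hCs hx).2]

lemma coe_trivialIso {W W' : Set M} (hW : IsOpen W) (hc : IsConnected W)
    (hW' : IsOpen W') (hc' : IsConnected W') (C : Set M)
    (hC : ∃ p ∈ W ∩ W', C = connectedComponentIn (W ∩ W') p) (x : W) (hx : (x : M) ∈ C) :
    ((trivialGStructure W' hW' hc').proj ((trivialIso hW hc hW' hc' C hC).map x) : M) = x :=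
  (trivialIso hW hc hW' hc' C hC).proj_map x ((mem_source_trivialIso _ _ _ _ _ _ _).2 hx)

lemma trivial_homRel {W W' : Set M} {hW : IsOpen W} {hc : IsConnected W}
    {hW' : IsOpen W'} {hc' : IsConnected W'}
    (t : InducedIso (trivialGStructure W hW hc) (trivialGStructure W' hW' hc'))
    (g : (trivialGStructure W hW hc).Grp) (h : (trivialGStructure W' hW' hc').Grp) :
    t.HomRel g h := by
  refine ⟨?_, rfl⟩
  rw [MulAction.mem_stabilizer_iff]
  exact image_id t.map.source

lemma mem_overlap_trivialIso {W₁ W₂ W₃ : Set M} {h₁ : IsOpen W₁} {c₁ : IsConnected W₁}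
    {h₂ : IsOpen W₂} {c₂ : IsConnected W₂} {h₃ : IsOpen W₃} {c₃ : IsConnected W₃}
    {C D : Set M} {hC : ∃ p ∈ W₁ ∩ W₂, C = connectedComponentIn (W₁ ∩ W₂) p}
    {hD : ∃ p ∈ W₂ ∩ W₃, D = connectedComponentIn (W₂ ∩ W₃) p} {x : W₁} :
    x ∈ (trivialIso h₂ c₂ h₃ c₃ D hD).overlap (trivialIso h₁ c₁ h₂ c₂ C hC) ↔
      (x : M) ∈ C ∧ (x : M) ∈ D := by
  constructor
  · rintro ⟨h, h'⟩
    have hx := (mem_source_trivialIso _ _ _ _ _ _ _).1 h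
    have hx' : ((trivialGStructure W₂ h₂ c₂).proj ((trivialIso h₁ c₁ h₂ c₂ C hC).map x) : M) ∈ D :=
      (mem_source_trivialIso _ _ _ _ _ _ _).1 h'
    rw [coe_trivialIso _ _ _ _ _ _ _ hx] at hx'
    exact ⟨hx, hx'⟩
  · rintro ⟨h, h'⟩
    refine ⟨(mem_source_trivialIso _ _ _ _ _ _ _).2 h, (mem_source_trivialIso _ _ _ _ _ _ _).2 ?_⟩
    change ((trivialGStructure W₂ h₂ c₂).proj ((trivialIso h₁ c₁ h₂ c₂ C hC).map x) : M) ∈ D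
    rw [coe_trivialIso _ _ _ _ _ _ _ h]
    exact h'

lemma mem_of_mem_overlap {W₁ W₂ W₃ : Set M} {h₁ : IsOpen W₁} {c₁ : IsConnected W₁}
    {h₂ : IsOpen W₂} {c₂ : IsConnected W₂} {h₃ : IsOpen W₃} {c₃ : IsConnected W₃}
    {C D : Set M} {hC : ∃ p ∈ W₁ ∩ W₂, C = connectedComponentIn (W₁ ∩ W₂) p}
    {hD : ∃ p ∈ W₂ ∩ W₃, D = connectedComponentIn (W₂ ∩ W₃) p} {x : W₁}
    (hx : x ∈ (trivialIso h₂ c₂ h₃ c₃ D hD).overlap (trivialIso h₁ c₁ h₂ c₂ C hC)) :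
    (x : M) ∈ W₁ ∩ W₃ ∧ (x : M) ∈ C ∧ (x : M) ∈ D := by
  have h := mem_overlap_trivialIso.1 hx
  refine ⟨⟨x.2, ?_⟩, h⟩
  obtain ⟨p, -, rfl⟩ := hD
  exact (connectedComponentIn_subset _ _ h.2).2

variable (M) in
/-- The trivial orbispace structure: all connected open sets are basic, with themselves as covers
and trivial groups. The transition maps from `W` to `W'` are the components of `W ∩ W'`. -/
noncomputable def trivialOrbispace : Orbispace M where
  basic := {W | IsOpen W ∧ IsConnected W}
  isConnected_basic := fun _ h => h.2
  isTopologicalBasis := by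
    refine isTopologicalBasis_of_isOpen_of_nhds (fun _ h => h.1) ?_
    intro a u ha hu
    exact ⟨connectedComponentIn u a, ⟨hu.connectedComponentIn,
      isConnected_connectedComponentIn_iff.2 ha⟩, mem_connectedComponentIn ha,
      connectedComponentIn_subset _ _⟩
  chart := fun W => trivialGStructure W.1 W.2.1 W.2.2
  Tran := fun W W' => {C : Set M // ∃ p ∈ (W : Set M) ∩ W',
    C = connectedComponentIn ((W : Set M) ∩ W') p}
  iso := fun {W W'} C => trivialIso W.2.1 W.2.2 W'.2.1 W'.2.2 C.1 C.2
  exists_tran := fun W W' p hp => ⟨⟨_, p, hp, rfl⟩, mem_connectedComponentIn hp⟩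
  act := fun _ t _ => t
  act_one := fun _ => rfl
  act_act := fun _ _ _ _ _ => rfl
  source_act := fun _ _ _ => rfl
  map_act := fun _ _ _ _ _ => rfl
  hom_act := fun _ _ _ _ _ => ⟨fun _ => trivial_homRel _ _ _, fun _ => trivial_homRel _ _ _⟩
  exists_eq_act := fun t₁ t₂ h => ⟨1, 1, Subtype.ext h.symm⟩
  act_eq_self_iff := fun _ _ _ => ⟨fun _ => trivial_homRel _ _ _, fun _ => rfl⟩
  one := fun W => ⟨W, eq_component_inter_self W.2.2⟩
  source_one := fun W => by
    ext x
    simp only [mem_univ, iff_true]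
    exact (mem_source_trivialIso _ _ _ _ _ _ _).2 x.2
  map_one := fun W x => Subtype.ext (coe_trivialIso W.2.1 W.2.2 W.2.1 W.2.2 _
    (eq_component_inter_self W.2.2) x x.2)
  hom_one := fun _ _ _ => ⟨fun _ => rfl, fun _ => trivial_homRel _ _ _⟩
  comp := fun {U V W} s t x hx => ⟨connectedComponentIn ((U : Set M) ∩ W) x.1, x.1,
    (mem_of_mem_overlap hx).1, rfl⟩
  comp_const := fun {U V W} s t x y hx hy hxy => by
    refine Subtype.ext (connectedComponentIn_eq ?_).symm
    have h1 : IsPreconnected ((Subtype.val : ↥U.1 → M) '' connectedComponentIn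
        ((trivialIso V.2.1 V.2.2 W.2.1 W.2.2 s.1 s.2).overlap
          (trivialIso U.2.1 U.2.2 V.2.1 V.2.2 t.1 t.2)) x) :=
      isPreconnected_connectedComponentIn.image _ continuous_subtype_val.continuousOn
    refine h1.subset_connectedComponentIn ⟨x, mem_connectedComponentIn hx, rfl⟩ ?_ ⟨y, hxy, rfl⟩
    rintro _ ⟨z, hz, rfl⟩
    exact (mem_of_mem_overlap (connectedComponentIn_subset _ _ hz)).1
  source_comp := fun s t x hx => (mem_source_trivialIso _ _ _ _ _ _ _).2
    (mem_connectedComponentIn (mem_of_mem_overlap hx).1)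
  map_comp := fun {U V W} s t x hx => by
    have h := mem_of_mem_overlap hx
    refine Subtype.ext ?_
    have h1 := coe_trivialIso U.2.1 U.2.2 W.2.1 W.2.2 _ ⟨x.1, h.1, rfl⟩ x
      (mem_connectedComponentIn h.1)
    have h2 := coe_trivialIso U.2.1 U.2.2 V.2.1 V.2.2 t.1 t.2 x h.2.1
    have h3 := coe_trivialIso V.2.1 V.2.2 W.2.1 W.2.2 s.1 s.2
      ((trivialIso U.2.1 U.2.2 V.2.1 V.2.2 t.1 t.2).map x) (h2.symm ▸ h.2.2)
    exact h1.trans (h3.trans h2).symm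
  hom_comp := fun _ _ _ _ _ _ _ _ _ _ => trivial_homRel _ _ _
  comp_assoc := fun _ _ _ _ _ _ _ _ => rfl
  comp_one := fun {U V} t g x hx => by
    obtain ⟨C, p, hp, rfl⟩ := t
    exact Subtype.ext (connectedComponentIn_eq (mem_of_mem_overlap hx).2.2).symm
  one_comp := fun {U V} t g x hx => by
    obtain ⟨C, p, hp, rfl⟩ := t
    exact Subtype.ext (connectedComponentIn_eq (mem_of_mem_overlap hx).2.1).symm

lemma trivial_isOpen (U : (trivialOrbispace M).basic) : IsOpen (U : Set M) :=
  (U.2 : IsOpen (U : Set M) ∧ IsConnected (U : Set M)).1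

lemma trivial_isConnected (U : (trivialOrbispace M).basic) : IsConnected (U : Set M) :=
  (U.2 : IsOpen (U : Set M) ∧ IsConnected (U : Set M)).2

/-- The component of `U ∩ V` that a transition map of the trivial orbispace structure is. -/
def trivialComponent {U V : (trivialOrbispace M).basic} (t : (trivialOrbispace M).Tran U V) :
    Set M :=
  Subtype.val (p := fun C : Set M => ∃ p ∈ (U : Set M) ∩ V,
    C = connectedComponentIn ((U : Set M) ∩ V) p) t

lemma trivialComponent_spec {U V : (trivialOrbispace M).basic}
    (t : (trivialOrbispace M).Tran U V) : ∃ p ∈ (U : Set M) ∩ V,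
      trivialComponent t = connectedComponentIn ((U : Set M) ∩ V) p :=
  Subtype.property (p := fun C : Set M => ∃ p ∈ (U : Set M) ∩ V,
    C = connectedComponentIn ((U : Set M) ∩ V) p) t

lemma trivialComponent_subset {U V : (trivialOrbispace M).basic}
    (t : (trivialOrbispace M).Tran U V) : trivialComponent t ⊆ (U : Set M) ∩ V := by
  obtain ⟨p, -, h⟩ := trivialComponent_spec t
  rw [h]
  exact connectedComponentIn_subset _ _

lemma trivialTran_ext {U V : (trivialOrbispace M).basic} {s t : (trivialOrbispace M).Tran U V}
    {x : M} (hs : x ∈ trivialComponent s) (ht : x ∈ trivialComponent t) : s = t := by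
  obtain ⟨p, -, h⟩ := trivialComponent_spec s
  obtain ⟨q, -, h'⟩ := trivialComponent_spec t
  refine Subtype.ext (?_ : trivialComponent s = trivialComponent t)
  rw [h] at hs ⊢
  rw [h'] at ht ⊢
  rw [connectedComponentIn_eq hs, connectedComponentIn_eq ht]

/-- The component of `U ∩ V` of a given point, as a transition map. -/
def trivialTran (U V : (trivialOrbispace M).basic) (p : M) (hp : p ∈ (U : Set M) ∩ V) :
    (trivialOrbispace M).Tran U V :=
  Subtype.mk (p := fun C : Set M => ∃ p ∈ (U : Set M) ∩ V,
    C = connectedComponentIn ((U : Set M) ∩ V) p) (connectedComponentIn ((U : Set M) ∩ V) p)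
    ⟨p, hp, rfl⟩

lemma mem_trivialComponent_trivialTran (U V : (trivialOrbispace M).basic) (p : M)
    (hp : p ∈ (U : Set M) ∩ V) : p ∈ trivialComponent (trivialTran U V p hp) :=
  mem_connectedComponentIn hp

lemma trivial_mem_src_iff {U V : (trivialOrbispace M).basic} (t : (trivialOrbispace M).Tran U V)
    (x : (trivialOrbispace M).Cov U) :
    x ∈ (trivialOrbispace M).src t ↔ (trivialOrbispace M).proj U x ∈ trivialComponent t :=
  mem_source_trivialIso (trivial_isOpen U) (trivial_isConnected U) (trivial_isOpen V) (trivial_isConnected V) (trivialComponent t) (trivialComponent_spec t) x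

lemma trivial_proj_app {U V : (trivialOrbispace M).basic} (t : (trivialOrbispace M).Tran U V)
    (x : (trivialOrbispace M).Cov U) (hx : (trivialOrbispace M).proj U x ∈ trivialComponent t) :
    (trivialOrbispace M).proj V ((trivialOrbispace M).app t x)
      = (trivialOrbispace M).proj U x :=
  coe_trivialIso (trivial_isOpen U) (trivial_isConnected U) (trivial_isOpen V) (trivial_isConnected V) (trivialComponent t) (trivialComponent_spec t) x hx

lemma trivial_mem_overlap_iff {U V W : (trivialOrbispace M).basic}
    (s : (trivialOrbispace M).Tran V W) (t : (trivialOrbispace M).Tran U V)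
    (x : (trivialOrbispace M).Cov U) :
    x ∈ ((trivialOrbispace M).iso s).overlap ((trivialOrbispace M).iso t) ↔
      (trivialOrbispace M).proj U x ∈ trivialComponent t ∧
        (trivialOrbispace M).proj U x ∈ trivialComponent s :=
  mem_overlap_trivialIso (h₁ := (trivial_isOpen U)) (c₁ := (trivial_isConnected U)) (h₂ := (trivial_isOpen V)) (c₂ := (trivial_isConnected V)) (h₃ := (trivial_isOpen W))
    (c₃ := (trivial_isConnected W)) (hC := trivialComponent_spec t) (hD := trivialComponent_spec s) (x := x)

lemma trivial_compAt_iff {U V W : (trivialOrbispace M).basic}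
    (s : (trivialOrbispace M).Tran V W) (t : (trivialOrbispace M).Tran U V)
    (x : (trivialOrbispace M).Cov U) (r : (trivialOrbispace M).Tran U W) :
    (trivialOrbispace M).CompAt s t x r ↔
      (trivialOrbispace M).proj U x ∈ trivialComponent t ∧
        (trivialOrbispace M).proj U x ∈ trivialComponent s ∧
        (trivialOrbispace M).proj U x ∈ trivialComponent r := by
  have key : ∀ hx, (trivialOrbispace M).proj U x ∈
      trivialComponent ((trivialOrbispace M).comp s t x hx) := fun hx =>
    (trivial_mem_src_iff _ _).1 ((trivialOrbispace M).source_comp s t x hx)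
  constructor
  · rintro ⟨hx, rfl⟩
    have h := (trivial_mem_overlap_iff _ _ _).1 hx
    exact ⟨h.1, h.2, key hx⟩
  · rintro ⟨h1, h2, h3⟩
    exact ⟨(trivial_mem_overlap_iff _ _ _).2 ⟨h1, h2⟩, trivialTran_ext (key _) h3⟩

/-- Transition maps of the trivial orbispace structure form a discrete space. -/
lemma trivial_isOpen_tran {U V : (trivialOrbispace M).basic}
    (s : Set ((trivialOrbispace M).Tran U V)) : IsOpen s := by
  refine isOpen_iSup_iff.2 fun t => isOpen_coinduced.2 ?_
  have : Subsingleton ((trivialOrbispace M).Grp V) := inferInstanceAs (Subsingleton PUnit.{u+1})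
  exact (isOpen_discrete _)

end Trivial

section Reparametrization

variable {M : Type u} [TopologicalSpace M] [LocallyConnectedSpace M]

/-- The preimage of a connected open set under a homeomorphism. -/
def trivialPreimage (h : M ≃ₜ M) (U : (trivialOrbispace M).basic) : (trivialOrbispace M).basic :=
  ⟨h ⁻¹' U, (trivial_isOpen U).preimage h.continuous,
    h.isConnected_preimage.2 (trivial_isConnected U)⟩

/-- The restriction of a homeomorphism to the preimage of a connected open set. -/
def trivialCovMap (h : M ≃ₜ M) (U : (trivialOrbispace M).basic) :
    C((trivialOrbispace M).Cov (trivialPreimage h U), (trivialOrbispace M).Cov U) :=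
  ⟨fun x : h ⁻¹' (U : Set M) => (⟨h x, x.2⟩ : (U : Set M)),
    (h.continuous.comp continuous_subtype_val).subtype_mk _⟩

/-- The image of a component under a homeomorphism. -/
def trivialTranMap (h : M ≃ₜ M) {U V : (trivialOrbispace M).basic}
    (t : (trivialOrbispace M).Tran (trivialPreimage h U) (trivialPreimage h V)) :
    (trivialOrbispace M).Tran U V :=
  Subtype.mk (p := fun C : Set M => ∃ p ∈ (U : Set M) ∩ V,
    C = connectedComponentIn ((U : Set M) ∩ V) p) (h.symm ⁻¹' trivialComponent t) (by
      obtain ⟨p, hp, hC⟩ := trivialComponent_spec t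
      refine ⟨h p, hp, ?_⟩
      rw [hC, h.preimage_symm, h.image_connectedComponentIn hp]
      congr 1
      change h '' (h ⁻¹' U ∩ h ⁻¹' V) = _
      rw [← preimage_inter, h.image_preimage])

/-- The preimage of a component under a homeomorphism. -/
def trivialTranComap (h : M ≃ₜ M) {U V : (trivialOrbispace M).basic}
    (t : (trivialOrbispace M).Tran U V) :
    (trivialOrbispace M).Tran (trivialPreimage h U) (trivialPreimage h V) :=
  Subtype.mk (p := fun C : Set M => ∃ p ∈ (trivialPreimage h U : Set M) ∩ trivialPreimage h V,
    C = connectedComponentIn ((trivialPreimage h U : Set M) ∩ trivialPreimage h V) p)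
    (h ⁻¹' trivialComponent t) (by
      obtain ⟨p, hp, hC⟩ := trivialComponent_spec t
      have hp' : h.symm p ∈ (trivialPreimage h U : Set M) ∩ trivialPreimage h V := by
        change h (h.symm p) ∈ (U : Set M) ∩ V
        simpa using hp
      refine ⟨h.symm p, hp', ?_⟩
      rw [hC, ← h.image_symm, h.symm.image_connectedComponentIn hp]
      congr 1
      rw [h.image_symm]
      rfl)

lemma trivial_proj_covMap (h : M ≃ₜ M) (U : (trivialOrbispace M).basic)
    (x : (trivialOrbispace M).Cov (trivialPreimage h U)) :
    (trivialOrbispace M).proj U (trivialCovMap h U x)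
      = h ((trivialOrbispace M).proj (trivialPreimage h U) x) := rfl

lemma trivial_proj_injective (U : (trivialOrbispace M).basic) :
    Function.Injective ((trivialOrbispace M).proj U) := fun _ _ h => Subtype.ext h

lemma mem_trivialTranMap (h : M ≃ₜ M) {U V : (trivialOrbispace M).basic}
    (t : (trivialOrbispace M).Tran (trivialPreimage h U) (trivialPreimage h V)) (x : M) :
    h x ∈ trivialComponent (trivialTranMap h t) ↔ x ∈ trivialComponent t := by
  change h.symm (h x) ∈ trivialComponent t ↔ _
  simp

lemma trivial_app_covMap (h : M ≃ₜ M) {U V : (trivialOrbispace M).basic}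
    (t : (trivialOrbispace M).Tran (trivialPreimage h U) (trivialPreimage h V))
    (t' : (trivialOrbispace M).Tran U V) (x : (trivialOrbispace M).Cov (trivialPreimage h U))
    (ht : (trivialOrbispace M).proj _ x ∈ trivialComponent t)
    (ht' : h ((trivialOrbispace M).proj _ x) ∈ trivialComponent t') :
    trivialCovMap h V ((trivialOrbispace M).app t x)
      = (trivialOrbispace M).app t' (trivialCovMap h U x) := by
  apply trivial_proj_injective
  rw [trivial_proj_covMap, trivial_proj_app t x ht, trivial_proj_app t' (trivialCovMap h U x) ht']
  rfl

variable {Y : Type v} [TopologicalSpace Y] [LocallyConnectedSpace Y] {P : Orbispace Y}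

/-- The composition of a system, defined on a trivial orbispace, with a homeomorphism. -/
noncomputable def OrbiSystem.reparam (h : M ≃ₜ M) {L : Type u} {U : L → (trivialOrbispace M).basic}
    {U' : L → P.basic} (σ : OrbiSystem (trivialOrbispace M) P U U') :
    OrbiSystem (trivialOrbispace M) P (fun a => trivialPreimage h (U a)) U' where
  f := fun a => (σ.f a).comp (trivialCovMap h (U a))
  rho := fun a b t => σ.rho a b (trivialTranMap h t)
  cover := by
    have := congrArg (fun s => h ⁻¹' s) σ.cover
    rw [preimage_iUnion, preimage_univ] at this
    exact this
  continuous_rho := fun a b => ⟨fun s _ => trivial_isOpen_tran _⟩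
  f_app := fun a b t x hx => by
    have hx1 := (trivial_mem_src_iff t x).1 hx
    have hx2 := (mem_trivialTranMap h t _).2 hx1
    have := σ.f_app a b (trivialTranMap h t) (trivialCovMap h (U a) x)
      ((trivial_mem_src_iff _ _).2 hx2)
    refine ⟨this.1, ?_⟩
    rw [← trivial_app_covMap h t _ x hx1 hx2] at this
    exact this.2
  rho_comp := fun a b c t s x r hr => by
    rw [trivial_compAt_iff] at hr
    refine σ.rho_comp a b c _ _ (trivialCovMap h (U a) x) _ ((trivial_compAt_iff _ _ _ _).2 ?_)
    rw [trivial_proj_covMap, mem_trivialTranMap, mem_trivialTranMap, mem_trivialTranMap]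
    exact hr

lemma OrbiSystem.IsRefinement.reparam (h : M ≃ₜ M) {L K : Type u}
    {U : L → (trivialOrbispace M).basic} {U' : L → P.basic} {V : K → (trivialOrbispace M).basic}
    {V' : K → P.basic} {σ : OrbiSystem (trivialOrbispace M) P U U'}
    {τ : OrbiSystem (trivialOrbispace M) P V V'} (hr : σ.IsRefinement τ) :
    (σ.reparam h).IsRefinement (τ.reparam h) := by
  obtain ⟨θ, hθ, i, i', h1, h2⟩ := hr
  have hfull : ∀ k, ∀ x ∈ (V k : Set M), x ∈ trivialComponent (i k) := by
    intro k x hx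
    obtain ⟨p, hp, hC⟩ := trivialComponent_spec (i k)
    rw [inter_eq_left.2 (hθ k)] at hC hp
    rw [hC, (trivial_isConnected (V k)).isPreconnected.connectedComponentIn hp]
    exact hx
  refine ⟨θ, fun k => preimage_mono (hθ k), fun k => trivialTranComap h (i k), i', ?_, ?_⟩
  · intro k x
    have h3 := h1 k (trivialCovMap h (V k) x)
    have h4 := hfull k (h ((trivialOrbispace M).proj _ x)) (trivialCovMap h (V k) x).2
    rw [← trivial_app_covMap h (trivialTranComap h (i k)) _ x h4 h4] at h3
    exact h3
  · intro k l t s x r hr1 hr2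
    have h3 := h2 k l (trivialTranMap h t) (trivialTranMap h s) (trivialCovMap h (V k) x)
    rw [trivial_compAt_iff] at hr1 hr2
    refine h3 (trivialTranMap h r) ?_ ?_
    · rw [trivial_compAt_iff, trivial_proj_covMap, mem_trivialTranMap, mem_trivialTranMap]
      exact hr1
    · rw [trivial_compAt_iff, trivial_proj_covMap, mem_trivialTranMap, mem_trivialTranMap]
      exact hr2

/-- Composition of a morphism, defined on a trivial orbispace, with a homeomorphism. -/
noncomputable def OrbiMorphism.reparam (h : M ≃ₜ M) :
    OrbiMorphism (trivialOrbispace M) P → OrbiMorphism (trivialOrbispace M) P :=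
  Quot.map (fun σ => ⟨σ.L, fun a => trivialPreimage h (σ.U a), σ.U', σ.sys.reparam h⟩) (by
    rintro σ τ ⟨K, V, V', σ', τ', h1, h2, d, hd, hd'⟩
    exact ⟨K, fun k => trivialPreimage h (V k), V', σ'.reparam h, τ'.reparam h, h1.reparam h,
      h2.reparam h, d, fun a x => hd a _, fun a b t => hd' a b _⟩)

lemma OrbiMorphism.reparam_refl (γ : OrbiMorphism (trivialOrbispace M) P) :
    γ.reparam (Homeomorph.refl M) = γ := by
  induction γ using Quot.ind
  rfl

lemma OrbiMorphism.reparam_trans (h k : M ≃ₜ M) (γ : OrbiMorphism (trivialOrbispace M) P) :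
    γ.reparam (h.trans k) = (γ.reparam k).reparam h := by
  induction γ using Quot.ind
  rfl

end Reparametrization

section FreeLoopSpace

instance : LocallyConnectedSpace UnitAddCircle :=
  haveI : LocallyPathConnectedSpace UnitAddCircle :=
    (QuotientAddGroup.isQuotientMap_mk
      (N := AddSubgroup.zmultiples (1 : ℝ))).locallyPathConnectedSpace
  inferInstance

variable {X : Type u} [TopologicalSpace X] [LocallyConnectedSpace X]

/-- The free loop space of an orbispace: the morphisms from `S¹ = ℝ / ℤ`, with the trivial
orbispace structure, into it. -/
def FreeLoopSpace (O : Orbispace X) := OrbiMorphism (trivialOrbispace UnitAddCircle) O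

/-- The action of `S¹` by rotation of the domain, `(s +ᵥ γ) t = γ (t + s)`. -/
noncomputable instance (O : Orbispace X) : AddAction UnitAddCircle (FreeLoopSpace O) where
  vadd s γ := OrbiMorphism.reparam (Homeomorph.addRight s) γ
  zero_vadd γ := by
    have : Homeomorph.addRight (0 : UnitAddCircle) = Homeomorph.refl _ := by ext; simp
    exact (congrArg (fun h => OrbiMorphism.reparam h γ) this).trans (OrbiMorphism.reparam_refl γ)
  add_vadd s t γ := by
    have : Homeomorph.addRight (s + t) = (Homeomorph.addRight s).trans (Homeomorph.addRight t) := by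
      ext x
      simp [add_assoc]
    exact (congrArg (fun h => OrbiMorphism.reparam h γ) this).trans
      (OrbiMorphism.reparam_trans _ _ γ)

/-- The compact-open topology on the free loop space. A subbasic open set consists of all loops
which are represented by a system over a given finite chain of open intervals (proper connected
open subsets of `S¹`) `I 0, …, I n`, in which only neighbours meet, and given basic open sets
`U k`, and whose maps send given compact sets `K k` into given open sets `V k` and whose
transition maps lie in given open sets. -/
instance (O : Orbispace X) : TopologicalSpace (FreeLoopSpace O) :=
  TopologicalSpace.generateFrom {S | ∃ (n : ℕ)
    (I : Fin (n + 1) → (trivialOrbispace UnitAddCircle).basic) (U : Fin (n + 1) → O.basic)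
    (K : ∀ k, Set ((trivialOrbispace UnitAddCircle).Cov (I k))) (V : ∀ k, Set (O.Cov (U k)))
    (A : ∀ k l, (trivialOrbispace UnitAddCircle).Tran (I k) (I l) → Set (O.Tran (U k) (U l))),
    (∀ k, (I k : Set UnitAddCircle) ≠ univ) ∧
    (∀ k l, ((I k : Set UnitAddCircle) ∩ I l).Nonempty → l = k ∨ l = k + 1 ∨ k = l + 1) ∧
    (∀ k, IsCompact (K k)) ∧ (∀ k, IsOpen (V k)) ∧ (∀ k l C, IsOpen (A k l C)) ∧
    S = {γ | ∃ σ : OrbiSystem (trivialOrbispace UnitAddCircle) O I U,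
      γ = Quot.mk _ ⟨Fin (n + 1), I, U, σ⟩ ∧
      (∀ k, MapsTo (σ.f k) (K k) (V k)) ∧ ∀ k l C, σ.rho k l C ∈ A k l C}}

end FreeLoopSpace

section TwistedSectors

namespace Orbispace

variable {X : Type u} [TopologicalSpace X] [LocallyConnectedSpace X] (O : Orbispace X)

lemma exists_basic (p : X) : ∃ U : O.basic, p ∈ (U : Set X) := by
  obtain ⟨U, hU, hp, -⟩ := O.isTopologicalBasis.exists_subset_of_mem_open (mem_univ p) isOpen_univ
  exact ⟨⟨U, hU⟩, hp⟩

lemma proj_mem (U : O.basic) (x : O.Cov U) : O.proj U x ∈ (U : Set X) :=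
  ((O.chart U).proj x).2

lemma proj_eq_proj_iff (U : O.basic) (x y : O.Cov U) :
    O.proj U x = O.proj U y ↔ ∃ g : O.Grp U, g • x = y := by
  rw [← (O.chart U).proj_eq_iff]
  exact Subtype.ext_iff.symm

lemma exists_proj_eq (U : O.basic) (p : X) (hp : p ∈ (U : Set X)) :
    ∃ x : O.Cov U, O.proj U x = p := by
  obtain ⟨x, hx⟩ := (O.chart U).isQuotientMap_proj.surjective ⟨p, hp⟩
  exact ⟨x, congrArg Subtype.val hx⟩

/-- A chosen basic open set around `p`. -/
noncomputable def basicAt (p : X) : O.basic := (O.exists_basic p).choose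

/-- A chosen point over `p`. -/
noncomputable def liftAt (p : X) : O.Cov (O.basicAt p) :=
  (O.exists_proj_eq (O.basicAt p) p (O.exists_basic p).choose_spec).choose

lemma proj_liftAt (p : X) : O.proj (O.basicAt p) (O.liftAt p) = p :=
  (O.exists_proj_eq (O.basicAt p) p (O.exists_basic p).choose_spec).choose_spec

/-- The isotropy group `G_p`: the stabilizer, in the local group, of a chosen point over `p`. -/
noncomputable abbrev Isotropy (p : X) : Subgroup (O.Grp (O.basicAt p)) :=
  MulAction.stabilizer (O.Grp (O.basicAt p)) (O.liftAt p)

/-- The space `{(p, (g)) | p ∈ X, g ∈ G_p}`, where `(g)` is the conjugacy class of `g` in the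
isotropy group `G_p`. -/
def TwistedSectors : Type u := Σ p : X, ConjClasses (O.Isotropy p)

variable {O}

/-- Points of two local covers over the same point of `X` are related by a transition map. -/
lemma exists_tran_app_eq {U V : O.basic} (x : O.Cov U) (y : O.Cov V)
    (h : O.proj U x = O.proj V y) : ∃ t : O.Tran U V, x ∈ O.src t ∧ O.app t x = y := by
  obtain ⟨t, ht⟩ := O.exists_tran U V (O.proj U x) ⟨O.proj_mem U x, h ▸ O.proj_mem V y⟩
  have hV : (O.proj V y) = (O.proj U x) := h.symm
  obtain ⟨z, hz, hzp⟩ := (O.iso t).exists_mem_source (O.isTopologicalBasis.isOpen U.2)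
    (O.isTopologicalBasis.isOpen V.2) _ ht
  obtain ⟨g, hg⟩ := (O.proj_eq_proj_iff U x z).1 hzp.symm
  have hx : x ∈ O.src (O.act 1 t g) := by
    rw [src, O.source_act]
    change g • x ∈ O.src t
    rwa [hg]
  have hp : O.proj V (O.app (O.act 1 t g) x) = O.proj V y := by
    rw [hV]
    exact (O.iso (O.act 1 t g)).proj_map x hx
  obtain ⟨h', hh'⟩ := (O.proj_eq_proj_iff V _ y).1 hp
  refine ⟨O.act h' (O.act 1 t g) 1, ?_, ?_⟩
  · rw [src, O.source_act]
    simpa using hx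
  · have := O.map_act (O.act 1 t g) h' 1 x (by simpa using hx)
    rw [one_smul] at this
    exact this.trans hh'

/-- The point `(p, (λ g))` of the space of twisted sectors given by a point `x` of a local cover
`Û` and an element `g` of the stabilizer of `x`, where `p` is the image of `x` and `(φ, λ)` is a
transition map with `φ x` the chosen point over `p`. -/
noncomputable def toSector (U : O.basic) (x : O.Cov U) (g : O.Grp U) (hg : g • x = x) :
    O.TwistedSectors :=
  let hex := exists_tran_app_eq x (O.liftAt (O.proj U x)) (O.proj_liftAt _).symm
  let t := hex.choose
  ⟨O.proj U x, ConjClasses.mk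
    ⟨(O.iso t).hom ⟨g, (O.iso t).mem_stabilizer hex.choose_spec.1 hg⟩, by
      have h := (O.iso t).map_smul ⟨g, (O.iso t).mem_stabilizer hex.choose_spec.1 hg⟩ x
        hex.choose_spec.1
      have h' : (O.iso t).map x = O.liftAt (O.proj U x) := hex.choose_spec.2
      rw [MulAction.mem_stabilizer_iff]
      rw [h'] at h
      rw [← h]
      exact (congrArg (O.iso t).map hg).trans h'⟩⟩

/-- The topology of the space of twisted sectors: the quotient topology from the disjoint union of
the spaces `{(x, g) ∈ Û × G_U | g • x = x}` over all basic open sets `U`. -/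
noncomputable instance : TopologicalSpace O.TwistedSectors :=
  TopologicalSpace.coinduced
    (fun q : Σ U : O.basic, {a : O.Cov U × O.Grp U // a.2 • a.1 = a.1} =>
      toSector q.1 q.2.1.1 q.2.1.2 q.2.2) inferInstance

end Orbispace

end TwistedSectors

section ConstantLoops

/-- The open interval of length `1 / 2` around `a`, in `S¹`. -/
def arcAt (a : ℝ) : (trivialOrbispace UnitAddCircle).basic :=
  ⟨(fun t : ℝ => (t : UnitAddCircle)) '' Ioo (a - 1 / 4) (a + 1 / 4),
    QuotientAddGroup.isOpenMap_coe _ isOpen_Ioo,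
    (isConnected_Ioo (by linarith)).image _ (AddCircle.continuous_mk' 1).continuousOn⟩

lemma round_add_round_of_mem_arcAt {a b c : ℝ} {x : UnitAddCircle}
    (ha : x ∈ (arcAt a : Set UnitAddCircle)) (hb : x ∈ (arcAt b : Set UnitAddCircle))
    (hc : x ∈ (arcAt c : Set UnitAddCircle)) :
    round (c - b) + round (b - a) = round (c - a) := by
  have key : ∀ {a b s t : ℝ}, s ∈ Ioo (a - 1 / 4) (a + 1 / 4) → t ∈ Ioo (b - 1 / 4) (b + 1 / 4) →
      (s : UnitAddCircle) = t → (round (b - a) : ℝ) = t - s := by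
    intro a b s t hs ht hst
    obtain ⟨n, hn⟩ := AddSubgroup.mem_zmultiples_iff.1 (QuotientAddGroup.eq.1 hst)
    have hn' : (n : ℝ) = t - s := by
      rw [zsmul_one] at hn
      linarith
    have : round (b - a) = n := by
      rw [round_eq, Int.floor_eq_iff]
      constructor <;> linarith [hs.1, hs.2, ht.1, ht.2]
    rw [this, hn']
  obtain ⟨s, hs, rfl⟩ := ha
  obtain ⟨t, ht, hts⟩ := hb
  obtain ⟨r, hr, hrs⟩ := hc
  have h1 := key hs ht hts.symm
  have h2 := key ht hr (hts.trans hrs.symm)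
  have h3 := key hs hr hrs.symm
  have : ((round (c - b) + round (b - a) : ℤ) : ℝ) = (round (c - a) : ℤ) := by
    push_cast
    linarith
  exact_mod_cast this

variable {X : Type u} [TopologicalSpace X] [LocallyConnectedSpace X] {O : Orbispace X}

open Orbispace

/-- The system over the intervals of length `1 / 2` in `S¹` whose maps are all constant, with value
`x`, and whose holonomy around `S¹` is `g`: it describes the constant path at `x` in `ℝ`, with
`x = g • x` as the periodicity condition. Seen from the intervals around `a` and around `b`, the
lifts of a common point to `ℝ` differ by `round (b - a)`. -/
noncomputable def constSystem (U : O.basic) (x : O.Cov U) (g : O.Grp U) (hg : g • x = x) :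
    OrbiSystem (trivialOrbispace UnitAddCircle) O arcAt (fun _ => U) where
  f := fun _ => ContinuousMap.const _ x
  rho := fun a b _ => O.ofGrp U (g ^ round (b - a))
  cover := by
    refine eq_univ_of_forall fun y => ?_
    obtain ⟨t, rfl⟩ := QuotientAddGroup.mk_surjective y
    exact mem_iUnion.2 ⟨t, t, ⟨by linarith, by linarith⟩, rfl⟩
  continuous_rho := fun _ _ => continuous_const
  f_app := fun a b _ y _ => by
    have hx : (1 : O.Grp U) • x ∈ O.src (O.one U) := by
      rw [src, O.source_one]
      trivial
    refine ⟨?_, ?_⟩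
    · rw [src, ofGrp, O.source_act]
      exact hx
    · have h1 := O.map_act (O.one U) (g ^ round (b - a)) 1 x hx
      rw [O.map_one, one_smul] at h1
      exact (h1.trans (zpow_mem (show g ∈ MulAction.stabilizer (O.Grp U) x from hg) _)).symm
  rho_comp := fun a b c t s y r hr => by
    rw [trivial_compAt_iff] at hr
    have h1 := round_add_round_of_mem_arcAt (trivialComponent_subset t hr.1).1
      (trivialComponent_subset t hr.1).2 (trivialComponent_subset s hr.2.1).2
    have hsrc : ∀ (k : O.Grp U) (z : O.Cov U), z ∈ O.src (O.ofGrp U k) := fun k z => by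
      rw [src, ofGrp, O.source_act, O.source_one]
      trivial
    refine ⟨⟨hsrc _ _, hsrc _ _⟩, ?_⟩
    rw [← h1, zpow_add]
    refine (O.one_comp _ _ _ _).trans ?_
    rw [ofGrp, O.act_act, mul_one]
    rfl

/-- The free loop that is constant at `x`, with holonomy `g`. -/
noncomputable def constLoop (U : O.basic) (x : O.Cov U) (g : O.Grp U) (hg : g • x = x) :
    FreeLoopSpace O :=
  Quot.mk _ ⟨ℝ, arcAt, fun _ => U, constSystem U x g hg⟩

end ConstantLoops

/-! A local point of an orbispace is a pair (U, x) with x in the local cover of U. The transition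
maps that carry one marked point to another are the morphisms of a groupoid on the local points. Its
connected components correspond to the points of X and its automorphism groups are the stabilizers,
so a point of the space of twisted sectors is the same as a conjugacy class of automorphisms in this
groupoid (`LocalPoint.toSector_eq_iff`).

A loop fixed by all rotations has a constant underlying map S¹ → X. Each map f_a of a system for it
sends a connected interval into one orbit of a finite group; this is a finite subset of a T₁ space,
hence discrete, and f_a is constant (`OrbiSystem.exists_isConst`). What remains of the system is a
locally constant cocycle on S¹ with values in the groupoid. Pulled back to ℝ it becomes trivial, and
translation by 1 changes a trivialization by an automorphism g, the holonomy, which is unique up to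
conjugation (`CircleCocycle.exists_trivialization`, `Trivialization.exists_conj`). Holonomy passes
in both directions along refinements and isomorphisms, so it is an invariant of the loop
(`HasHolonomy.of_mk_eq`). Conversely, systems with the same holonomy are directly equivalent
(`HasHolonomy.directlyEquivalent`). The loop c_{U,x,g} and all its rotations have holonomy g. Hence
the fixed loops are exactly the loops c_{U,x,g}, and two of these coincide if and only if they
define the same sector.

For the topologies, both spaces are quotients of the disjoint union of the spaces {(x, g) | gx = x}:
the twisted sectors by definition, the fixed loops by two facts. The loop c_{U,x,g} depends
continuously on (x, g) (`continuous_constLoop`), because a representing system is transported from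
(x, g) by finitely many transition maps that stay defined nearby. Conversely, a fixed loop near
c_{U,x,g} is c_{U,y,h} with (y, h) near (x, g) (`exists_isOpen_of_constLoop`): over three arcs, all
with the same chart U, y is the value on the first arc and h the inverse of the product of three
transition elements. The finite groups need not be discrete, so the smallest open neighbourhood
`nhdsKer {g}` plays the role of the point g. -/

section

open CategoryTheory

/-! ### The groupoid of local points of an orbispace -/

/-- A point of one of the local covers of an orbispace. -/
structure LocalPoint {X : Type u} [TopologicalSpace X] [LocallyConnectedSpace X]
    (O : Orbispace X) where
  chart : O.basic
  pt : O.Cov chart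

namespace Orbispace

variable {X : Type u} [TopologicalSpace X] [LocallyConnectedSpace X] (O : Orbispace X)

/-- The membership proof in `comp` depends on the two transition maps and on the point, so none of
them can be rewritten in place. -/
lemma comp_congr {U V W : O.basic} {s s' : O.Tran V W} {t t' : O.Tran U V} {x x' : O.Cov U}
    (hs : s = s') (ht : t = t') (hx : x = x') (h : x ∈ (O.iso s).overlap (O.iso t))
    (h' : x' ∈ (O.iso s').overlap (O.iso t')) : O.comp s t x h = O.comp s' t' x' h' := by
  subst hs ht hx
  rfl

lemma mem_src_ofGrp (U : O.basic) (g : O.Grp U) (x : O.Cov U) : x ∈ O.src (O.ofGrp U g) := by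
  rw [src, ofGrp, O.source_act, O.source_one]
  trivial

lemma app_ofGrp (U : O.basic) (g : O.Grp U) (x : O.Cov U) : O.app (O.ofGrp U g) x = g • x := by
  have hx : (1 : O.Grp U) • x ∈ O.src (O.one U) := by
    rw [src, O.source_one]
    trivial
  have h := O.map_act (O.one U) g 1 x hx
  rwa [O.map_one, one_smul] at h

lemma ofGrp_one (U : O.basic) : O.ofGrp U 1 = O.one U := O.act_one _

lemma act_ofGrp {U : O.basic} (g h : O.Grp U) : O.act h (O.ofGrp U g) 1 = O.ofGrp U (h * g) := by
  rw [ofGrp, O.act_act, mul_one]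
  rfl

/-- If g and h give the same transition map, then composition with g⁻¹h fixes the identity
transition map. Under the two-sided action the stabilizer of the identity is the diagonal, so g⁻¹h =
1. -/
lemma ofGrp_injective (U : O.basic) : Function.Injective (O.ofGrp U) := by
  intro g h hgh
  have h1 := congrArg (fun t => O.act h⁻¹ t 1) hgh
  simp only [act_ofGrp, inv_mul_cancel, ofGrp_one] at h1
  have h2 : O.act (g⁻¹ * h)⁻¹ (O.one U) 1 = O.one U := by simpa [ofGrp] using h1
  rw [O.act_eq_self_iff, O.hom_one] at h2
  exact inv_mul_eq_one.1 h2.symm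

lemma base_self {U : O.basic} (t : O.Tran U U) : (O.iso t).base = (U : Set X) := by
  obtain ⟨p, hp, h⟩ := (O.iso t).base_eq
  rw [h, inter_self] at *
  exact (O.isConnected_basic U U.2).isPreconnected.connectedComponentIn hp

/-- All self-transitions of U lie over the single component U of U ∩ U, so each has the form h⁻¹ ∘ 1
∘ g. As g⁻¹ ∘ 1 ∘ g = 1, this is the transition map of h⁻¹g. -/
lemma ofGrp_surjective (U : O.basic) : Function.Surjective (O.ofGrp U) := by
  intro t
  obtain ⟨h, g, rfl⟩ := O.exists_eq_act (O.one U) t (by rw [base_self, base_self])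
  refine ⟨h⁻¹ * g, ?_⟩
  have h1 := (O.act_eq_self_iff (O.one U) g g).2 ((O.hom_one U g g).2 rfl)
  conv_rhs => rw [← mul_one h⁻¹, ← one_mul g, ← O.act_act, O.act_one]
  nth_rw 2 [← one_mul g]
  have h2 : O.act h⁻¹ (O.act g (O.act g⁻¹ (O.one U) g) 1) 1 = O.ofGrp U (h⁻¹ * g) := by
    rw [h1, O.act_act, mul_one]; rfl
  rw [← h2, O.act_act, O.act_act]
  simp

end Orbispace

namespace LocalPoint

variable {X : Type u} [TopologicalSpace X] [LocallyConnectedSpace X] {O : Orbispace X}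

/-- A morphism of local points is a transition map that maps the first point to the second. -/
@[ext]
structure Hom (P Q : LocalPoint O) where
  tran : O.Tran P.chart Q.chart
  mem_src : P.pt ∈ O.src tran
  app_eq : O.app tran P.pt = Q.pt

/-- The composition of morphisms of local points. -/
def Hom.comp {P Q R : LocalPoint O} (f : Hom P Q) (g : Hom Q R) : Hom P R :=
  have h : P.pt ∈ (O.iso g.tran).overlap (O.iso f.tran) :=
    ⟨f.mem_src, (congrArg (· ∈ O.src g.tran) f.app_eq).mpr g.mem_src⟩
  { tran := O.comp g.tran f.tran P.pt h
    mem_src := O.source_comp _ _ _ h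
    app_eq := (O.map_comp _ _ _ h).trans ((congrArg (O.app g.tran) f.app_eq).trans g.app_eq) }

/-- The orbispace axioms speak of compositions on components of domains of definition. The marked
point selects the component, and the axioms then become the category laws. -/
instance : Category (LocalPoint O) where
  Hom := Hom
  id P := ⟨O.one P.chart, by rw [Orbispace.src, O.source_one]; trivial, O.map_one _ _⟩
  comp f g := f.comp g
  id_comp {P Q} f := Hom.ext (by
    have h : P.pt ∈ (O.iso f.tran).overlap (O.iso (O.act 1 (O.one P.chart) 1)) :=
      ⟨O.mem_src_ofGrp P.chart 1 P.pt,
        (congrArg (· ∈ O.src f.tran) (O.app_ofGrp P.chart 1 P.pt)).mpr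
          (by rw [one_smul]; exact f.mem_src)⟩
    refine Eq.trans ?_ ((O.comp_one f.tran 1 P.pt h).trans (O.act_one _))
    exact O.comp_congr rfl (O.act_one _).symm rfl _ _)
  comp_id {P Q} f := Hom.ext (by
    have h : P.pt ∈ (O.iso (O.act 1 (O.one Q.chart) 1)).overlap (O.iso f.tran) :=
      ⟨f.mem_src, O.mem_src_ofGrp Q.chart 1 _⟩
    refine Eq.trans ?_ ((O.one_comp f.tran 1 P.pt h).trans (O.act_one _))
    exact O.comp_congr (O.act_one _).symm rfl rfl _ _)
  assoc {P Q R S} f g k := Hom.ext (by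
    have h : P.pt ∈ (O.iso (k.tran)).overlap (O.iso (f.comp g).tran) :=
      ⟨(f.comp g).mem_src,
        (congrArg (· ∈ O.src k.tran) (f.comp g).app_eq).mpr k.mem_src⟩
    have h' : O.app f.tran P.pt ∈ (O.iso k.tran).overlap (O.iso g.tran) := by
      rw [f.app_eq]
      exact ⟨g.mem_src, (congrArg (· ∈ O.src k.tran) g.app_eq).mpr k.mem_src⟩
    refine (O.comp_assoc k.tran g.tran f.tran P.pt _ h h' ⟨f.mem_src, O.source_comp _ _ _ h'⟩).trans
      (O.comp_congr ?_ rfl rfl _ _)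
    exact O.comp_congr rfl rfl f.app_eq _ _)

/-- The element `g` of the stabilizer of a local point, as an automorphism of this point. -/
def ofStab (P : LocalPoint O) (g : O.Grp P.chart) (hg : g • P.pt = P.pt) : P ⟶ P :=
  Hom.mk (O.ofGrp P.chart g) (O.mem_src_ofGrp _ _ _) ((O.app_ofGrp _ _ _).trans hg)

lemma hom_ext {P Q : LocalPoint O} {f g : P ⟶ Q} (h : Hom.tran f = Hom.tran g) : f = g :=
  Hom.ext h

lemma tran_comp_ofStab {P Q : LocalPoint O} (f : P ⟶ Q) (h : O.Grp Q.chart)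
    (hh : h • Q.pt = Q.pt) : Hom.tran (f ≫ Q.ofStab h hh) = O.act h (Hom.tran f) 1 :=
  O.one_comp (Hom.tran f) h P.pt _

lemma tran_ofStab_comp {P Q : LocalPoint O} (f : P ⟶ Q) (g : O.Grp P.chart)
    (hg : g • P.pt = P.pt) : Hom.tran (P.ofStab g hg ≫ f) = O.act 1 (Hom.tran f) g :=
  O.comp_one (Hom.tran f) g P.pt _

lemma ofStab_one (P : LocalPoint O) : P.ofStab 1 (one_smul _ _) = 𝟙 P :=
  hom_ext (O.ofGrp_one _)

/-- The product is reversed because `≫` is in diagrammatic order. -/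
lemma ofStab_comp (P : LocalPoint O) (g h : O.Grp P.chart) (hg : g • P.pt = P.pt)
    (hh : h • P.pt = P.pt) : P.ofStab g hg ≫ P.ofStab h hh =
      P.ofStab (h * g) (by rw [mul_smul, hg, hh]) :=
  hom_ext ((tran_comp_ofStab _ _ _).trans (O.act_ofGrp _ _))

lemma ofStab_surjective (P : LocalPoint O) (f : P ⟶ P) : ∃ g hg, f = P.ofStab g hg := by
  obtain ⟨g, hg⟩ := O.ofGrp_surjective P.chart (Hom.tran f)
  refine ⟨g, ?_, hom_ext hg.symm⟩
  rw [← O.app_ofGrp, hg]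
  exact Hom.app_eq f

lemma ofStab_injective (P : LocalPoint O) {g h : O.Grp P.chart} {hg : g • P.pt = P.pt}
    {hh : h • P.pt = P.pt} (H : P.ofStab g hg = P.ofStab h hh) : g = h :=
  O.ofGrp_injective _ (congrArg Hom.tran H)

lemma proj_eq {P Q : LocalPoint O} (f : P ⟶ Q) : O.proj P.chart P.pt = O.proj Q.chart Q.pt := by
  rw [← Hom.app_eq f]
  exact ((O.iso (Hom.tran f)).proj_map _ (Hom.mem_src f)).symm

lemma nonempty_hom {P Q : LocalPoint O} (h : O.proj P.chart P.pt = O.proj Q.chart Q.pt) :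
    Nonempty (P ⟶ Q) := by
  obtain ⟨t, h1, h2⟩ := Orbispace.exists_tran_app_eq P.pt Q.pt h
  exact ⟨Hom.mk t h1 h2⟩

/-- Inverses are not among the orbispace axioms. Any transition map back from Q to P closes f up to
an automorphism of P, which is a group element and can be cancelled. -/
lemma exists_comp_eq_id {P Q : LocalPoint O} (f : P ⟶ Q) : ∃ f' : Q ⟶ P, f ≫ f' = 𝟙 P := by
  obtain ⟨k⟩ := nonempty_hom (proj_eq f).symm
  obtain ⟨g, hg, h⟩ := ofStab_surjective P (f ≫ k)
  refine ⟨k ≫ P.ofStab g⁻¹ (inv_smul_eq_iff.2 hg.symm), ?_⟩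
  rw [← Category.assoc, h, ofStab_comp, ← ofStab_one]
  congr 1
  simp

/-- Every morphism has a right inverse; since the right inverse has one as well, it is two-sided. -/
noncomputable instance : Groupoid (LocalPoint O) where
  inv f := (exists_comp_eq_id f).choose
  comp_inv f := (exists_comp_eq_id f).choose_spec
  inv_comp {P Q} f := by
    have h := (exists_comp_eq_id f).choose_spec
    set f' := (exists_comp_eq_id f).choose
    obtain ⟨f'', h'⟩ := exists_comp_eq_id f'
    have : f = f'' := by
      calc f = f ≫ (f' ≫ f'') := by rw [h', Category.comp_id]
        _ = f'' := by rw [← Category.assoc, h, Category.id_comp]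
    change f' ≫ f = 𝟙 Q
    rw [this, h']

lemma mem_stabilizer_tran {P Q : LocalPoint O} (f : P ⟶ Q) {g : O.Grp P.chart}
    (hg : g • P.pt = P.pt) : g ∈ MulAction.stabilizer _ (O.iso (Hom.tran f)).map.source :=
  (O.iso (Hom.tran f)).mem_stabilizer (Hom.mem_src f) hg

lemma hom_smul {P Q : LocalPoint O} (f : P ⟶ Q) {g : O.Grp P.chart}
    (hg : g • P.pt = P.pt) :
    ((O.iso (Hom.tran f)).hom ⟨g, mem_stabilizer_tran f hg⟩ : O.Grp Q.chart) • Q.pt = Q.pt := by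
  have h := (O.iso (Hom.tran f)).map_smul ⟨g, mem_stabilizer_tran f hg⟩ P.pt (Hom.mem_src f)
  have h' : (O.iso (Hom.tran f)).map P.pt = Q.pt := Hom.app_eq f
  rw [h'] at h
  rw [← h]
  exact (congrArg (O.iso (Hom.tran f)).map hg).trans h'

/-- This is the axiom λ(g)⁻¹ ∘ φ ∘ g = φ, read in the groupoid. -/
lemma ofStab_comp_eq {P Q : LocalPoint O} (f : P ⟶ Q) {g : O.Grp P.chart}
    (hg : g • P.pt = P.pt) :
    P.ofStab g hg ≫ f = f ≫ Q.ofStab _ (hom_smul f hg) := by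
  apply hom_ext
  rw [tran_comp_ofStab, tran_ofStab_comp]
  have h := (O.act_eq_self_iff (Hom.tran f)
    ((O.iso (Hom.tran f)).hom ⟨g, mem_stabilizer_tran f hg⟩) g).2 ⟨mem_stabilizer_tran f hg, rfl⟩
  have h' := congrArg (fun t => O.act
    ((O.iso (Hom.tran f)).hom ⟨g, mem_stabilizer_tran f hg⟩ : O.Grp Q.chart) t 1) h
  simpa [O.act_act] using h'

/-- The chosen local point over a point of an orbispace. -/
noncomputable abbrev base (p : X) : LocalPoint O := ⟨O.basicAt p, O.liftAt p⟩

/-- An element of the isotropy group as an automorphism of the chosen local point. -/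
noncomputable def ofIsotropy {p : X} (k : O.Isotropy p) : (base p : LocalPoint O) ⟶ base p :=
  ofStab (base p) k k.2

lemma ofIsotropy_comp {p : X} (k m : O.Isotropy p) :
    ofIsotropy k ≫ ofIsotropy m = ofIsotropy (m * k) :=
  ofStab_comp _ _ _ _ _

lemma ofIsotropy_injective {p : X} : Function.Injective (ofIsotropy (O := O) (p := p)) :=
  fun _ _ h => Subtype.ext (ofStab_injective _ h)

lemma ofIsotropy_surjective {p : X} : Function.Surjective (ofIsotropy (O := O) (p := p)) := by
  intro f
  obtain ⟨m, hm, h⟩ := ofStab_surjective _ f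
  exact ⟨⟨m, hm⟩, h.symm⟩

/-- The definition of `toSector` uses a chosen transition map to the base point. Any other morphism
f differs from it by an automorphism of the base point, that is, by an element of the isotropy
group, and this conjugates the result. -/
lemma toSector_eq_mk {P : LocalPoint O} {g : O.Grp P.chart} (hg : g • P.pt = P.pt) {p : X}
    (f : P ⟶ base p) {k : O.Isotropy p} (h : P.ofStab g hg ≫ f = f ≫ ofIsotropy k) :
    Orbispace.toSector P.chart P.pt g hg = ⟨p, ConjClasses.mk k⟩ := by
  have hp := (proj_eq f).trans (O.proj_liftAt p)
  subst hp
  refine Sigma.ext rfl (heq_of_eq ?_)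
  have hex := Orbispace.exists_tran_app_eq P.pt (O.liftAt (O.proj P.chart P.pt))
    (O.proj_liftAt _).symm
  let t : P ⟶ base (O.proj P.chart P.pt) :=
    Hom.mk hex.choose hex.choose_spec.1 hex.choose_spec.2
  let l : O.Isotropy (O.proj P.chart P.pt) :=
    ⟨(O.iso (Hom.tran t)).hom ⟨g, mem_stabilizer_tran t hg⟩, hom_smul t hg⟩
  change ConjClasses.mk l = _
  have ht : P.ofStab g hg ≫ t = t ≫ ofIsotropy l := ofStab_comp_eq t hg
  obtain ⟨m, hm⟩ := ofIsotropy_surjective (inv t ≫ f)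
  rw [ConjClasses.mk_eq_mk_iff_isConj, isConj_iff]
  refine ⟨m, mul_inv_eq_iff_eq_mul.2 (ofIsotropy_injective ?_)⟩
  rw [← ofIsotropy_comp, ← ofIsotropy_comp, hm, ← cancel_epi t, Category.assoc, ← h,
    ← Category.assoc, ← ht]
  simp

lemma exists_toSector_eq_mk (P : LocalPoint O) {g : O.Grp P.chart} (hg : g • P.pt = P.pt) :
    ∃ (f : P ⟶ base (O.proj P.chart P.pt)) (k : O.Isotropy (O.proj P.chart P.pt)),
      P.ofStab g hg ≫ f = f ≫ ofIsotropy k := by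
  obtain ⟨f⟩ : Nonempty (P ⟶ base (O.proj P.chart P.pt)) := nonempty_hom (O.proj_liftAt _).symm
  exact ⟨f, ⟨_, hom_smul f hg⟩, ofStab_comp_eq f hg⟩

/-- Two automorphisms of local points define the same point of the space of twisted sectors if
and only if they are conjugate. -/
lemma toSector_eq_iff {P Q : LocalPoint O} {g : O.Grp P.chart} (hg : g • P.pt = P.pt)
    {h : O.Grp Q.chart} (hh : h • Q.pt = Q.pt) :
    Orbispace.toSector P.chart P.pt g hg = Orbispace.toSector Q.chart Q.pt h hh ↔
      ∃ f : P ⟶ Q, P.ofStab g hg ≫ f = f ≫ Q.ofStab h hh := by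
  obtain ⟨b, k, hk⟩ := exists_toSector_eq_mk Q hh
  constructor
  · intro H
    obtain ⟨a, m, hm⟩ := exists_toSector_eq_mk P hg
    rw [toSector_eq_mk hg a hm, toSector_eq_mk hh b hk] at H
    generalize O.proj P.chart P.pt = p at *
    generalize O.proj Q.chart Q.pt = q at *
    obtain ⟨rfl, H⟩ := Sigma.mk.inj H
    have H := eq_of_heq H
    rw [ConjClasses.mk_eq_mk_iff_isConj, isConj_iff] at H
    obtain ⟨c, hc⟩ := H
    refine ⟨a ≫ ofIsotropy c ≫ inv b, ?_⟩
    rw [← Category.assoc, hm, ← cancel_mono b]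
    simp only [Category.assoc, IsIso.inv_hom_id, Category.comp_id]
    rw [hk, IsIso.inv_hom_id_assoc, ofIsotropy_comp, mul_inv_eq_iff_eq_mul.1 hc,
      ofIsotropy_comp]
  · rintro ⟨f, hf⟩
    rw [toSector_eq_mk hh b hk]
    refine toSector_eq_mk hg (f ≫ b) ?_
    rw [← Category.assoc, hf, Category.assoc, hk, Category.assoc]

end LocalPoint

/-! ### Locally constant cocycles on the circle with values in a groupoid -/

/-- A locally constant cocycle on an open cover of `S¹`, with values in a groupoid. -/
structure CircleCocycle (C : Type*) [Groupoid C] (L : Type*) where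
  U : L → Set UnitAddCircle
  isOpen_U : ∀ a, IsOpen (U a)
  exists_mem : ∀ z, ∃ a, z ∈ U a
  P : L → C
  rho : ∀ a b z, z ∈ U a → z ∈ U b → (P a ⟶ P b)
  rho_comp : ∀ a b c z ha hb hc, rho a b z ha hb ≫ rho b c z hb hc = rho a c z ha hc
  rho_eventually : ∀ a b z ha hb, ∀ᶠ z' in 𝓝 z, ∀ ha' hb', rho a b z' ha' hb' = rho a b z ha hb

namespace CircleCocycle

variable {C : Type*} [Groupoid C] {L K : Type*}

/-- A trivialization, over `ℝ`, of a cocycle on `S¹`, with holonomy `g`. -/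
structure Trivialization (c : CircleCocycle C L) {Q : C} (g : Q ⟶ Q) where
  w : ∀ a (t : ℝ), (t : UnitAddCircle) ∈ c.U a → (c.P a ⟶ Q)
  w_eventually : ∀ a t ht, ∀ᶠ t' in 𝓝 t, ∀ ht', w a t' ht' = w a t ht
  rho_comp : ∀ a b (t : ℝ) ha hb, c.rho a b t ha hb ≫ w b t hb = w a t ha
  w_add_one : ∀ a (t : ℝ) ht ht', w a (t + 1) ht' = w a t ht ≫ g

lemma tendsto_coe (t : ℝ) : Filter.Tendsto (fun s : ℝ => (s : UnitAddCircle)) (𝓝 t) (𝓝 t) :=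
  (AddCircle.continuous_mk' 1).continuousAt

/-- Two holonomies of the same cocycle are conjugate. -/
lemma Trivialization.exists_conj {c : CircleCocycle C L} {Q R : C} {g : Q ⟶ Q} {h : R ⟶ R}
    (T : c.Trivialization g) (S : c.Trivialization h) : ∃ k : Q ⟶ R, g ≫ k = k ≫ h := by
  choose a ha using c.exists_mem
  -- The quotient of the two trivializations does not depend on the member of the cover, so it is a
  -- locally constant function on ℝ and hence constant. Comparing its values at 0 and 1 yields the
  -- conjugation.
  let k : ℝ → (Q ⟶ R) := fun t => inv (T.w (a t) t (ha _)) ≫ S.w (a t) t (ha _)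
  have hk : ∀ b (t : ℝ) (hb : (t : UnitAddCircle) ∈ c.U b),
      k t = inv (T.w b t hb) ≫ S.w b t hb := by
    intro b t hb
    simp only [k]
    rw [← T.rho_comp (a t) b t (ha _) hb, ← S.rho_comp (a t) b t (ha _) hb]
    simp
  have hloc : IsLocallyConstant k := by
    rw [IsLocallyConstant.iff_eventually_eq]
    intro t
    filter_upwards [T.w_eventually (a t) t (ha _), S.w_eventually (a t) t (ha _),
      tendsto_coe t ((c.isOpen_U (a t)).mem_nhds (ha _))] with t' h1 h2 h3
    rw [hk (a t) t' h3, h1, h2]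
  have hconst := hloc.apply_eq_of_preconnectedSpace 0 (0 + 1)
  refine ⟨k 0, ?_⟩
  have h1 : ((0 + 1 : ℝ) : UnitAddCircle) ∈ c.U (a (0 : ℝ)) := by
    have : ((0 + 1 : ℝ) : UnitAddCircle) = (0 : ℝ) := by simp [AddCircle.coe_period]
    rw [this]
    exact ha _
  have h2 := hk (a (0 : ℝ)) (0 + 1) h1
  rw [← hconst, T.w_add_one _ 0 (ha _), S.w_add_one _ 0 (ha _)] at h2
  conv_lhs => rw [h2]
  simp [k]

/-- A morphism of cocycles over a refinement of the covers. -/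
structure Map (c : CircleCocycle C L) (d : CircleCocycle C K) where
  θ : K → L
  U_subset : ∀ k, d.U k ⊆ c.U (θ k)
  i : ∀ k, d.P k ⟶ c.P (θ k)
  rho_comp_i : ∀ k l z hk hl, d.rho k l z hk hl ≫ i l =
    i k ≫ c.rho (θ k) (θ l) z (U_subset k hk) (U_subset l hl)

/-- The restriction of a trivialization to a refinement. -/
def Trivialization.restrict {c : CircleCocycle C L} {d : CircleCocycle C K} (m : c.Map d) {Q : C}
    {g : Q ⟶ Q} (T : c.Trivialization g) : d.Trivialization g where
  w k t ht := m.i k ≫ T.w (m.θ k) t (m.U_subset k ht)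
  w_eventually k t ht := by
    filter_upwards [T.w_eventually (m.θ k) t (m.U_subset k ht)] with t' h ht'
    rw [h]
  rho_comp k l t hk hl := by
    rw [← Category.assoc, m.rho_comp_i, Category.assoc, T.rho_comp]
  w_add_one k t ht ht' := by
    rw [T.w_add_one _ t (m.U_subset k ht), Category.assoc]

/-- The extension of a trivialization of a refinement. -/
lemma Trivialization.nonempty_extend {c : CircleCocycle C L} {d : CircleCocycle C K} (m : c.Map d)
    {Q : C} {g : Q ⟶ Q} (T : d.Trivialization g) : Nonempty (c.Trivialization g) := by
  choose k hk using d.exists_mem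
  -- The extension is forced: pass from `a` to a member of the refinement that contains t and use
  -- `T` there. The result is independent of that member, by `hw`.
  let w : ∀ a (t : ℝ) (l : K), (t : UnitAddCircle) ∈ c.U a → (t : UnitAddCircle) ∈ d.U l →
      (c.P a ⟶ Q) :=
    fun a t l ht hl => c.rho a (m.θ l) t ht (m.U_subset _ hl) ≫ inv (m.i l) ≫ T.w l t hl
  have hw : ∀ a (t : ℝ) (k l : K) ht hk hl, w a t k ht hk = w a t l ht hl := by
    intro a t k l ht hk hl
    simp only [w]
    rw [← T.rho_comp k l t hk hl, ← c.rho_comp a (m.θ k) (m.θ l) t ht (m.U_subset _ hk)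
      (m.U_subset _ hl), Category.assoc]
    congr 1
    rw [← cancel_epi (m.i k), IsIso.hom_inv_id_assoc, ← Category.assoc (m.i k), ← m.rho_comp_i,
      Category.assoc, IsIso.hom_inv_id_assoc]
  refine ⟨⟨fun a t ht => w a t (k t) ht (hk t), ?_, ?_, ?_⟩⟩
  · intro a t ht
    filter_upwards [T.w_eventually (k t) t (hk _),
      tendsto_coe t ((d.isOpen_U (k t)).mem_nhds (hk _)),
      tendsto_coe t (c.rho_eventually a (m.θ (k t)) t ht (m.U_subset _ (hk _)))]
      with t' h1 h2 h3 ht'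
    rw [hw a t' (k t') (k t) ht' (hk t') h2]
    simp only [w]
    rw [h1, h3]
  · intro a b t ha hb
    simp only [w]
    rw [← Category.assoc, c.rho_comp]
  · intro a t ht ht'
    have h : ((t + 1 : ℝ) : UnitAddCircle) = t := by simp
    have h1 : ((t + 1 : ℝ) : UnitAddCircle) ∈ d.U (k t) := by
      rw [h]
      exact hk t
    rw [hw a (t + 1) _ (k t) ht' (hk _) h1]
    simp only [w]
    rw [T.w_add_one _ t (hk _) h1, Category.assoc, Category.assoc]
    congr 1
    simp only [h]

/-- Comparison of two trivializations with the same holonomy. -/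
lemma Trivialization.exists_compare {c : CircleCocycle C L} {d : CircleCocycle C K} {Q : C}
    {g : Q ⟶ Q} (T : c.Trivialization g) (S : d.Trivialization g) :
    ∃ u : ∀ a b z, z ∈ c.U a → z ∈ d.U b → (c.P a ⟶ d.P b),
      (∀ a b z ha hb, ∀ᶠ z' in 𝓝 z, ∀ ha' hb', u a b z' ha' hb' = u a b z ha hb) ∧
      ∀ a b a' b' z ha hb ha' hb', c.rho a a' z ha ha' ≫ u a' b' z ha' hb' =
        u a b z ha hb ≫ d.rho b b' z hb hb' := by
  -- The factors g that the two trivializations acquire under t ↦ t + 1 cancel in this quotient, so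
  -- it is periodic and descends to the circle.
  let v : ∀ a b (t : ℝ), (t : UnitAddCircle) ∈ c.U a → (t : UnitAddCircle) ∈ d.U b →
      (c.P a ⟶ d.P b) := fun a b t ha hb => T.w a t ha ≫ inv (S.w b t hb)
  have hv1 : ∀ a b (t : ℝ) ha hb ha' hb', v a b (t + 1) ha' hb' = v a b t ha hb := by
    intro a b t ha hb ha' hb'
    simp only [v]
    rw [T.w_add_one a t ha, S.w_add_one b t hb]
    simp
  have hper : ∀ (t : ℝ) (n : ℤ), ((t + n : ℝ) : UnitAddCircle) = t := by
    intro t n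
    rw [AddCircle.coe_add, add_eq_left]
    exact (AddCircle.coe_eq_zero_iff 1).2 ⟨n, by simp⟩
  have hv2 : ∀ a b (t : ℝ) (n : ℤ) ha hb ha' hb', v a b (t + n) ha' hb' = v a b t ha hb := by
    intro a b t n
    induction n with
    | zero => intro ha hb ha' hb'; simp
    | succ n ih =>
      intro ha hb ha' hb'
      have ha'' : ((t + (n : ℤ) : ℝ) : UnitAddCircle) ∈ c.U a := (hper t n).symm ▸ ha
      have hb'' : ((t + (n : ℤ) : ℝ) : UnitAddCircle) ∈ d.U b := (hper t n).symm ▸ hb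
      rw [← ih ha hb ha'' hb'', ← hv1 a b _ ha'' hb'' (by simpa [add_assoc] using ha')
        (by simpa [add_assoc] using hb')]
      congr 1
      push_cast
      ring
    | pred n ih =>
      intro ha hb ha' hb'
      have ha'' : ((t + (-n : ℤ) : ℝ) : UnitAddCircle) ∈ c.U a := (hper t (-n)).symm ▸ ha
      have hb'' : ((t + (-n : ℤ) : ℝ) : UnitAddCircle) ∈ d.U b := (hper t (-n)).symm ▸ hb
      rw [← ih ha hb ha'' hb'']
      have e : t + ((-n - 1 : ℤ) : ℝ) + 1 = t + (-n : ℤ) := by push_cast; ring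
      have := hv1 a b _ ha' hb' (e.symm ▸ ha'') (e.symm ▸ hb'')
      rw [← this]
      congr 1
  have hv3 : ∀ a b (s t : ℝ) ha hb ha' hb', (s : UnitAddCircle) = t →
      v a b s ha' hb' = v a b t ha hb := by
    intro a b s t ha hb ha' hb' h
    obtain ⟨n, hn⟩ := AddSubgroup.mem_zmultiples_iff.1 (QuotientAddGroup.eq.1 h.symm)
    have e : s = t + n := by
      rw [zsmul_one] at hn
      linarith
    subst e
    exact hv2 a b t n ha hb ha' hb'
  have hsec : ∀ z : UnitAddCircle, ∃ t : ℝ, (t : UnitAddCircle) = z :=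
    QuotientAddGroup.mk_surjective
  choose s hs using hsec
  refine ⟨fun a b z ha hb => v a b (s z) (by rwa [hs]) (by rwa [hs]), ?_, ?_⟩
  · intro a b z ha hb
    have ha₁ : (s z : UnitAddCircle) ∈ c.U a := by rwa [hs]
    have hb₁ : (s z : UnitAddCircle) ∈ d.U b := by rwa [hs]
    have hev : ∀ᶠ t in 𝓝 (s z), ∀ ha' hb', v a b t ha' hb' = v a b (s z) ha₁ hb₁ := by
      filter_upwards [T.w_eventually a _ ha₁, S.w_eventually b _ hb₁] with t h1 h2 ha' hb'
      simp only [v]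
      rw [h1, h2]
    -- Local constancy descends from ℝ to S¹ because the projection is open.
    have himg := (QuotientAddGroup.isOpenMap_coe (G := ℝ)
      (N := AddSubgroup.zmultiples (1 : ℝ))).image_mem_nhds hev
    have himg' : _ ∈ 𝓝 ((s z : ℝ) : UnitAddCircle) := himg
    rw [hs] at himg'
    filter_upwards [himg'] with z' hz' ha' hb'
    obtain ⟨t, ht, htz⟩ := hz'
    have htz : (t : UnitAddCircle) = z' := htz
    rw [hv3 a b (s z') t (by rwa [htz]) (by rwa [htz]) _ _ ((hs z').trans htz.symm)]
    exact ht _ _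
  · intro a b a' b' z ha hb ha' hb'
    obtain ⟨t, ht⟩ : ∃ t, t = s z := ⟨_, rfl⟩
    have hz : z = (t : UnitAddCircle) := by rw [ht, hs]
    subst hz
    simp only [hv3 _ _ _ t ha' hb' _ _ (hs t), hv3 _ _ _ t ha hb _ _ (hs t), v]
    rw [← Category.assoc, T.rho_comp, Category.assoc, ← S.rho_comp b b' t hb hb']
    simp

end CircleCocycle

/-! ### Existence of trivializations, and cocycles given by sections of ℝ → S¹ -/

namespace CircleCocycle

variable {C : Type*} [Groupoid C] {L : Type*}

/-- Integer powers of an automorphism in a groupoid. -/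
def autPow {Q : C} (g : Q ⟶ Q) (n : ℤ) : Q ⟶ Q := (g ^ n : Q ⟶ Q)

lemma autPow_add {Q : C} (g : Q ⟶ Q) (m n : ℤ) : autPow g m ≫ autPow g n = autPow g (m + n) :=
  (zpow_add g m n).symm

lemma autPow_zero {Q : C} (g : Q ⟶ Q) : autPow g 0 = 𝟙 Q := zpow_zero g

lemma autPow_one {Q : C} (g : Q ⟶ Q) : autPow g 1 = g := zpow_one g

lemma coe_add_intCast (t : ℝ) (n : ℤ) : ((t + n : ℝ) : UnitAddCircle) = t := by
  rw [AddCircle.coe_add, add_eq_left]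
  exact (AddCircle.coe_eq_zero_iff 1).2 ⟨n, by simp⟩

lemma exists_eq_add_intCast {s t : ℝ} (h : (s : UnitAddCircle) = t) : ∃ n : ℤ, t = s + n := by
  obtain ⟨n, hn⟩ := AddSubgroup.mem_zmultiples_iff.1 (QuotientAddGroup.eq.1 h)
  exact ⟨n, by rw [zsmul_one] at hn; linarith⟩

/-- Two lifts of one point of the circle differ by an integer, so `round` only names this integer as
an element of ℤ. In particular it is additive on such differences. -/
lemma round_sub_of_coe_eq {s t : ℝ} (h : (s : UnitAddCircle) = t) :
    (round (t - s) : ℝ) = t - s := by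
  obtain ⟨n, rfl⟩ := exists_eq_add_intCast h
  simp

/-- Starting from the identity at 0, one inverts `r` going forwards and composes with it going
backwards. -/
lemma exists_recursion {Q : C} (r : ℤ → (Q ⟶ Q)) :
    ∃ W : ℤ → (Q ⟶ Q), ∀ j, r j ≫ W (j + 1) = W j := by
  let F : ℕ → (Q ⟶ Q) := fun n => Nat.rec (𝟙 Q) (fun m f => inv (r m) ≫ f) n
  let B : ℕ → (Q ⟶ Q) := fun n => Nat.rec (𝟙 Q) (fun m f => r (Int.negSucc m) ≫ f) n
  refine ⟨fun j => match j with
    | Int.ofNat n => F n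
    | Int.negSucc n => B (n + 1), ?_⟩
  rintro (n | n)
  · change r n ≫ inv (r n) ≫ F n = F n
    simp
  · cases n with
    | zero => rfl
    | succ n => rfl

/-- Every cocycle on `S¹` has a trivialization over `ℝ`. -/
lemma exists_trivialization (c : CircleCocycle C L) {Q : C} (q : ∀ a, c.P a ⟶ Q) :
    ∃ g : Q ⟶ Q, Nonempty (c.Trivialization g) := by
  obtain ⟨δ, hδ, hball⟩ := lebesgue_number_lemma_of_metric (isCompact_univ (X := UnitAddCircle))
    c.isOpen_U fun z _ => mem_iUnion.2 (c.exists_mem z)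
  -- The member of the cover is chosen for a point of the circle and not for a lift, so that all
  -- data along the grid j/N are exactly N-periodic in j.
  choose A hA using fun z => hball z (mem_univ z)
  obtain ⟨m, hm⟩ := exists_nat_one_div_lt hδ
  set N : ℕ := m + 1 with hN
  have hNpos : (0 : ℝ) < N := by positivity
  have hN1 : (1 : ℝ) / N < δ := by rw [hN]; push_cast; exact hm
  let e : ℤ → UnitAddCircle := fun j => ((j / N : ℝ) : UnitAddCircle)
  have heN : ∀ j, e (j + N) = e j := by
    intro j
    simp only [e]
    rw [← coe_add_intCast (j / N : ℝ) 1]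
    congr 1
    push_cast
    field_simp
  have hmem : ∀ (j : ℤ) (t : ℝ), |t - j / N| ≤ 1 / N → (t : UnitAddCircle) ∈ c.U (A (e j)) := by
    intro j t ht
    apply hA
    rw [Metric.mem_ball, dist_eq_norm, ← AddCircle.coe_sub]
    exact (QuotientAddGroup.norm_mk_le_norm (m := t - j / N)).trans_lt (ht.trans_lt hN1)
  have hmem1 : ∀ j, e (j + 1) ∈ c.U (A (e j)) := by
    intro j
    apply hmem
    rw [← sub_div, abs_div, abs_of_pos hNpos]
    simp
  have hmem0 : ∀ j, e j ∈ c.U (A (e j)) := by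
    intro j
    apply hmem
    simp only [sub_self, abs_zero]
    positivity
  let R : ∀ z z', z' ∈ c.U (A z) → z' ∈ c.U (A z') → (Q ⟶ Q) := fun z z' h h' =>
    inv (q (A z)) ≫ c.rho (A z) (A z') z' h h' ≫ q (A z')
  -- On [j/N, (j+1)/N) the trivialization passes to the member `A (e j)` and then applies `q` and `W
  -- j`. The recursion says that consecutive pieces agree at (j+1)/N.
  obtain ⟨W, hW⟩ := exists_recursion fun j => R (e j) (e (j + 1)) (hmem1 j) (hmem0 (j + 1))
  -- The quotient of `W (j + N)` by `W j` is independent of j, because the transition factors are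
  -- N-periodic. Its value is the holonomy.
  have hWN : ∀ j, W (j + N) = W j ≫ (inv (W 0) ≫ W N) := by
    have step : ∀ j, inv (W (j + 1)) ≫ W (j + 1 + N) = inv (W j) ≫ W (j + N) := by
      intro j
      have h1 := hW j
      have h2 := hW (j + N)
      have h3 : j + N + 1 = j + 1 + N := by ring
      simp only [h3, heN] at h2
      rw [← h1, ← h2]
      simp
    have hconst : ∀ j, inv (W j) ≫ W (j + N) = inv (W 0) ≫ W N := by
      intro j
      induction j with
      | zero => simp
      | succ n ih => rw [step, ih]
      | pred n ih =>
        have := step (-n - 1)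
        rw [sub_add_cancel] at this
        rw [← this, ih]
    intro j
    rw [← hconst j, IsIso.hom_inv_id_assoc]
  have hfl : ∀ t : ℝ, |t - (⌊N * t⌋ : ℤ) / N| ≤ 1 / N := by
    intro t
    have h1 := Int.floor_le (N * t)
    have h2 := Int.lt_floor_add_one (N * t)
    have h3 : t - (⌊N * t⌋ : ℤ) / N = (N * t - ⌊N * t⌋) / N := by field_simp
    rw [h3, abs_div, abs_of_pos hNpos, abs_of_nonneg (by linarith)]
    exact div_le_div_of_nonneg_right (by linarith) hNpos.le
  let w' : ∀ a (t : ℝ) (z : UnitAddCircle), (t : UnitAddCircle) ∈ c.U a →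
      (t : UnitAddCircle) ∈ c.U (A z) → (Q ⟶ Q) → (c.P a ⟶ Q) := fun a t z h h' v =>
    c.rho a (A z) t h h' ≫ q (A z) ≫ v
  refine ⟨inv (W 0) ≫ W N, ⟨⟨fun a t ht => w' a t (e ⌊N * t⌋) ht (hmem _ _ (hfl t)) (W ⌊N * t⌋),
    ?_, ?_, ?_⟩⟩⟩
  · intro a t ht
    set j := ⌊N * t⌋ with hj
    have hright := tendsto_coe t (c.rho_eventually a (A (e j)) t ht (hmem _ _ (hfl t)))
    have hlt : ∀ᶠ t' in 𝓝 t, (N : ℝ) * t' < j + 1 := by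
      have : Filter.Tendsto (fun t' : ℝ => (N : ℝ) * t') (𝓝 t) (𝓝 (N * t)) :=
        (continuous_const.mul continuous_id).tendsto t
      exact this.eventually (gt_mem_nhds (Int.lt_floor_add_one (N * t)))
    rcases (Int.floor_le (N * t)).lt_or_eq with h | h
    · have hgt : ∀ᶠ t' in 𝓝 t, (j : ℝ) < N * t' := by
        have : Filter.Tendsto (fun t' : ℝ => (N : ℝ) * t') (𝓝 t) (𝓝 (N * t)) :=
          (continuous_const.mul continuous_id).tendsto t
        exact this.eventually (lt_mem_nhds h)
      filter_upwards [hright, hlt, hgt] with t' h1 h2 h3 ht'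
      have h4 : ⌊N * t'⌋ = j := Int.floor_eq_iff.2 ⟨h3.le, h2⟩
      simp only [h4, w']
      rw [h1]
    -- At a grid point two pieces meet: to its right the floor is j, to its left j − 1, and the
    -- recursion at j − 1 matches them.
    · have htj : t = j / N := by
        rw [eq_div_iff hNpos.ne', mul_comm]
        exact h.symm
      have htz : (t : UnitAddCircle) = e j := by rw [htj]
      have htz' : (t : UnitAddCircle) = e (j - 1 + 1) := by rw [htj, sub_add_cancel]
      have hmemL : (t : UnitAddCircle) ∈ c.U (A (e (j - 1))) := htz' ▸ hmem1 (j - 1)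
      have hleft := tendsto_coe t (c.rho_eventually a (A (e (j - 1))) t ht hmemL)
      have hgt : ∀ᶠ t' in 𝓝 t, (j : ℝ) - 1 < N * t' := by
        have : Filter.Tendsto (fun t' : ℝ => (N : ℝ) * t') (𝓝 t) (𝓝 (N * t)) :=
          (continuous_const.mul continuous_id).tendsto t
        exact this.eventually (lt_mem_nhds (by rw [← h]; linarith))
      filter_upwards [hright, hleft, hlt, hgt] with t' h1 h1' h2 h3 ht'
      by_cases h5 : (j : ℝ) ≤ N * t'
      · have h4 : ⌊N * t'⌋ = j := Int.floor_eq_iff.2 ⟨h5, h2⟩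
        simp only [h4, w']
        rw [h1]
      · have h4 : ⌊N * t'⌋ = j - 1 := Int.floor_eq_iff.2 ⟨by push_cast; linarith, by
          push_cast; linarith⟩
        have hz : ∀ z (hz : z = e j) h', w' a t z ht h' (W j) =
            w' a t (e j) ht (hmem _ _ (hfl t)) (W j) := by
          rintro z rfl h'
          rfl
        refine Eq.trans ?_ (hz t htz (by rw [htz]; exact hmem0 j))
        simp only [h4, w']
        rw [h1']
        have hr := hW (j - 1)
        simp only [sub_add_cancel, R, ← htz] at hr
        rw [← hr]
        simp only [Category.assoc, IsIso.hom_inv_id_assoc]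
        rw [← Category.assoc, c.rho_comp]
  · intro a b t ha hb
    simp only [w']
    rw [← Category.assoc, c.rho_comp]
  · intro a t ht ht'
    have h1 : (N : ℝ) * (t + 1) = N * t + (N : ℤ) := by push_cast; ring
    have h2 : ((t + 1 : ℝ) : UnitAddCircle) = t := by simp
    simp only [h1, Int.floor_add_intCast, w', heN, h2, hWN, Category.assoc]

/-- The cocycle with values `g ^ n` that is defined by continuous sections of `ℝ → S¹` over the
sets of a cover, where `n` is the difference of two sections. -/
noncomputable def ofSections {U : L → Set UnitAddCircle} (hU : ∀ a, IsOpen (U a))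
    (hcov : ∀ z, ∃ a, z ∈ U a)
    (l : L → UnitAddCircle → ℝ) (hl : ∀ a, ContinuousOn (l a) (U a))
    (hl' : ∀ a z, (l a z : UnitAddCircle) = z) {P : L → C} {Q : C} (i : ∀ a, Q ⟶ P a)
    (g : Q ⟶ Q) : CircleCocycle C L where
  U := U
  isOpen_U := hU
  exists_mem := hcov
  P := P
  rho a b z _ _ := inv (i a) ≫ autPow g (round (l b z - l a z)) ≫ i b
  rho_comp a b c z _ _ _ := by
    have h : round (l b z - l a z) + round (l c z - l b z) = round (l c z - l a z) := by
      have h1 := round_sub_of_coe_eq ((hl' a z).trans (hl' b z).symm)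
      have h2 := round_sub_of_coe_eq ((hl' b z).trans (hl' c z).symm)
      have h3 := round_sub_of_coe_eq ((hl' a z).trans (hl' c z).symm)
      have : ((round (l b z - l a z) + round (l c z - l b z) : ℤ) : ℝ) =
          (round (l c z - l a z) : ℤ) := by push_cast; linarith
      exact_mod_cast this
    rw [← h, ← autPow_add]
    simp
  rho_eventually a b z ha hb := by
    have h1 := (hl a).continuousAt ((hU a).mem_nhds ha)
    have h2 := (hl b).continuousAt ((hU b).mem_nhds hb)
    -- The difference of the sections is continuous and integral, and integers at distance less than
    -- 1 are equal.
    have h3 := (h2.sub h1).eventually (Metric.ball_mem_nhds _ one_pos)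
    filter_upwards [h3] with z' hz' _ _
    have h4 := round_sub_of_coe_eq ((hl' a z).trans (hl' b z).symm)
    have h5 := round_sub_of_coe_eq ((hl' a z').trans (hl' b z').symm)
    have h6 : round (l b z' - l a z') = round (l b z - l a z) := by
      change dist (l b z' - l a z') (l b z - l a z) < 1 at hz'
      rw [← h4, ← h5, Int.dist_cast_real] at hz'
      by_contra hne
      have : (1 : ℝ) ≤ dist (round (l b z' - l a z')) (round (l b z - l a z)) :=
        Int.pairwise_one_le_dist hne
      linarith
    rw [h6]

/-- The trivialization of a cocycle that is defined by sections. -/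
noncomputable def trivializationOfSections {U : L → Set UnitAddCircle} (hU : ∀ a, IsOpen (U a))
    (hcov : ∀ z, ∃ a, z ∈ U a)
    (l : L → UnitAddCircle → ℝ) (hl : ∀ a, ContinuousOn (l a) (U a))
    (hl' : ∀ a z, (l a z : UnitAddCircle) = z) {P : L → C} {Q : C} (i : ∀ a, Q ⟶ P a)
    (g : Q ⟶ Q) : (ofSections hU hcov l hl hl' i g).Trivialization g where
  w a t _ := (inv (i a) ≫ autPow g (round (t - l a t)) : P a ⟶ Q)
  w_eventually a t ht := by
    have h1 := ((hl a).continuousAt ((hU a).mem_nhds ht)).comp (tendsto_coe t)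
    have h2 := (continuousAt_id (x := t)).sub h1
    have h3 := h2.eventually (Metric.ball_mem_nhds _ one_pos)
    filter_upwards [h3] with t' hz' _
    have h4 := round_sub_of_coe_eq (hl' a t)
    have h5 := round_sub_of_coe_eq (hl' a t')
    have h6 : round (t' - l a t') = round (t - l a t) := by
      change dist (t' - l a t') (t - l a t) < 1 at hz'
      rw [← h4, ← h5, Int.dist_cast_real] at hz'
      by_contra hne
      have : (1 : ℝ) ≤ dist (round (t' - l a t')) (round (t - l a t)) :=
        Int.pairwise_one_le_dist hne
      linarith
    rw [h6]
  rho_comp a b t _ _ := by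
    have h : round (l b t - l a t) + round (t - l b t) = round (t - l a t) := by
      have h1 := round_sub_of_coe_eq ((hl' a t).trans (hl' b t).symm)
      have h2 := round_sub_of_coe_eq (hl' b t)
      have h3 := round_sub_of_coe_eq (hl' a t)
      have : ((round (l b t - l a t) + round (t - l b t) : ℤ) : ℝ) =
          (round (t - l a t) : ℤ) := by push_cast; linarith
      exact_mod_cast this
    change (inv (i a) ≫ autPow g (round (l b t - l a t)) ≫ i b) ≫ inv (i b) ≫ _ = _
    rw [← h, ← autPow_add]
    simp
  w_add_one a t _ _ := by
    have h2 : ((t + 1 : ℝ) : UnitAddCircle) = t := by simp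
    have h3 : t + 1 - l a t = (t - l a t) + 1 := by ring
    rw [h2, h3, round_add_one, ← autPow_add, autPow_one]
    exact (Category.assoc _ _ _).symm

/-- A proper subset of the circle has a section, which is continuous on the subset if this is
open. -/
lemma exists_section {U : Set UnitAddCircle} (h : U ≠ univ) :
    ∃ l : UnitAddCircle → ℝ, ContinuousOn l U ∧ ∀ z, (l z : UnitAddCircle) = z := by
  obtain ⟨z, hz⟩ := (ne_univ_iff_exists_notMem U).1 h
  obtain ⟨q, rfl⟩ := QuotientAddGroup.mk_surjective z
  refine ⟨fun z => AddCircle.equivIco 1 q z, fun z hzU => ?_, fun z => AddCircle.coe_equivIco⟩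
  have hne : z ≠ (q : UnitAddCircle) := fun h => hz (h ▸ hzU)
  exact (continuous_subtype_val.continuousAt.comp
    (AddCircle.continuousAt_equivIco 1 q hne)).continuousWithinAt

end CircleCocycle

/-! ### The map underlying a morphism from a trivial orbispace -/

namespace OrbiSystem

section Underlying

variable {M : Type u} [TopologicalSpace M] [LocallyConnectedSpace M]
  {Y : Type v} [TopologicalSpace Y] [LocallyConnectedSpace Y] {P : Orbispace Y}
  {L : Type u} {U : L → (trivialOrbispace M).basic} {U' : L → P.basic}

/-- Two representatives of one point of M are related by a transition map; `rho` sends it to a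
transition map of P, which does not change the point of Y. -/
lemma proj_f_eq (σ : OrbiSystem (trivialOrbispace M) P U U') {a b : L}
    (x : (trivialOrbispace M).Cov (U a)) (y : (trivialOrbispace M).Cov (U b))
    (h : (trivialOrbispace M).proj _ x = (trivialOrbispace M).proj _ y) :
    P.proj _ (σ.f a x) = P.proj _ (σ.f b y) := by
  have hx : (trivialOrbispace M).proj _ x ∈ (U a : Set M) ∩ U b :=
    ⟨Orbispace.proj_mem _ _ x, h ▸ Orbispace.proj_mem _ _ y⟩
  have hz := mem_trivialComponent_trivialTran (U a) (U b) _ hx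
  have h1 := σ.f_app a b (trivialTran (U a) (U b) _ hx) x ((trivial_mem_src_iff _ _).2 hz)
  have h2 : (trivialOrbispace M).app (trivialTran (U a) (U b) _ hx) x = y :=
    trivial_proj_injective _ ((trivial_proj_app _ x hz).trans h)
  rw [h2] at h1
  rw [h1.2]
  exact ((P.iso _).proj_map _ h1.1).symm

lemma exists_proj_eq (σ : OrbiSystem (trivialOrbispace M) P U U') (z : M) :
    ∃ (a : L) (x : (trivialOrbispace M).Cov (U a)), (trivialOrbispace M).proj _ x = z := by
  obtain ⟨a, ha⟩ := mem_iUnion.1 (σ.cover ▸ mem_univ z)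
  exact ⟨a, Orbispace.exists_proj_eq _ _ z ha⟩

/-- The map between the underlying spaces. -/
noncomputable def underlying (σ : OrbiSystem (trivialOrbispace M) P U U') (z : M) : Y :=
  P.proj _ (σ.f (σ.exists_proj_eq z).choose (σ.exists_proj_eq z).choose_spec.choose)

lemma underlying_proj (σ : OrbiSystem (trivialOrbispace M) P U U') (a : L)
    (x : (trivialOrbispace M).Cov (U a)) :
    σ.underlying ((trivialOrbispace M).proj _ x) = P.proj _ (σ.f a x) :=
  σ.proj_f_eq _ _ (σ.exists_proj_eq _).choose_spec.choose_spec

lemma trivialComponent_eq_of_subset {V W : (trivialOrbispace M).basic} (h : (V : Set M) ⊆ W)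
    (t : (trivialOrbispace M).Tran V W) : trivialComponent t = V := by
  obtain ⟨p, hp, hC⟩ := trivialComponent_spec t
  rw [inter_eq_left.2 h] at hC hp
  rw [hC, (trivial_isConnected V).isPreconnected.connectedComponentIn hp]

lemma IsRefinement.underlying_eq {K : Type u} {V : K → (trivialOrbispace M).basic}
    {V' : K → P.basic} {σ : OrbiSystem (trivialOrbispace M) P U U'}
    {τ : OrbiSystem (trivialOrbispace M) P V V'} (h : σ.IsRefinement τ) :
    τ.underlying = σ.underlying := by
  obtain ⟨θ, hθ, i, i', h1, -⟩ := h
  ext z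
  obtain ⟨k, x, rfl⟩ := τ.exists_proj_eq z
  have hx : (trivialOrbispace M).proj _ x ∈ trivialComponent (i k) := by
    rw [trivialComponent_eq_of_subset (hθ k)]
    exact Orbispace.proj_mem _ _ x
  rw [underlying_proj, ← trivial_proj_app (i k) x hx, underlying_proj, ← (h1 k x).2]
  exact ((P.iso _).proj_map _ (h1 k x).1).symm

lemma Isomorphic.underlying_eq {σ τ : OrbiSystem (trivialOrbispace M) P U U'}
    (h : σ.Isomorphic τ) : τ.underlying = σ.underlying := by
  obtain ⟨d, hd, -⟩ := h
  ext z
  obtain ⟨k, x, rfl⟩ := τ.exists_proj_eq z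
  rw [underlying_proj, underlying_proj, hd]
  exact congrArg Subtype.val ((P.chart _).proj_smul _ _)

lemma underlying_reparam (h : M ≃ₜ M) (σ : OrbiSystem (trivialOrbispace M) P U U') (z : M) :
    (σ.reparam h).underlying z = σ.underlying (h z) := by
  obtain ⟨k, x, rfl⟩ := (σ.reparam h).exists_proj_eq z
  rw [underlying_proj, ← trivial_proj_covMap, underlying_proj]
  rfl

end Underlying

end OrbiSystem

/-- The map of spaces underlying a morphism from a trivial orbispace. -/
noncomputable def OrbiMorphism.underlying {M : Type u} [TopologicalSpace M]
    [LocallyConnectedSpace M] {Y : Type v} [TopologicalSpace Y] [LocallyConnectedSpace Y]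
    {P : Orbispace Y} : OrbiMorphism (trivialOrbispace M) P → M → Y :=
  Quot.lift (fun σ => σ.sys.underlying) (by
    rintro σ τ ⟨K, V, V', σ', τ', h1, h2, h3⟩
    change σ.sys.underlying = τ.sys.underlying
    rw [← h1.underlying_eq, ← h2.underlying_eq, h3.underlying_eq])

/-! ### Systems on the circle whose maps are constant -/

/-- The function takes a membership proof as an argument, as cocycles and trivializations do; this
form lets their local constancy be used without extending them to the whole space. -/
lemma IsPreconnected.eq_of_eventually_eq {α β : Type*} [TopologicalSpace α] {S T : Set α}
    (hS : IsPreconnected S) (hST : S ⊆ T) (w : ∀ z, z ∈ T → β)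
    (hw : ∀ z hz, ∀ᶠ z' in 𝓝 z, ∀ hz', w z' hz' = w z hz) {z z' : α} (hz : z ∈ S) (hz' : z' ∈ S) :
    w z (hST hz) = w z' (hST hz') := by
  have : PreconnectedSpace S := isPreconnected_iff_preconnectedSpace.1 hS
  have hloc : IsLocallyConstant fun s : S => w s (hST s.2) := by
    rw [IsLocallyConstant.iff_eventually_eq]
    intro s
    filter_upwards [continuous_subtype_val.continuousAt.eventually (hw s (hST s.2))] with s' hs'
    exact hs' _
  exact hloc.apply_eq_of_preconnectedSpace ⟨z, hz⟩ ⟨z', hz'⟩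

namespace LocalPoint

variable {X : Type u} [TopologicalSpace X] [LocallyConnectedSpace X] {O : Orbispace X}

lemma compAt_tran {P Q R : LocalPoint O} (f : P ⟶ Q) (g : Q ⟶ R) :
    O.CompAt (Hom.tran g) (Hom.tran f) P.pt (Hom.tran (f ≫ g)) := ⟨_, rfl⟩

lemma tran_comp_eq_of_compAt {P Q R : LocalPoint O} {f : P ⟶ Q} {g : Q ⟶ R} {r : P ⟶ R}
    (h : O.CompAt (Hom.tran g) (Hom.tran f) P.pt (Hom.tran r)) : f ≫ g = r :=
  hom_ext h.choose_spec

/-- An element of a local group, as a morphism between two points of a local cover. -/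
def ofGrp {U : O.basic} {x y : O.Cov U} (g : O.Grp U) (h : g • x = y) :
    (⟨U, x⟩ : LocalPoint O) ⟶ ⟨U, y⟩ :=
  Hom.mk (O.ofGrp U g) (O.mem_src_ofGrp _ _ _) ((O.app_ofGrp _ _ _).trans h)

lemma tran_comp_ofGrp {P : LocalPoint O} {U : O.basic} {x y : O.Cov U} (g : O.Grp U)
    (h : g • x = y) (f : P ⟶ ⟨U, x⟩) : Hom.tran (f ≫ ofGrp g h) = O.act g (Hom.tran f) 1 :=
  O.one_comp (Hom.tran f) g P.pt _

lemma tran_ofGrp_comp {Q : LocalPoint O} {U : O.basic} {x y : O.Cov U} (g : O.Grp U)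
    (h : g • x = y) (f : (⟨U, y⟩ : LocalPoint O) ⟶ Q) :
    Hom.tran (ofGrp g h ≫ f) = O.act 1 (Hom.tran f) g :=
  O.comp_one (Hom.tran f) g x _

/-- `ofStab` reverses products, but powers of a single element commute, so it respects integer
powers. -/
lemma autPow_ofStab {P : LocalPoint O} {g : O.Grp P.chart} (hg : g • P.pt = P.pt) (n : ℤ) :
    CircleCocycle.autPow (P.ofStab g hg) n = P.ofStab (g ^ n)
      (zpow_mem (show g ∈ MulAction.stabilizer (O.Grp P.chart) P.pt from hg) n) := by
  have hs : ∀ (n : ℤ), g ^ n • P.pt = P.pt :=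
    zpow_mem (show g ∈ MulAction.stabilizer (O.Grp P.chart) P.pt from hg)
  have hadd : ∀ (m n : ℤ), P.ofStab (g ^ m) (hs m) ≫ P.ofStab (g ^ n) (hs n) =
      P.ofStab (g ^ (m + n)) (hs _) := by
    intro m n
    rw [ofStab_comp]
    congr 1
    rw [← zpow_add, add_comm]
  have h0 : P.ofStab (g ^ (0 : ℤ)) (hs 0) = 𝟙 P := by
    rw [← ofStab_one]
    congr 1
    exact zpow_zero g
  have h1 : P.ofStab (g ^ (1 : ℤ)) (hs 1) = P.ofStab g hg := by
    congr 1
    exact zpow_one g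
  induction n with
  | zero => rw [CircleCocycle.autPow_zero, h0]
  | succ n ih => rw [← CircleCocycle.autPow_add, CircleCocycle.autPow_one, ih, ← h1, hadd]
  | pred n ih =>
    rw [← cancel_mono (P.ofStab g hg)]
    calc CircleCocycle.autPow (P.ofStab g hg) (-n - 1) ≫ P.ofStab g hg
        = CircleCocycle.autPow (P.ofStab g hg) (-n - 1) ≫
            CircleCocycle.autPow (P.ofStab g hg) 1 := by rw [CircleCocycle.autPow_one]
      _ = CircleCocycle.autPow (P.ofStab g hg) (-n) := by
          rw [CircleCocycle.autPow_add, sub_add_cancel]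
      _ = P.ofStab (g ^ (-n : ℤ)) (hs _) := ih
      _ = P.ofStab (g ^ (-n - 1 : ℤ)) (hs _) ≫ P.ofStab (g ^ (1 : ℤ)) (hs 1) := by
          rw [hadd]
          congr 2
          ring
      _ = _ := by rw [h1]

end LocalPoint

namespace OrbiSystem

variable {X : Type u} [TopologicalSpace X] [LocallyConnectedSpace X] {O : Orbispace X}
  {L K : Type} {U : L → (trivialOrbispace UnitAddCircle).basic} {U' : L → O.basic}

/-- The maps of a system are constant with the given values. -/
def IsConst (σ : OrbiSystem (trivialOrbispace UnitAddCircle) O U U') (y : ∀ a, O.Cov (U' a)) :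
    Prop :=
  ∀ a x, σ.f a x = y a

section Cocycle

variable {σ : OrbiSystem (trivialOrbispace UnitAddCircle) O U U'} {y : ∀ a, O.Cov (U' a)}

/-- The morphism of local points that is given by a transition map. -/
def IsConst.hom (hy : σ.IsConst y) {a b : L}
    (t : (trivialOrbispace UnitAddCircle).Tran (U a) (U b)) :
    (⟨U' a, y a⟩ : LocalPoint O) ⟶ ⟨U' b, y b⟩ :=
  have h : y a ∈ O.src (σ.rho a b t) ∧ O.app (σ.rho a b t) (y a) = y b := by
    obtain ⟨p, hp, h⟩ := trivialComponent_spec t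
    obtain ⟨x, hx⟩ := Orbispace.exists_proj_eq (trivialOrbispace UnitAddCircle) (U a) p hp.1
    have h1 := σ.f_app a b t x ((trivial_mem_src_iff _ _).2 (by
      rw [hx, h]
      exact mem_connectedComponentIn hp))
    rw [hy, hy] at h1
    exact ⟨h1.1, h1.2.symm⟩
  LocalPoint.Hom.mk (σ.rho a b t) h.1 h.2

/-- The cocycle of a system whose maps are constant. -/
def IsConst.cocycle (hy : σ.IsConst y) : CircleCocycle (LocalPoint O) L where
  U a := U a
  isOpen_U a := trivial_isOpen _
  exists_mem z := mem_iUnion.1 (σ.cover ▸ mem_univ z)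
  P a := ⟨U' a, y a⟩
  rho a b z ha hb := hy.hom (trivialTran (U a) (U b) z ⟨ha, hb⟩)
  rho_comp a b c z ha hb hc := by
    obtain ⟨x, hx⟩ := Orbispace.exists_proj_eq (trivialOrbispace UnitAddCircle) (U a) z ha
    have h := σ.rho_comp a b c (trivialTran (U a) (U b) z ⟨ha, hb⟩)
      (trivialTran (U b) (U c) z ⟨hb, hc⟩) x (trivialTran (U a) (U c) z ⟨ha, hc⟩)
      ((trivial_compAt_iff _ _ _ _).2 (by
        rw [hx]
        exact ⟨mem_trivialComponent_trivialTran _ _ _ _, mem_trivialComponent_trivialTran _ _ _ _,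
          mem_trivialComponent_trivialTran _ _ _ _⟩))
    rw [hy] at h
    exact LocalPoint.tran_comp_eq_of_compAt h
  rho_eventually a b z ha hb := by
    have ho : IsOpen (connectedComponentIn ((U a : Set UnitAddCircle) ∩ U b) z) :=
      ((trivial_isOpen _).inter (trivial_isOpen _)).connectedComponentIn
    filter_upwards [ho.mem_nhds (mem_connectedComponentIn ⟨ha, hb⟩)] with z' hz' ha' hb'
    congr 1
    exact trivialTran_ext (mem_trivialComponent_trivialTran _ _ _ _) hz'

lemma IsConst.cocycle_rho (hy : σ.IsConst y) {a b : L}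
    (t : (trivialOrbispace UnitAddCircle).Tran (U a) (U b)) {z : UnitAddCircle}
    (hz : z ∈ trivialComponent t) (ha hb) : hy.cocycle.rho a b z ha hb = hy.hom t := by
  change hy.hom _ = hy.hom t
  congr 1
  exact trivialTran_ext (mem_trivialComponent_trivialTran _ _ _ _) hz

end Cocycle

/-- The system of constant maps that is given by a cocycle. -/
noncomputable def ofCocycle (c : CircleCocycle (LocalPoint O) L)
    (U : L → (trivialOrbispace UnitAddCircle).basic) (hU : ∀ a, c.U a = U a) :
    OrbiSystem (trivialOrbispace UnitAddCircle) O U (fun a => (c.P a).chart) :=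
  have hmem : ∀ {a b} (t : (trivialOrbispace UnitAddCircle).Tran (U a) (U b)) {z},
      z ∈ trivialComponent t → z ∈ c.U a ∧ z ∈ c.U b := fun {a b} t z hz => by
    rw [hU, hU]
    exact trivialComponent_subset t hz
  have hne : ∀ {a b} (t : (trivialOrbispace UnitAddCircle).Tran (U a) (U b)),
      ∃ z, z ∈ trivialComponent t := fun {a b} t => by
    obtain ⟨p, hp, h⟩ := trivialComponent_spec t
    exact ⟨p, h ▸ mem_connectedComponentIn hp⟩
  have hrho : ∀ {a b} (t : (trivialOrbispace UnitAddCircle).Tran (U a) (U b)) {z z'}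
      (hz : z ∈ trivialComponent t) (hz' : z' ∈ trivialComponent t),
      c.rho a b z (hmem t hz).1 (hmem t hz).2 = c.rho a b z' (hmem t hz').1 (hmem t hz').2 := by
    intro a b t z z' hz hz'
    have hpc : IsPreconnected (trivialComponent t) := by
      obtain ⟨p, hp, h⟩ := trivialComponent_spec t
      rw [h]
      exact isPreconnected_connectedComponentIn
    exact hpc.eq_of_eventually_eq (T := c.U a ∩ c.U b) (fun z hz => hmem t hz)
      (fun z hz => c.rho a b z hz.1 hz.2) (fun z hz => by
        filter_upwards [c.rho_eventually a b z hz.1 hz.2] with z' h h'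
        exact h _ _) hz hz'
  { f := fun a => ContinuousMap.const _ (c.P a).pt
    rho := fun a b t => LocalPoint.Hom.tran (c.rho a b (hne t).choose
      (hmem t (hne t).choose_spec).1 (hmem t (hne t).choose_spec).2)
    cover := eq_univ_of_forall fun z => by
      obtain ⟨a, ha⟩ := c.exists_mem z
      exact mem_iUnion.2 ⟨a, hU a ▸ ha⟩
    continuous_rho := fun a b => ⟨fun _ _ => trivial_isOpen_tran _⟩
    f_app := fun a b t x _ => ⟨LocalPoint.Hom.mem_src _, (LocalPoint.Hom.app_eq _).symm⟩
    rho_comp := fun a b d t s x r h => by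
      rw [trivial_compAt_iff] at h
      rw [hrho t (hne t).choose_spec h.1, hrho s (hne s).choose_spec h.2.1,
        hrho r (hne r).choose_spec h.2.2, ← c.rho_comp a b d _ (hmem t h.1).1 (hmem t h.1).2
        (hmem s h.2.1).2]
      exact LocalPoint.compAt_tran _ _ }

lemma isConst_ofCocycle (c : CircleCocycle (LocalPoint O) L)
    (U : L → (trivialOrbispace UnitAddCircle).basic) (hU : ∀ a, c.U a = U a) :
    (ofCocycle c U hU).IsConst fun a => (c.P a).pt := fun _ _ => rfl

/-- In `ofCocycle` the cocycle is evaluated at a chosen point of each component. By local constancy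
any other point of the component serves as well. -/
lemma rho_ofCocycle (c : CircleCocycle (LocalPoint O) L)
    (U : L → (trivialOrbispace UnitAddCircle).basic) (hU : ∀ a, c.U a = U a) {a b : L}
    (t : (trivialOrbispace UnitAddCircle).Tran (U a) (U b)) {z : UnitAddCircle}
    (hz : z ∈ trivialComponent t) (ha hb) :
    (ofCocycle c U hU).rho a b t = LocalPoint.Hom.tran (c.rho a b z ha hb) := by
  have hpc : IsPreconnected (trivialComponent t) := by
    obtain ⟨p, hp, h⟩ := trivialComponent_spec t
    rw [h]
    exact isPreconnected_connectedComponentIn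
  have hne : ∃ z, z ∈ trivialComponent t := ⟨z, hz⟩
  refine congrArg LocalPoint.Hom.tran (hpc.eq_of_eventually_eq (T := c.U a ∩ c.U b)
    (fun z hz => ?_) (fun z hz => c.rho a b z hz.1 hz.2) (fun z hz => ?_) hne.choose_spec hz)
  · rw [hU, hU]
    exact trivialComponent_subset t hz
  · filter_upwards [c.rho_eventually a b z hz.1 hz.2] with z' h h'
    exact h _ _

end OrbiSystem

/-! ### Refinements and isomorphisms as morphisms of cocycles -/

namespace OrbiSystem

variable {X : Type u} [TopologicalSpace X] [LocallyConnectedSpace X] {O : Orbispace X}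
  {L K : Type} {U : L → (trivialOrbispace UnitAddCircle).basic} {U' : L → O.basic}
  {V : K → (trivialOrbispace UnitAddCircle).basic} {V' : K → O.basic}

/-- A refinement induces a morphism of cocycles. -/
lemma IsRefinement.nonempty_map {σ : OrbiSystem (trivialOrbispace UnitAddCircle) O U U'}
    {τ : OrbiSystem (trivialOrbispace UnitAddCircle) O V V'} (h : σ.IsRefinement τ)
    {y : ∀ a, O.Cov (U' a)} {x : ∀ a, O.Cov (V' a)} (hy : σ.IsConst y) (hx : τ.IsConst x) :
    Nonempty (hy.cocycle.Map hx.cocycle) := by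
  obtain ⟨θ, hθ, i, i', h1, h2⟩ := h
  have hi : ∀ k, x k ∈ O.src (i' k) ∧ O.app (i' k) (x k) = y (θ k) := by
    intro k
    obtain ⟨p, hp⟩ := (trivial_isConnected (V k)).nonempty
    obtain ⟨z, -⟩ := Orbispace.exists_proj_eq (trivialOrbispace UnitAddCircle) (V k) p hp
    have := h1 k z
    rwa [hy, hx] at this
  refine ⟨⟨θ, hθ, fun k => LocalPoint.Hom.mk (i' k) (hi k).1 (hi k).2, ?_⟩⟩
  intro k l z hk hl
  obtain ⟨p, rfl⟩ := Orbispace.exists_proj_eq (trivialOrbispace UnitAddCircle) (V k) z hk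
  have hmem : ∀ k, V k = (V k : Set UnitAddCircle) → ∀ z ∈ (V k : Set UnitAddCircle),
      z ∈ trivialComponent (i k) := by
    intro k _ z hz
    rw [trivialComponent_eq_of_subset (hθ k)]
    exact hz
  obtain ⟨r, hr1, hr2⟩ := h2 k l (trivialTran _ _ _ ⟨hk, hl⟩) (trivialTran _ _ _ ⟨hθ k hk, hθ l hl⟩)
    p (trivialTran _ _ _ ⟨hk, hθ l hl⟩)
    ((trivial_compAt_iff _ _ _ _).2 ⟨mem_trivialComponent_trivialTran _ _ _ _, hmem l rfl _ hl,
      mem_trivialComponent_trivialTran _ _ _ _⟩)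
    ((trivial_compAt_iff _ _ _ _).2 ⟨hmem k rfl _ hk, mem_trivialComponent_trivialTran _ _ _ _,
      mem_trivialComponent_trivialTran _ _ _ _⟩)
  rw [hx] at hr1 hr2
  apply LocalPoint.hom_ext
  obtain ⟨_, h3⟩ := hr1
  obtain ⟨_, h4⟩ := hr2
  exact h3.trans h4.symm

/-- An isomorphism induces a morphism of cocycles. -/
lemma Isomorphic.nonempty_map {σ τ : OrbiSystem (trivialOrbispace UnitAddCircle) O U U'}
    (h : σ.Isomorphic τ) {y x : ∀ a, O.Cov (U' a)} (hy : σ.IsConst y) (hx : τ.IsConst x) :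
    Nonempty (hx.cocycle.Map hy.cocycle) := by
  obtain ⟨d, h1, h2⟩ := h
  have hd : ∀ a, d a • y a = x a := by
    intro a
    obtain ⟨p, hp⟩ := (trivial_isConnected (U a)).nonempty
    obtain ⟨z, -⟩ := Orbispace.exists_proj_eq (trivialOrbispace UnitAddCircle) (U a) p hp
    have := h1 a z
    rw [hy, hx] at this
    exact this.symm
  refine ⟨⟨id, fun _ => subset_rfl, fun a => LocalPoint.ofGrp (d a) (hd a), ?_⟩⟩
  intro a b z ha hb
  apply LocalPoint.hom_ext
  refine (LocalPoint.tran_comp_ofGrp (d b) (hd b) _).trans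
    (Eq.trans ?_ (LocalPoint.tran_ofGrp_comp (d a) (hd a) _).symm)
  change O.act (d b) (σ.rho a b _) 1 = O.act 1 (τ.rho a b _) (d a)
  rw [h2, O.act_act]
  simp

/-- A converse of `IsRefinement.nonempty_map`, used to build common refinements. Since `V k` is
connected and contained in the larger set, there is only one transition map between them, and the
choice of the point `p k` is immaterial. -/
lemma ofCocycle_isRefinement {σ : OrbiSystem (trivialOrbispace UnitAddCircle) O U U'}
    {y : ∀ a, O.Cov (U' a)} (hy : σ.IsConst y) (c : CircleCocycle (LocalPoint O) K)
    (V : K → (trivialOrbispace UnitAddCircle).basic) (hV : ∀ a, c.U a = V a)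
    (m : hy.cocycle.Map c) : σ.IsRefinement (ofCocycle c V hV) := by
  have hsub : ∀ k, (V k : Set UnitAddCircle) ⊆ U (m.θ k) := fun k => hV k ▸ m.U_subset k
  choose p hp using fun k => (trivial_isConnected (V k)).nonempty
  refine ⟨m.θ, hsub, fun k => trivialTran _ _ (p k) ⟨hp k, hsub k (hp k)⟩,
    fun k => LocalPoint.Hom.tran (m.i k), ?_, ?_⟩
  · intro k x
    exact ⟨LocalPoint.Hom.mem_src (m.i k), (LocalPoint.Hom.app_eq (m.i k)).trans (hy _ _).symm⟩
  · intro k l t s x r h1 h2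
    rw [trivial_compAt_iff] at h1 h2
    have hk := (trivialComponent_subset t h1.1).1
    have hl := (trivialComponent_subset t h1.1).2
    rw [rho_ofCocycle c V hV t h1.1 (hV k ▸ hk) (hV l ▸ hl)]
    refine ⟨_, LocalPoint.compAt_tran _ (m.i l), ?_⟩
    rw [m.rho_comp_i, hy.cocycle_rho s h2.2.1]
    exact LocalPoint.compAt_tran (m.i k) (hy.hom s)

lemma isomorphic_refl (σ : OrbiSystem (trivialOrbispace UnitAddCircle) O U U') :
    σ.Isomorphic σ :=
  ⟨fun _ => 1, fun _ _ => (one_smul _ _).symm, fun _ _ _ => by rw [inv_one, O.act_one]⟩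

end OrbiSystem

/-! ### Holonomy determines a system up to direct equivalence -/

namespace SomeSystem

variable {X : Type u} [TopologicalSpace X] [LocallyConnectedSpace X] {O : Orbispace X}

/-- The maps of a system over `S¹` are constant, and its holonomy is conjugate to the
automorphism `g` of a local point. -/
def HasHolonomy (σ : SomeSystem (trivialOrbispace UnitAddCircle) O) {Q : LocalPoint O}
    (g : Q ⟶ Q) : Prop :=
  ∃ (y : ∀ a, O.Cov (σ.U' a)) (hy : σ.sys.IsConst y), Nonempty (hy.cocycle.Trivialization g)

/-- Systems with the same holonomy are equivalent. -/
lemma HasHolonomy.directlyEquivalent {σ τ : SomeSystem (trivialOrbispace UnitAddCircle) O}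
    {Q : LocalPoint O} {g : Q ⟶ Q} (hσ : σ.HasHolonomy g) (hτ : τ.HasHolonomy g) :
    DirectlyEquivalent σ τ := by
  obtain ⟨y, hy, ⟨T⟩⟩ := hσ
  obtain ⟨x, hx, ⟨S⟩⟩ := hτ
  obtain ⟨w, hw1, hw2⟩ := T.exists_compare S
  -- The common refinement consists of the components of U_a ∩ U_b; a point z in the index selects
  -- the component. On each of them the comparison `w` is constant.
  let K : Type :=
    {k : σ.L × τ.L × UnitAddCircle // k.2.2 ∈ (σ.U k.1 : Set UnitAddCircle) ∩ τ.U k.2.1}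
  let V : K → (trivialOrbispace UnitAddCircle).basic := fun k =>
    ⟨connectedComponentIn ((σ.U k.1.1 : Set UnitAddCircle) ∩ τ.U k.1.2.1) k.1.2.2,
      ((trivial_isOpen _).inter (trivial_isOpen _)).connectedComponentIn,
      isConnected_connectedComponentIn_iff.2 k.2⟩
  have hV : ∀ k, (V k : Set UnitAddCircle) ⊆ (σ.U k.1.1 : Set UnitAddCircle) ∩ τ.U k.1.2.1 :=
    fun k => connectedComponentIn_subset _ _
  let c : CircleCocycle (LocalPoint O) K :=
    { U := fun k => V k
      isOpen_U := fun k => trivial_isOpen _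
      exists_mem := fun z => by
        obtain ⟨a, ha⟩ := hy.cocycle.exists_mem z
        obtain ⟨b, hb⟩ := hx.cocycle.exists_mem z
        exact ⟨⟨⟨a, b, z⟩, ha, hb⟩, mem_connectedComponentIn ⟨ha, hb⟩⟩
      P := fun k => ⟨σ.U' k.1.1, y k.1.1⟩
      rho := fun k l z hk hl => hy.cocycle.rho k.1.1 l.1.1 z (hV k hk).1 (hV l hl).1
      rho_comp := fun k l m z hk hl hm => hy.cocycle.rho_comp _ _ _ _ _ _ _
      rho_eventually := fun k l z hk hl => by
        filter_upwards [hy.cocycle.rho_eventually k.1.1 l.1.1 z (hV k hk).1 (hV l hl).1]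
          with z' h _ _
        exact h _ _ }
  let mσ : hy.cocycle.Map c :=
    { θ := fun k => k.1.1
      U_subset := fun k z hz => (hV k hz).1
      i := fun k => 𝟙 (⟨σ.U' k.1.1, y k.1.1⟩ : LocalPoint O)
      rho_comp_i := fun k l z hk hl => (Category.comp_id _).trans (Category.id_comp _).symm }
  have hconst : ∀ (k : K) (z : UnitAddCircle) (hz : z ∈ (V k : Set UnitAddCircle)),
      w k.1.1 k.1.2.1 k.1.2.2 k.2.1 k.2.2 = w k.1.1 k.1.2.1 z (hV k hz).1 (hV k hz).2 := by
    intro k z hz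
    exact (trivial_isConnected (V k)).isPreconnected.eq_of_eventually_eq (hV k)
      (fun z hz => w k.1.1 k.1.2.1 z hz.1 hz.2) (fun z hz => by
        filter_upwards [hw1 k.1.1 k.1.2.1 z hz.1 hz.2] with z' h h'
        exact h _ _) (mem_connectedComponentIn k.2) hz
  let mτ : hx.cocycle.Map c :=
    { θ := fun k => k.1.2.1
      U_subset := fun k z hz => (hV k hz).2
      i := fun k => w k.1.1 k.1.2.1 k.1.2.2 k.2.1 k.2.2
      rho_comp_i := fun k l z hk hl => by
        rw [hconst l z hl, hconst k z hk]
        exact hw2 _ _ _ _ z _ _ _ _ }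
  -- One and the same system refines both: σ through identities, τ through the comparison `w`. The
  -- required isomorphism is therefore trivial.
  exact ⟨K, V, fun k => σ.U' k.1.1, OrbiSystem.ofCocycle c V fun _ => rfl,
    OrbiSystem.ofCocycle c V fun _ => rfl, OrbiSystem.ofCocycle_isRefinement hy c V _ mσ,
    OrbiSystem.ofCocycle_isRefinement hx c V _ mτ, OrbiSystem.isomorphic_refl _⟩

end SomeSystem

/-! ### Finite groups and T₁ covers: holonomy as an invariant of the loop -/

section Finite

variable {X : Type u} [TopologicalSpace X] [LocallyConnectedSpace X] {O : Orbispace X}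

/-- If the local groups are finite and the local covers are `T₁`, a continuous map from a connected
space into a fibre of a local cover is constant. -/
lemma Orbispace.exists_eq_const (hfin : ∀ U : O.basic, Finite (O.Grp U))
    (hT1 : ∀ U : O.basic, T1Space (O.Cov U)) {Z : Type*} [TopologicalSpace Z] [ConnectedSpace Z]
    {U : O.basic} (f : C(Z, O.Cov U)) {p : X} (h : ∀ z, O.proj U (f z) = p) :
    ∃ y, ∀ z, f z = y := by
  have := hfin U
  have := hT1 U
  obtain ⟨z₀⟩ := (inferInstance : Nonempty Z)
  let T : Set (O.Cov U) := range fun g : O.Grp U => g • f z₀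
  have hTf : T.Finite := finite_range _
  have hm : MapsTo f univ T := fun z _ =>
    (O.proj_eq_proj_iff U (f z₀) (f z)).1 ((h z₀).trans (h z).symm)
  refine ⟨f z₀, fun z => ?_⟩
  exact isPreconnected_univ.constant_of_mapsTo hTf.isDiscrete f.continuous.continuousOn hm
    (mem_univ _)
    (mem_univ _)

/-- A constant underlying map confines each `f a` to a single fibre, and the cover of a connected
arc by itself is connected. -/
lemma OrbiSystem.exists_isConst (hfin : ∀ U : O.basic, Finite (O.Grp U))
    (hT1 : ∀ U : O.basic, T1Space (O.Cov U)) {L : Type}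
    {U : L → (trivialOrbispace UnitAddCircle).basic} {U' : L → O.basic}
    (σ : OrbiSystem (trivialOrbispace UnitAddCircle) O U U') {p : X}
    (h : ∀ z, σ.underlying z = p) : ∃ y, σ.IsConst y := by
  choose y hy using fun a => Orbispace.exists_eq_const hfin hT1 (σ.f a)
    (fun x => (σ.underlying_proj a x).symm.trans (h _))
  exact ⟨y, hy⟩

/-- A trivialization supplies morphisms from the values of the system to Q, and morphisms of local
points do not change the point of X. -/
lemma OrbiSystem.IsConst.underlying_eq {L : Type}
    {U : L → (trivialOrbispace UnitAddCircle).basic} {U' : L → O.basic}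
    {σ : OrbiSystem (trivialOrbispace UnitAddCircle) O U U'} {y : ∀ a, O.Cov (U' a)}
    (hy : σ.IsConst y) {Q : LocalPoint O} {g : Q ⟶ Q} (T : hy.cocycle.Trivialization g)
    (z : UnitAddCircle) : σ.underlying z = O.proj Q.chart Q.pt := by
  obtain ⟨a, x, rfl⟩ := σ.exists_proj_eq z
  obtain ⟨t, ht⟩ := QuotientAddGroup.mk_surjective ((trivialOrbispace UnitAddCircle).proj _ x)
  have ht : (t : UnitAddCircle) = (trivialOrbispace UnitAddCircle).proj _ x := ht
  rw [underlying_proj, hy]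
  exact LocalPoint.proj_eq (T.w a t (ht ▸ Orbispace.proj_mem _ _ x))

/-- Only one of the systems is known to have constant maps. Its underlying map is constant and is
shared by both refinements and by the other system, so all of them have constant maps and hence
cocycles. The trivialization is then restricted or extended along the morphisms between these. -/
lemma SomeSystem.HasHolonomy.of_directlyEquivalent (hfin : ∀ U : O.basic, Finite (O.Grp U))
    (hT1 : ∀ U : O.basic, T1Space (O.Cov U))
    {σ τ : SomeSystem (trivialOrbispace UnitAddCircle) O} (h : DirectlyEquivalent σ τ)
    {Q : LocalPoint O} (g : Q ⟶ Q) : σ.HasHolonomy g ↔ τ.HasHolonomy g := by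
  obtain ⟨K, V, V', σ', τ', h1, h2, h3⟩ := h
  constructor
  · rintro ⟨y, hy, ⟨T⟩⟩
    have e1 : ∀ z, σ'.underlying z = _ := fun z =>
      (congrFun h1.underlying_eq z).trans (hy.underlying_eq T z)
    have e2 : ∀ z, τ'.underlying z = _ := fun z => (congrFun h3.underlying_eq z).trans (e1 z)
    have e3 : ∀ z, τ.sys.underlying z = _ := fun z =>
      (congrFun h2.underlying_eq z).symm.trans (e2 z)
    obtain ⟨y1, hy1⟩ := σ'.exists_isConst hfin hT1 e1
    obtain ⟨y2, hy2⟩ := τ'.exists_isConst hfin hT1 e2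
    obtain ⟨y3, hy3⟩ := τ.sys.exists_isConst hfin hT1 e3
    obtain ⟨m1⟩ := h1.nonempty_map hy hy1
    obtain ⟨m3⟩ := h3.nonempty_map hy1 hy2
    obtain ⟨m2⟩ := h2.nonempty_map hy3 hy2
    obtain ⟨T2⟩ := (T.restrict m1).nonempty_extend m3
    exact ⟨y3, hy3, T2.nonempty_extend m2⟩
  · rintro ⟨y, hy, ⟨T⟩⟩
    have e2 : ∀ z, τ'.underlying z = _ := fun z =>
      (congrFun h2.underlying_eq z).trans (hy.underlying_eq T z)
    have e1 : ∀ z, σ'.underlying z = _ := fun z => (congrFun h3.underlying_eq z).symm.trans (e2 z)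
    have e3 : ∀ z, σ.sys.underlying z = _ := fun z =>
      (congrFun h1.underlying_eq z).symm.trans (e1 z)
    obtain ⟨y1, hy1⟩ := σ'.exists_isConst hfin hT1 e1
    obtain ⟨y2, hy2⟩ := τ'.exists_isConst hfin hT1 e2
    obtain ⟨y3, hy3⟩ := σ.sys.exists_isConst hfin hT1 e3
    obtain ⟨m1⟩ := h1.nonempty_map hy3 hy1
    obtain ⟨m3⟩ := h3.nonempty_map hy1 hy2
    obtain ⟨m2⟩ := h2.nonempty_map hy hy2
    exact ⟨y3, hy3, ((T.restrict m2).restrict m3).nonempty_extend m1⟩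

/-- The holonomy of a system depends only on the loop that it represents. -/
lemma SomeSystem.HasHolonomy.of_mk_eq (hfin : ∀ U : O.basic, Finite (O.Grp U))
    (hT1 : ∀ U : O.basic, T1Space (O.Cov U))
    {σ τ : SomeSystem (trivialOrbispace UnitAddCircle) O}
    (h : (Quot.mk _ σ : FreeLoopSpace O) = Quot.mk _ τ) {Q : LocalPoint O} {g : Q ⟶ Q}
    (hσ : σ.HasHolonomy g) : τ.HasHolonomy g := by
  -- Direct equivalence only generates the equivalence relation, so the invariance is propagated
  -- along chains.
  have key := Quot.eqvGen_exact h
  clear h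
  revert hσ
  rw [← eq_iff_iff.1 (?_ : (σ.HasHolonomy g) = (τ.HasHolonomy g))]
  · exact id
  · induction key with
    | rel _ _ h => exact propext (of_directlyEquivalent hfin hT1 h g)
    | refl _ => rfl
    | symm _ _ _ ih => exact ih.symm
    | trans _ _ _ _ _ ih1 ih2 => exact ih1.trans ih2

lemma SomeSystem.HasHolonomy.mk_eq {σ τ : SomeSystem (trivialOrbispace UnitAddCircle) O}
    {Q : LocalPoint O} {g : Q ⟶ Q} (hσ : σ.HasHolonomy g) (hτ : τ.HasHolonomy g) :
    (Quot.mk _ σ : FreeLoopSpace O) = Quot.mk _ τ :=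
  Quot.sound (hσ.directlyEquivalent hτ)

/-- Two holonomies of a system are conjugate. -/
lemma SomeSystem.HasHolonomy.exists_conj {σ : SomeSystem (trivialOrbispace UnitAddCircle) O}
    {Q R : LocalPoint O} {g : Q ⟶ Q} {h : R ⟶ R} (hg : σ.HasHolonomy g) (hh : σ.HasHolonomy h) :
    ∃ k : Q ⟶ R, g ≫ k = k ≫ h := by
  obtain ⟨y, hy, ⟨T⟩⟩ := hg
  obtain ⟨x, hx, ⟨S⟩⟩ := hh
  obtain rfl : x = y := by
    ext a
    obtain ⟨p, hp⟩ := (trivial_isConnected (σ.U a)).nonempty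
    obtain ⟨z, -⟩ := Orbispace.exists_proj_eq (trivialOrbispace UnitAddCircle) (σ.U a) p hp
    rw [← hx a z, hy a z]
  exact T.exists_conj S

/-- A conjugation carries a holonomy of a system to another one. -/
lemma SomeSystem.HasHolonomy.conj {σ : SomeSystem (trivialOrbispace UnitAddCircle) O}
    {Q R : LocalPoint O} {g : Q ⟶ Q} {h : R ⟶ R} (hg : σ.HasHolonomy g) (k : Q ⟶ R)
    (hk : g ≫ k = k ≫ h) : σ.HasHolonomy h := by
  obtain ⟨y, hy, ⟨T⟩⟩ := hg
  refine ⟨y, hy, ⟨⟨fun a t ht => T.w a t ht ≫ k, ?_, ?_, ?_⟩⟩⟩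
  · intro a t ht
    filter_upwards [T.w_eventually a t ht] with t' h ht'
    rw [h]
  · intro a b t ha hb
    rw [← Category.assoc, T.rho_comp]
  · intro a t ht ht'
    rw [T.w_add_one a t ht, Category.assoc, hk, Category.assoc]

/-- All values of the maps lie over the same point of X as Q, so each of them is joined to Q by a
morphism. These morphisms are the input of `exists_trivialization`. -/
lemma SomeSystem.exists_hasHolonomy (hfin : ∀ U : O.basic, Finite (O.Grp U))
    (hT1 : ∀ U : O.basic, T1Space (O.Cov U))
    (σ : SomeSystem (trivialOrbispace UnitAddCircle) O) {Q : LocalPoint O}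
    (h : ∀ z, σ.sys.underlying z = O.proj Q.chart Q.pt) :
    ∃ (g : O.Grp Q.chart) (hg : g • Q.pt = Q.pt), σ.HasHolonomy (Q.ofStab g hg) := by
  obtain ⟨y, hy⟩ := σ.sys.exists_isConst hfin hT1 h
  have hq : ∀ a, Nonempty (hy.cocycle.P a ⟶ Q) := by
    intro a
    obtain ⟨p, hp⟩ := (trivial_isConnected (σ.U a)).nonempty
    obtain ⟨x, -⟩ := Orbispace.exists_proj_eq (trivialOrbispace UnitAddCircle) (σ.U a) p hp
    apply LocalPoint.nonempty_hom
    rw [← h ((trivialOrbispace UnitAddCircle).proj _ x), OrbiSystem.underlying_proj, hy]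
    rfl
  obtain ⟨g, hT⟩ := hy.cocycle.exists_trivialization fun a => (hq a).some
  obtain ⟨g, hg, rfl⟩ := LocalPoint.ofStab_surjective Q g
  exact ⟨g, hg, y, hy, hT⟩

/-- The holonomy of a system with constant maps, whose transition maps are powers of `g` given by
sections of `ℝ → S¹`. -/
lemma SomeSystem.hasHolonomy_of_sections (σ : SomeSystem (trivialOrbispace UnitAddCircle) O)
    {Q : LocalPoint O} {g : O.Grp Q.chart} (hg : g • Q.pt = Q.pt)
    (y : ∀ a, O.Cov (σ.U' a)) (hy : σ.sys.IsConst y)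
    (i : ∀ a, Q ⟶ (⟨σ.U' a, y a⟩ : LocalPoint O))
    (l : σ.L → UnitAddCircle → ℝ) (hl : ∀ a, ContinuousOn (l a) (σ.U a))
    (hl' : ∀ a z, (l a z : UnitAddCircle) = z)
    (h : ∀ a b (t : (trivialOrbispace UnitAddCircle).Tran (σ.U a) (σ.U b)),
      ∃ z ∈ trivialComponent t, hy.hom t =
        inv (i a) ≫ CircleCocycle.autPow (Q.ofStab g hg) (round (l b z - l a z)) ≫ i b) :
    σ.HasHolonomy (Q.ofStab g hg) := by
  let c := CircleCocycle.ofSections (fun a => hy.cocycle.isOpen_U a) hy.cocycle.exists_mem l hl hl'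
    i (Q.ofStab g hg)
  have T : c.Trivialization (Q.ofStab g hg) :=
    CircleCocycle.trivializationOfSections _ _ l hl hl' _ _
  suffices H : ∀ a b z ha hb, hy.cocycle.rho a b z ha hb = c.rho a b z ha hb by
    let m : c.Map hy.cocycle :=
      { θ := id
        U_subset := fun _ => subset_rfl
        i := fun a => 𝟙 (⟨σ.U' a, y a⟩ : LocalPoint O)
        rho_comp_i := fun a b z ha hb =>
          (Category.comp_id _).trans ((H a b z ha hb).trans (Category.id_comp _).symm) }
    exact ⟨y, hy, ⟨T.restrict m⟩⟩
  intro a b z ha hb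
  obtain ⟨z', hz', H⟩ := h a b (trivialTran (σ.U a) (σ.U b) z ⟨ha, hb⟩)
  refine H.trans ?_
  -- The hypothesis gives the transition map in terms of one point of the component; the right-hand
  -- side is locally constant there, so the formula holds at z too.
  have hpc : IsPreconnected (connectedComponentIn ((σ.U a : Set UnitAddCircle) ∩ σ.U b) z) :=
    isPreconnected_connectedComponentIn
  exact hpc.eq_of_eventually_eq (connectedComponentIn_subset _ _)
    (fun z hz => c.rho a b z hz.1 hz.2) (fun z hz => by
        filter_upwards [c.rho_eventually a b z hz.1 hz.2] with z' h h'
        exact h _ _) hz' (mem_connectedComponentIn ⟨ha, hb⟩)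

end Finite

section

/-! ### Constant loops -/

/-- The circle is cut at a − 1/2, opposite to the centre of the arc, so the section is continuous on
the arc and takes values within 1/4 of a. -/
lemma exists_section_arcAt (a : ℝ) : ∃ l : UnitAddCircle → ℝ,
    ContinuousOn l (arcAt a : Set UnitAddCircle) ∧ (∀ z, (l z : UnitAddCircle) = z) ∧
      ∀ z ∈ (arcAt a : Set UnitAddCircle), |l z - a| < 1 / 4 := by
  have hlt : ∀ z ∈ (arcAt a : Set UnitAddCircle),
      |(AddCircle.equivIco 1 (a - 1 / 2) z : ℝ) - a| < 1 / 4 := by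
    rintro z ⟨t, ht, rfl⟩
    have h1 : t ∈ Ico (a - 1 / 2) (a - 1 / 2 + 1) := ⟨by linarith [ht.1], by linarith [ht.2]⟩
    change |(AddCircle.equivIco 1 (a - 1 / 2) (t : AddCircle (1 : ℝ)) : ℝ) - a| < 1 / 4
    rw [AddCircle.equivIco_coe_of_mem h1, abs_lt]
    exact ⟨by linarith [ht.1], by linarith [ht.2]⟩
  refine ⟨fun z => AddCircle.equivIco 1 (a - 1 / 2) z, fun z hz => ?_,
    fun z => AddCircle.coe_equivIco, hlt⟩
  have hne : z ≠ ((a - 1 / 2 : ℝ) : UnitAddCircle) := by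
    rintro rfl
    have h1 := hlt _ hz
    have h2 : a - 1 / 2 ∈ Ico (a - 1 / 2) (a - 1 / 2 + 1) := ⟨le_rfl, by linarith⟩
    rw [AddCircle.equivIco_coe_of_mem h2, abs_lt] at h1
    linarith [h1.1]
  exact (continuous_subtype_val.continuousAt.comp
    (AddCircle.continuousAt_equivIco 1 _ hne)).continuousWithinAt

/-- The integer t − s is at distance less than 1/2 from b − a. This identifies the exponents in
`constSystem` with differences of sections. -/
lemma round_eq_round_of_arcAt {a b s t : ℝ} (h : (s : UnitAddCircle) = t) (hs : |s - a| < 1 / 4)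
    (ht : |t - b| < 1 / 4) : round (t - s) = round (b - a) := by
  obtain ⟨n, rfl⟩ := CircleCocycle.exists_eq_add_intCast h
  rw [add_sub_cancel_left, round_intCast]
  symm
  rw [abs_lt] at hs ht
  rw [round_eq, Int.floor_eq_iff]
  constructor <;> linarith [hs.1, hs.2, ht.1, ht.2]

variable {X : Type u} [TopologicalSpace X] [LocallyConnectedSpace X] {O : Orbispace X}

lemma SomeSystem.hasHolonomy_of_const {L : Type} {V : L → (trivialOrbispace UnitAddCircle).basic}
    {U : O.basic} (σ : OrbiSystem (trivialOrbispace UnitAddCircle) O V fun _ => U) {x : O.Cov U}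
    {g : O.Grp U} (hg : g • x = x) (hσ : σ.IsConst fun _ => x) (n : L → L → ℤ)
    (hn : ∀ a b t, σ.rho a b t = O.ofGrp U (g ^ n a b))
    (l : L → UnitAddCircle → ℝ) (hl : ∀ a, ContinuousOn (l a) (V a))
    (hl' : ∀ a z, (l a z : UnitAddCircle) = z)
    (hr : ∀ a b z, z ∈ (V a : Set UnitAddCircle) → z ∈ (V b : Set UnitAddCircle) →
      round (l b z - l a z) = n a b) :
    (⟨L, V, fun _ => U, σ⟩ : SomeSystem (trivialOrbispace UnitAddCircle) O).HasHolonomy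
      (LocalPoint.ofStab ⟨U, x⟩ g hg) := by
  refine SomeSystem.hasHolonomy_of_sections _ (Q := ⟨U, x⟩) hg (fun _ => x) hσ (fun _ => 𝟙 _) l hl
    hl' ?_
  intro a b t
  obtain ⟨p, hp, h⟩ := trivialComponent_spec t
  refine ⟨p, h ▸ mem_connectedComponentIn hp, ?_⟩
  rw [hr a b p hp.1 hp.2, LocalPoint.autPow_ofStab]
  apply LocalPoint.hom_ext
  refine (hn a b t).trans ?_
  simp only [IsIso.inv_id]
  rw [Category.id_comp, Category.comp_id]
  rfl

lemma hasHolonomy_constSystem (U : O.basic) (x : O.Cov U) (g : O.Grp U) (hg : g • x = x) :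
    (⟨ℝ, arcAt, fun _ => U, constSystem U x g hg⟩ :
      SomeSystem (trivialOrbispace UnitAddCircle) O).HasHolonomy
        (LocalPoint.ofStab ⟨U, x⟩ g hg) := by
  choose l hl hl' hla using exists_section_arcAt
  exact SomeSystem.hasHolonomy_of_const _ hg (fun _ _ => rfl) (fun a b => round (b - a))
    (fun _ _ _ => rfl) l hl hl' fun a b z ha hb =>
      round_eq_round_of_arcAt ((hl' a z).trans (hl' b z).symm) (hla a z ha) (hla b z hb)

/-- Rotation by s replaces the section l_a by z ↦ l_a(z + s) − s. Differences of sections, and with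
them the exponents of g, are the same as before, so the rotated loop is the original one. -/
lemma hasHolonomy_reparam_constSystem (U : O.basic) (x : O.Cov U) (g : O.Grp U) (hg : g • x = x)
    (s : ℝ) :
    (⟨ℝ, fun a => trivialPreimage (Homeomorph.addRight (s : UnitAddCircle)) (arcAt a), fun _ => U,
      (constSystem U x g hg).reparam (Homeomorph.addRight (s : UnitAddCircle))⟩ :
      SomeSystem (trivialOrbispace UnitAddCircle) O).HasHolonomy
        (LocalPoint.ofStab ⟨U, x⟩ g hg) := by
  choose l hl hl' hla using exists_section_arcAt
  refine SomeSystem.hasHolonomy_of_const _ hg (fun _ _ => rfl) (fun a b => round (b - a))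
    (fun _ _ _ => rfl) (fun a z => l a (z + s) - s) ?_ ?_ ?_
  · intro a
    exact ((hl a).comp (continuous_add_const _).continuousOn fun z hz => hz).sub
      continuousOn_const
  · intro a z
    rw [AddCircle.coe_sub, hl', add_sub_cancel_right]
  · intro a b z ha hb
    rw [sub_sub_sub_cancel_right]
    exact round_eq_round_of_arcAt ((hl' a _).trans (hl' b _).symm) (hla a _ ha) (hla b _ hb)

lemma constLoop_mem_fixedPoints (U : O.basic) (x : O.Cov U) (g : O.Grp U) (hg : g • x = x) :
    constLoop U x g hg ∈ AddAction.fixedPoints UnitAddCircle (FreeLoopSpace O) := by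
  intro s
  obtain ⟨s, rfl⟩ := QuotientAddGroup.mk_surjective s
  exact (hasHolonomy_reparam_constSystem U x g hg s).mk_eq (hasHolonomy_constSystem U x g hg)

/-- This turns every question about representatives of a constant loop into one about cocycles; both
comparisons of topologies rest on it. -/
lemma mk_eq_constLoop_iff (hfin : ∀ U : O.basic, Finite (O.Grp U))
    (hT1 : ∀ U : O.basic, T1Space (O.Cov U))
    (σ : SomeSystem (trivialOrbispace UnitAddCircle) O) (Q : LocalPoint O)
    (g : O.Grp Q.chart) (hg : g • Q.pt = Q.pt) :
    (Quot.mk _ σ : FreeLoopSpace O) = constLoop Q.chart Q.pt g hg ↔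
      σ.HasHolonomy (Q.ofStab g hg) :=
  ⟨fun h => (hasHolonomy_constSystem Q.chart Q.pt g hg).of_mk_eq hfin hT1 h.symm,
    fun h => h.mk_eq (hasHolonomy_constSystem Q.chart Q.pt g hg)⟩

/-- Both sides express that the two automorphisms are conjugate in the groupoid of local points: on
the left as holonomies of one system, on the right by `toSector_eq_iff`. -/
lemma constLoop_eq_iff (hfin : ∀ U : O.basic, Finite (O.Grp U))
    (hT1 : ∀ U : O.basic, T1Space (O.Cov U))
    (P Q : LocalPoint O) (g : O.Grp P.chart) (hg : g • P.pt = P.pt)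
    (h : O.Grp Q.chart) (hh : h • Q.pt = Q.pt) :
    constLoop P.chart P.pt g hg = constLoop Q.chart Q.pt h hh ↔
      Orbispace.toSector P.chart P.pt g hg = Orbispace.toSector Q.chart Q.pt h hh := by
  have hP := hasHolonomy_constSystem P.chart P.pt g hg
  rw [LocalPoint.toSector_eq_iff]
  refine (mk_eq_constLoop_iff hfin hT1 _ Q h hh).trans ⟨fun H => hP.exists_conj H, ?_⟩
  rintro ⟨k, hk⟩
  exact hP.conj k hk

/-- A loop that is fixed by rotations has a constant underlying loop. -/
lemma exists_underlying_eq {γ : FreeLoopSpace O}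
    (hγ : γ ∈ AddAction.fixedPoints UnitAddCircle (FreeLoopSpace O)) :
    ∃ p : X, ∀ z, OrbiMorphism.underlying γ z = p := by
  refine ⟨OrbiMorphism.underlying γ 0, fun z => ?_⟩
  have h := congrArg (fun γ : FreeLoopSpace O => OrbiMorphism.underlying γ 0) (hγ z)
  induction γ using Quot.ind with
  | mk σ =>
    refine Eq.trans ?_ h
    refine Eq.trans ?_ (OrbiSystem.underlying_reparam (Homeomorph.addRight z) σ.sys 0).symm
    simp [OrbiMorphism.underlying]

/-- A system that represents a fixed loop has holonomy at every local point over its image. -/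
lemma exists_hasHolonomy_of_fixed (hfin : ∀ U : O.basic, Finite (O.Grp U))
    (hT1 : ∀ U : O.basic, T1Space (O.Cov U))
    (σ : SomeSystem (trivialOrbispace UnitAddCircle) O)
    (hσ : (Quot.mk _ σ : FreeLoopSpace O) ∈
      AddAction.fixedPoints UnitAddCircle (FreeLoopSpace O)) (a : σ.L)
    (x : (trivialOrbispace UnitAddCircle).Cov (σ.U a)) :
    ∃ (g : O.Grp (σ.U' a)) (hg : g • σ.sys.f a x = σ.sys.f a x),
      σ.HasHolonomy (LocalPoint.ofStab ⟨σ.U' a, σ.sys.f a x⟩ g hg) := by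
  obtain ⟨p, hp⟩ := exists_underlying_eq hσ
  have hp' : ∀ z, σ.sys.underlying z = p := hp
  refine σ.exists_hasHolonomy hfin hT1 (Q := ⟨σ.U' a, σ.sys.f a x⟩) fun z => ?_
  rw [hp', ← σ.sys.underlying_proj, hp']

lemma exists_eq_constLoop (hfin : ∀ U : O.basic, Finite (O.Grp U))
    (hT1 : ∀ U : O.basic, T1Space (O.Cov U))
    {γ : FreeLoopSpace O}
    (hγ : γ ∈ AddAction.fixedPoints UnitAddCircle (FreeLoopSpace O)) :
    ∃ (U : O.basic) (x : O.Cov U) (g : O.Grp U) (hg : g • x = x), γ = constLoop U x g hg := by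
  induction γ using Quot.ind with
  | mk σ =>
    obtain ⟨a, x, -⟩ := σ.sys.exists_proj_eq 0
    obtain ⟨g, hg, h⟩ := exists_hasHolonomy_of_fixed hfin hT1 σ hγ a x
    exact ⟨_, _, g, hg, (mk_eq_constLoop_iff hfin hT1 σ ⟨_, _⟩ g hg).2 h⟩

end

/-! ### Continuity of the constant loop in the point and the holonomy -/

section

namespace CircleCocycle

variable {C : Type*} [Groupoid C] {L : Type*}

lemma Trivialization.w_add_intCast {c : CircleCocycle C L} {Q : C} {g : Q ⟶ Q}
    (T : c.Trivialization g) (a : L) (t : ℝ) (n : ℤ) (ht ht') :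
    T.w a (t + n) ht' = T.w a t ht ≫ autPow g n := by
  have hn : ∀ n : ℤ, ((t + n : ℝ) : UnitAddCircle) ∈ c.U a := fun n => by
    rwa [coe_add_intCast]
  induction n with
  | zero => simp [autPow_zero]
  | succ n ih =>
    rw [← autPow_add, autPow_one, ← Category.assoc, ← ih (hn n)]
    have e : t + ((n + 1 : ℤ) : ℝ) = t + (n : ℤ) + 1 := by push_cast; ring
    rw [← T.w_add_one a (t + (n : ℤ)) (hn n) (e ▸ hn (n + 1))]
    congr 1
  | pred n ih =>
    have e : t + ((-n - 1 : ℤ) : ℝ) + 1 = t + (-n : ℤ) := by push_cast; ring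
    rw [← cancel_mono g, ← T.w_add_one a _ ht' (e ▸ hn (-n)), Category.assoc]
    nth_rw 4 [← autPow_one g]
    rw [autPow_add, sub_add_cancel, ← ih (hn (-n))]
    congr 1

/-- A cocycle over proper connected sets, with a trivialization, is given by sections. -/
lemma Trivialization.exists_rho_eq {c : CircleCocycle C L} {Q : C} {g : Q ⟶ Q}
    (T : c.Trivialization g) (hU : ∀ a, IsConnected (c.U a)) (l : L → UnitAddCircle → ℝ)
    (hl : ∀ a, ContinuousOn (l a) (c.U a)) (hl' : ∀ a z, (l a z : UnitAddCircle) = z) :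
    ∃ i : ∀ a, Q ⟶ c.P a, ∀ a b z ha hb,
      c.rho a b z ha hb = inv (i a) ≫ autPow g (round (l b z - l a z)) ≫ i b := by
  have hmem : ∀ {a z}, z ∈ c.U a → (l a z : UnitAddCircle) ∈ c.U a := fun {a z} h => by
    rwa [hl']
  choose p hp using fun a => (hU a).nonempty
  -- The trivialization along the section `l a` is locally constant on a connected set. The inverse
  -- of its value is the morphism `i a`.
  have hconst : ∀ a z (hz : z ∈ c.U a),
      T.w a (l a z) (hmem hz) = T.w a (l a (p a)) (hmem (hp a)) := by
    intro a z hz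
    refine (hU a).isPreconnected.eq_of_eventually_eq subset_rfl
      (fun z hz => T.w a (l a z) (hmem hz)) (fun z hz => ?_) hz (hp a)
    have h1 := (hl a).continuousAt ((c.isOpen_U a).mem_nhds hz)
    filter_upwards [h1.eventually (T.w_eventually a (l a z) (hmem hz))] with z' h h'
    exact h _
  refine ⟨fun a => inv (T.w a (l a (p a)) (hmem (hp a))), fun a b z ha hb => ?_⟩
  have ha' : (l b z : UnitAddCircle) ∈ c.U a := by rwa [hl']
  have e : l b z = l a z + (round (l b z - l a z) : ℤ) := by
    rw [round_sub_of_coe_eq ((hl' a z).trans (hl' b z).symm)]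
    ring
  have h1 := T.rho_comp a b (l b z) ha' (hmem hb)
  have h2 := T.w_add_intCast a (l a z) (round (l b z - l a z)) (hmem ha) (by rwa [← e])
  have h3 : T.w a (l b z) ha' = T.w a (l a z) (hmem ha) ≫ autPow g (round (l b z - l a z)) := by
    rw [← h2]
    congr 1
  rw [h3, hconst a z ha, hconst b z hb] at h1
  rw [IsIso.inv_inv, ← Category.assoc, ← h1]
  simp only [hl', Category.assoc, IsIso.hom_inv_id, Category.comp_id]

end CircleCocycle

variable {X : Type u} [TopologicalSpace X] [LocallyConnectedSpace X] {O : Orbispace X}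

namespace LocalPoint

/-- A transition map, as a morphism from a point of its domain. -/
def germ {U V : O.basic} (t : O.Tran U V) (x : O.Cov U) (hx : x ∈ O.src t) :
    (⟨U, x⟩ : LocalPoint O) ⟶ ⟨V, O.app t x⟩ :=
  Hom.mk t hx rfl

lemma isOpen_overlap {U V W : O.basic} (s : O.Tran V W) (t : O.Tran U V) :
    IsOpen ((O.iso s).overlap (O.iso t)) :=
  (O.iso t).map.isOpen_inter_preimage (O.iso s).map.open_source

/-- The transition map `j ∘ i⁻¹`, taken at a point of the local cover, is locally constant. -/
lemma eventually_inv_germ_comp {U V W : O.basic} (i : O.Tran U V) (j : O.Tran U W) {x : O.Cov U}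
    (hi : x ∈ O.src i) (hj : x ∈ O.src j) :
    ∀ᶠ x' in 𝓝 x, ∀ hi' hj', Hom.tran (inv (germ i x' hi') ≫ germ j x' hj') =
      Hom.tran (inv (germ i x hi) ≫ germ j x hj) := by
  obtain ⟨r, hr⟩ : ∃ r, r = Hom.tran (inv (germ i x hi) ≫ germ j x hj) := ⟨_, rfl⟩
  obtain ⟨hx, hxj⟩ : O.CompAt r i x j := by
    have h := compAt_tran (germ i x hi) (inv (germ i x hi) ≫ germ j x hj)
    rwa [IsIso.hom_inv_id_assoc, ← hr] at h
  rw [← hr]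
  -- The identity r ∘ i = j holds at x. Since compositions are constant on components of their
  -- domain, it persists nearby, so r remains the value of j ∘ i⁻¹.
  have hnhds : connectedComponentIn ((O.iso r).overlap (O.iso i)) x ∈ 𝓝 x :=
    (isOpen_overlap _ _).connectedComponentIn.mem_nhds (mem_connectedComponentIn hx)
  filter_upwards [hnhds] with x' hx' hi' hj'
  have ho := connectedComponentIn_subset _ _ hx'
  have h1 : O.comp r i x' ho = j :=
    (O.comp_const _ _ _ _ hx ho hx').trans hxj
  have h2 := O.map_comp r i x' ho
  rw [h1] at h2
  let R' : (⟨V, O.app i x'⟩ : LocalPoint O) ⟶ ⟨W, O.app j x'⟩ := Hom.mk r ho.2 h2.symm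
  have h3 : germ i x' hi' ≫ R' = germ j x' hj' := hom_ext h1
  rw [← h3, IsIso.inv_hom_id_assoc]

/-- The target of a germ is the image point itself, while the targets y and z are only equal to such
images. The underlying transition map is unaffected by this identification. -/
lemma tran_inv_comp_eq_germ {U V W : O.basic} {x : O.Cov U} {y : O.Cov V} {z : O.Cov W}
    (f : (⟨U, x⟩ : LocalPoint O) ⟶ ⟨V, y⟩) (f' : (⟨U, x⟩ : LocalPoint O) ⟶ ⟨W, z⟩)
    (k : (⟨U, x⟩ : LocalPoint O) ⟶ ⟨U, x⟩) :
    Hom.tran (inv f ≫ k ≫ f') = Hom.tran (inv (germ (Hom.tran f) x (Hom.mem_src f)) ≫ k ≫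
      germ (Hom.tran f') x (Hom.mem_src f')) := by
  have key : ∀ (y : O.Cov V) (z : O.Cov W) (t : O.Tran U V) (ht : x ∈ O.src t)
      (h : O.app t x = y) (t' : O.Tran U W) (ht' : x ∈ O.src t') (h' : O.app t' x = z),
      Hom.tran (inv (Hom.mk t ht h : (⟨U, x⟩ : LocalPoint O) ⟶ ⟨V, y⟩) ≫ k ≫
        (Hom.mk t' ht' h' : (⟨U, x⟩ : LocalPoint O) ⟶ ⟨W, z⟩)) =
        Hom.tran (inv (germ t x ht) ≫ k ≫ germ t' x ht') := by
    rintro _ _ t ht rfl t' ht' rfl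
    rfl
  exact key y z _ _ (Hom.app_eq f) _ _ (Hom.app_eq f')

/-- Moving the power of g past `h` separates the dependence on g, which enters through λ(g)ⁿ, from
the factor `inv f ≫ h`, which does not involve g. -/
lemma tran_inv_comp_autPow_comp {P Q R : LocalPoint O} (f : P ⟶ R) (h : P ⟶ Q)
    {g : O.Grp P.chart} (hg : g • P.pt = P.pt) (n : ℤ) :
    Hom.tran (inv f ≫ CircleCocycle.autPow (P.ofStab g hg) n ≫ h) =
      O.act ((O.iso (Hom.tran h)).hom (⟨g, mem_stabilizer_tran h hg⟩ ^ n)) (Hom.tran (inv f ≫ h))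
        1 := by
  have hn : g ^ n • P.pt = P.pt :=
    zpow_mem (show g ∈ MulAction.stabilizer (O.Grp P.chart) P.pt from hg) n
  rw [autPow_ofStab, ofStab_comp_eq h hn, ← Category.assoc]
  exact tran_comp_ofStab _ _ _

end LocalPoint

lemma Orbispace.continuous_act {U V : O.basic} (t : O.Tran U V) :
    Continuous fun h : O.Grp V => O.act h t 1 :=
  continuous_iff_coinduced_le.2 (le_iSup (fun t : O.Tran U V =>
    TopologicalSpace.coinduced (fun h : O.Grp V => O.act h t 1) inferInstance) t)

lemma SomeSystem.hasHolonomy_ofCocycle_ofSections {L : Type}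
    (I : L → (trivialOrbispace UnitAddCircle).basic) (hI : ⋃ k, (I k : Set UnitAddCircle) = univ)
    (l : L → UnitAddCircle → ℝ)
    (hl : ∀ a, ContinuousOn (l a) (I a)) (hl' : ∀ a z, (l a z : UnitAddCircle) = z)
    (P : L → LocalPoint O) {Q : LocalPoint O} (i : ∀ a, Q ⟶ P a) {g : O.Grp Q.chart}
    (hg : g • Q.pt = Q.pt) :
    (⟨L, I, fun k => (P k).chart, OrbiSystem.ofCocycle (CircleCocycle.ofSections
      (fun k => trivial_isOpen (I k)) (fun z => mem_iUnion.1 (hI ▸ mem_univ z)) l hl hl' i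
      (Q.ofStab g hg)) I fun _ => rfl⟩ :
        SomeSystem (trivialOrbispace UnitAddCircle) O).HasHolonomy (Q.ofStab g hg) := by
  refine SomeSystem.hasHolonomy_of_sections _ hg (fun a => (P a).pt)
    (OrbiSystem.isConst_ofCocycle _ I fun _ => rfl) i l hl hl' fun a b t => ?_
  obtain ⟨p, hp, h⟩ := trivialComponent_spec t
  have hpt : p ∈ trivialComponent t := h ▸ mem_connectedComponentIn hp
  exact ⟨p, hpt, LocalPoint.hom_ext (OrbiSystem.rho_ofCocycle _ I (fun _ => rfl) t hpt hp.1 hp.2)⟩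

/-- The constant loops depend continuously on the point and the holonomy. -/
lemma continuous_constLoop (hfin : ∀ U : O.basic, Finite (O.Grp U))
    (hT1 : ∀ U : O.basic, T1Space (O.Cov U)) (U : O.basic) :
    Continuous fun a : {a : O.Cov U × O.Grp U // a.2 • a.1 = a.1} =>
      constLoop U a.1.1 a.1.2 a.2 := by
  refine continuous_generateFrom_iff.2 ?_
  rintro _ ⟨n, I, U', K, V, A, hne, -, hK, hV, hA, rfl⟩
  rw [isOpen_iff_mem_nhds]
  rintro ⟨⟨x₀, g₀⟩, hg₀⟩ ⟨σ, hσ, hσV, hσA⟩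
  have hg₀' : g₀ • x₀ = x₀ := hg₀
  have hfinU := hfin U
  obtain ⟨(y : ∀ k, O.Cov (U' k)), (hy : σ.IsConst y), ⟨T⟩⟩ :=
    (mk_eq_constLoop_iff hfin hT1 _ ⟨U, x₀⟩ g₀ hg₀').1 hσ.symm
  choose l hl hl' using fun k => CircleCocycle.exists_section (hne k)
  obtain ⟨i, hi⟩ := T.exists_rho_eq (fun k => trivial_isConnected (I k)) l hl hl'
  -- By `hi` the system σ is transported from (x₀, g₀) by the transition maps `j k`. The same
  -- formula applied to a nearby pair (x, g) defines the perturbed system.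
  let j : ∀ k, O.Tran U (U' k) := fun k => LocalPoint.Hom.tran (i k)
  have hj₀ : ∀ k, x₀ ∈ O.src (j k) := fun k => LocalPoint.Hom.mem_src (i k)
  have hjy : ∀ k, O.app (j k) x₀ = y k := fun k => LocalPoint.Hom.app_eq (i k)
  have e1 : ∀ᶠ x in 𝓝 x₀, ∀ k, x ∈ O.src (j k) :=
    Filter.eventually_all.2 fun k => (O.iso (j k)).map.open_source.mem_nhds (hj₀ k)
  have e2 : ∀ᶠ x in 𝓝 x₀, ∀ k, (K k).Nonempty → O.app (j k) x ∈ V k := by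
    refine Filter.eventually_all.2 fun k => ?_
    -- If `K k` is empty, the subbasic set imposes no condition on the value, which need not lie in
    -- `V k`.
    by_cases hKk : (K k).Nonempty
    · obtain ⟨p, hp⟩ := hKk
      have h1 : O.app (j k) x₀ ∈ V k := by
        have := hσV k hp
        rwa [hy, ← hjy] at this
      filter_upwards [((O.iso (j k)).map.continuousAt (hj₀ k)).eventually
        ((hV k).mem_nhds h1)] with x hx _ using hx
    · exact Filter.Eventually.of_forall fun x h => absurd h hKk
  have e3 : ∀ᶠ x in 𝓝 x₀, ∀ k m, ∀ hk hm,
      LocalPoint.Hom.tran (inv (LocalPoint.germ (j k) x hk) ≫ LocalPoint.germ (j m) x hm) =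
        LocalPoint.Hom.tran (inv (LocalPoint.germ (j k) x₀ (hj₀ k)) ≫
          LocalPoint.germ (j m) x₀ (hj₀ m)) :=
    Filter.eventually_all.2 fun k => Filter.eventually_all.2 fun m =>
      LocalPoint.eventually_inv_germ_comp _ _ _ _
  -- In a finite group this is the smallest open neighbourhood of g₀. It lies in every open set
  -- containing g₀, so it serves for all components of all intersections at once.
  have e4 : ∀ᶠ g in 𝓝 g₀, g ∈ nhdsKer {g₀} :=
    isOpen_nhdsKer.mem_nhds (subset_nhdsKer rfl)
  have hfst : Filter.Tendsto (fun a : {a : O.Cov U × O.Grp U // a.2 • a.1 = a.1} => a.1.1)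
      (𝓝 ⟨(x₀, g₀), hg₀⟩) (𝓝 x₀) := (continuous_fst.comp continuous_subtype_val).tendsto _
  have hsnd : Filter.Tendsto (fun a : {a : O.Cov U × O.Grp U // a.2 • a.1 = a.1} => a.1.2)
      (𝓝 ⟨(x₀, g₀), hg₀⟩) (𝓝 g₀) := (continuous_snd.comp continuous_subtype_val).tendsto _
  have ev : ∀ᶠ a : {a : O.Cov U × O.Grp U // a.2 • a.1 = a.1} in 𝓝 ⟨(x₀, g₀), hg₀⟩,
      ((∀ k, a.1.1 ∈ O.src (j k)) ∧ (∀ k, (K k).Nonempty → O.app (j k) a.1.1 ∈ V k) ∧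
      ∀ k m, ∀ hk hm, LocalPoint.Hom.tran (inv (LocalPoint.germ (j k) a.1.1 hk) ≫
        LocalPoint.germ (j m) a.1.1 hm) =
        LocalPoint.Hom.tran (inv (LocalPoint.germ (j k) x₀ (hj₀ k)) ≫
          LocalPoint.germ (j m) x₀ (hj₀ m))) ∧ a.1.2 ∈ nhdsKer {g₀} :=
    (hfst.eventually (e1.and (e2.and e3))).and (hsnd.eventually e4)
  filter_upwards [ev]
  rintro ⟨⟨x, g⟩, hg⟩ ⟨⟨h1, h2, h3⟩, h4⟩
  have hg : g • x = x := hg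
  let c := CircleCocycle.ofSections (fun k => trivial_isOpen (I k))
    (fun z => mem_iUnion.1 (σ.cover ▸ mem_univ z)) l hl hl'
    (P := fun k => (⟨U' k, O.app (j k) x⟩ : LocalPoint O))
    (fun k => LocalPoint.germ (j k) x (h1 k)) (LocalPoint.ofStab ⟨U, x⟩ g hg)
  refine ⟨OrbiSystem.ofCocycle c I fun _ => rfl, ?_, ?_, ?_⟩
  · exact ((mk_eq_constLoop_iff hfin hT1 _ ⟨U, x⟩ g hg).2
      (SomeSystem.hasHolonomy_ofCocycle_ofSections I σ.cover l hl hl'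
        (fun k => (⟨U' k, O.app (j k) x⟩ : LocalPoint O))
        (fun k => LocalPoint.germ (j k) x (h1 k)) hg)).symm
  · exact fun k p hp => h2 k ⟨p, hp⟩
  · intro k m t
    obtain ⟨p, hp, h⟩ := trivialComponent_spec t
    have hpt : p ∈ trivialComponent t := h ▸ mem_connectedComponentIn hp
    rw [OrbiSystem.rho_ofCocycle c I (fun _ => rfl) t hpt hp.1 hp.2]
    set N := round (l m p - l k p)
    -- The transition map is λ(g)ᴺ acting on a transition map that depends on x' only; near x₀ the
    -- latter is the same as at x₀, by `h3`.
    have key : ∀ (x' : O.Cov U) (g' : O.Grp U) (hg' : g' • x' = x') (hk : x' ∈ O.src (j k))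
        (hm : x' ∈ O.src (j m)),
        LocalPoint.Hom.tran (inv (LocalPoint.germ (j k) x' hk) ≫
          CircleCocycle.autPow (LocalPoint.ofStab ⟨U, x'⟩ g' hg') N ≫
            LocalPoint.germ (j m) x' hm) =
        O.act ((O.iso (j m)).hom (⟨g', (O.iso (j m)).mem_stabilizer hm hg'⟩ ^ N))
          (LocalPoint.Hom.tran (inv (LocalPoint.germ (j k) x' hk) ≫
            LocalPoint.germ (j m) x' hm)) 1 := fun x' g' hg' hk hm =>
      LocalPoint.tran_inv_comp_autPow_comp _ (LocalPoint.germ (j m) x' hm) hg' N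
    -- The condition on the holonomy is open in the stabilizer of the domain of `j m`, where λ is
    -- defined and continuous. It is therefore the trace of an open subset of G_U, which contains g₀
    -- and so also g.
    have hAopen : IsOpen {s : MulAction.stabilizer (O.Grp U) (O.src (j m)) |
        O.act ((O.iso (j m)).hom (s ^ N)) (LocalPoint.Hom.tran
          (inv (LocalPoint.germ (j k) x₀ (hj₀ k)) ≫ LocalPoint.germ (j m) x₀ (hj₀ m))) 1 ∈
            A k m t} :=
      (hA k m t).preimage ((Orbispace.continuous_act _).comp (continuous_subtype_val.comp
        ((O.iso (j m)).hom.continuous.comp (continuous_zpow N))))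
    obtain ⟨W, hW, hWA⟩ := isOpen_induced_iff.1 hAopen
    have hg₀W : g₀ ∈ W := by
      have : (⟨g₀, (O.iso (j m)).mem_stabilizer (hj₀ m) hg₀'⟩ :
          MulAction.stabilizer (O.Grp U) (O.src (j m))) ∈ Subtype.val ⁻¹' W := by
        rw [hWA]
        change O.act _ _ _ ∈ A k m t
        rw [← key x₀ g₀ hg₀' (hj₀ k) (hj₀ m)]
        have h5 := (hy.cocycle_rho t hpt hp.1 hp.2).symm.trans (hi k m p hp.1 hp.2)
        have h6 := hσA k m t
        rwa [show σ.rho k m t = _ from (congrArg LocalPoint.Hom.tran h5).trans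
          (LocalPoint.tran_inv_comp_eq_germ _ _ _)] at h6
      exact this
    have hgW : g ∈ W := by
      have := nhdsKer_minimal (singleton_subset_iff.2 hg₀W) hW
      exact this h4
    have h7 : (⟨g, (O.iso (j m)).mem_stabilizer (h1 m) hg⟩ :
        MulAction.stabilizer (O.Grp U) (O.src (j m))) ∈ Subtype.val ⁻¹' W := hgW
    rw [hWA] at h7
    have h8 := key x g hg (h1 k) (h1 m)
    rw [h3] at h8
    exact h8 ▸ h7

end

/-! ### Three arcs: recovering the point and the holonomy from a nearby fixed loop -/

section

lemma mem_arcAt {a t : ℝ} (h : |t - a| < 1 / 4) :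
    (t : UnitAddCircle) ∈ (arcAt a : Set UnitAddCircle) :=
  ⟨t, ⟨by linarith [(abs_lt.1 h).1], by linarith [(abs_lt.1 h).2]⟩, rfl⟩

lemma arcAt_ne_univ (a : ℝ) : (arcAt a : Set UnitAddCircle) ≠ univ := by
  intro h
  have h1 : ((a + 1 / 2 : ℝ) : UnitAddCircle) ∈ (arcAt a : Set UnitAddCircle) := h ▸ mem_univ _
  obtain ⟨t, ht, h2⟩ := h1
  obtain ⟨n, rfl⟩ := CircleCocycle.exists_eq_add_intCast h2.symm
  have h3 : (-1 : ℝ) < n := by linarith [ht.1]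
  have h4 : (n : ℝ) < 0 := by linarith [ht.2]
  have h5 : -1 < n := by exact_mod_cast h3
  have h6 : n < 0 := by exact_mod_cast h4
  omega

/-- Three arcs of length `1 / 2` which cover the circle. -/
noncomputable def threeArcs (k : Fin 3) : (trivialOrbispace UnitAddCircle).basic :=
  arcAt ((k : ℕ) / 3)

lemma iUnion_threeArcs : ⋃ k, (threeArcs k : Set UnitAddCircle) = univ := by
  refine eq_univ_of_forall fun z => ?_
  have hz : (((AddCircle.equivIco 1 (-1 / 6) z : Ico (-1 / 6 : ℝ) (-1 / 6 + 1)) : ℝ) :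
      UnitAddCircle) = z := AddCircle.coe_equivIco
  obtain ⟨h1, h2⟩ := (AddCircle.equivIco 1 (-1 / 6) z).2
  set t : ℝ := ((AddCircle.equivIco 1 (-1 / 6) z : Ico (-1 / 6 : ℝ) (-1 / 6 + 1)) : ℝ)
  rw [← hz, mem_iUnion]
  rcases lt_or_ge t (1 / 6) with h3 | h3
  · exact ⟨0, mem_arcAt (by rw [abs_lt]; constructor <;> norm_num <;> linarith)⟩
  rcases lt_or_ge t (1 / 2) with h4 | h4
  · exact ⟨1, mem_arcAt (by rw [abs_lt]; constructor <;> norm_num <;> linarith)⟩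
  · exact ⟨2, mem_arcAt (by rw [abs_lt]; constructor <;> norm_num <;> linarith)⟩

namespace CircleCocycle

variable {C : Type*} [Groupoid C] {L : Type*}

lemma Trivialization.w_eq_of_isPreconnected {c : CircleCocycle C L} {Q : C} {g : Q ⟶ Q}
    (T : c.Trivialization g) {a : L} {S : Set ℝ} (hS : _root_.IsPreconnected S)
    (h : ∀ t ∈ S, (t : UnitAddCircle) ∈ c.U a) {s t : ℝ} (hs : s ∈ S) (ht : t ∈ S) :
    T.w a s (h s hs) = T.w a t (h t ht) :=
  hS.eq_of_eventually_eq (T := {t : ℝ | (t : UnitAddCircle) ∈ c.U a}) h (T.w a)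
    (T.w_eventually a) hs ht

/-- The holonomy of a cocycle over three arcs. -/
lemma Trivialization.exists_conj_threeArcs {c : CircleCocycle C (Fin 3)}
    (hU : ∀ k, c.U k = threeArcs k) {Q : C} {g : Q ⟶ Q} (T : c.Trivialization g) :
    ∃ (z₁ z₂ z₃ : UnitAddCircle) (h₁ : z₁ ∈ c.U 0 ∩ c.U 1) (h₂ : z₂ ∈ c.U 1 ∩ c.U 2)
      (h₃ : z₃ ∈ c.U 2 ∩ c.U 0) (k : Q ⟶ c.P 0),
      k = (g ≫ k) ≫ c.rho 0 1 z₁ h₁.1 h₁.2 ≫ c.rho 1 2 z₂ h₂.1 h₂.2 ≫ c.rho 2 0 z₃ h₃.1 h₃.2 := by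
  have m0 : ∀ t ∈ Ioo (-1 / 4 : ℝ) (1 / 4), (t : UnitAddCircle) ∈ c.U 0 := fun t ht => by
    rw [hU]
    exact mem_arcAt (by rw [abs_lt]; constructor <;> norm_num <;> linarith [ht.1, ht.2])
  have m1 : ∀ t ∈ Ioo (1 / 12 : ℝ) (7 / 12), (t : UnitAddCircle) ∈ c.U 1 := fun t ht => by
    rw [hU]
    exact mem_arcAt (by rw [abs_lt]; constructor <;> norm_num <;> linarith [ht.1, ht.2])
  have m2 : ∀ t ∈ Ioo (5 / 12 : ℝ) (11 / 12), (t : UnitAddCircle) ∈ c.U 2 := fun t ht => by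
    rw [hU]
    exact mem_arcAt (by rw [abs_lt]; constructor <;> norm_num <;> linarith [ht.1, ht.2])
  -- The lift of the first arc one period later, where the path around the circle ends.
  have m0' : ∀ t ∈ Ioo (3 / 4 : ℝ) (5 / 4), (t : UnitAddCircle) ∈ c.U 0 := fun t ht => by
    have h := m0 (t - 1) ⟨by linarith [ht.1], by linarith [ht.2]⟩
    rw [← coe_add_intCast (t - 1) 1] at h
    simpa using h
  have i0 : (0 : ℝ) ∈ Ioo (-1 / 4 : ℝ) (1 / 4) := by norm_num
  have i0' : (1 / 6 : ℝ) ∈ Ioo (-1 / 4 : ℝ) (1 / 4) := by norm_num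
  have i1 : (1 / 6 : ℝ) ∈ Ioo (1 / 12 : ℝ) (7 / 12) := by norm_num
  have i1' : (1 / 2 : ℝ) ∈ Ioo (1 / 12 : ℝ) (7 / 12) := by norm_num
  have i2 : (1 / 2 : ℝ) ∈ Ioo (5 / 12 : ℝ) (11 / 12) := by norm_num
  have i2' : (5 / 6 : ℝ) ∈ Ioo (5 / 12 : ℝ) (11 / 12) := by norm_num
  have i3 : (5 / 6 : ℝ) ∈ Ioo (3 / 4 : ℝ) (5 / 4) := by norm_num
  have i3' : (0 + 1 : ℝ) ∈ Ioo (3 / 4 : ℝ) (5 / 4) := by norm_num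
  -- The trivialization is followed along 0, 1/6, 1/2, 5/6, 1: it is constant within each of the
  -- arcs 0, 1, 2, 0, and the arcs are changed at the three intermediate points. At 1 it has become
  -- `w 0 0 ≫ g`, so the product of the three transitions is conjugate to g⁻¹.
  have e0 := T.w_eq_of_isPreconnected isPreconnected_Ioo m0 i0 i0'
  have e1 := T.w_eq_of_isPreconnected isPreconnected_Ioo m1 i1 i1'
  have e2 := T.w_eq_of_isPreconnected isPreconnected_Ioo m2 i2 i2'
  have e3 := T.w_eq_of_isPreconnected isPreconnected_Ioo m0' i3 i3'
  have r1 := T.rho_comp 0 1 (1 / 6) (m0 _ i0') (m1 _ i1)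
  have r2 := T.rho_comp 1 2 (1 / 2) (m1 _ i1') (m2 _ i2)
  have r3 := T.rho_comp 2 0 (5 / 6) (m2 _ i2') (m0' _ i3)
  have p := T.w_add_one 0 0 (m0 _ i0) (m0' _ i3')
  refine ⟨_, _, _, ⟨m0 _ i0', m1 _ i1⟩, ⟨m1 _ i1', m2 _ i2⟩, ⟨m2 _ i2', m0' _ i3⟩,
    inv (T.w 0 0 (m0 _ i0)), ?_⟩
  rw [e3, p] at r3
  rw [e2, ← r3] at r2
  rw [e1, ← r2, ← e0] at r1
  rw [← cancel_mono (T.w 0 0 (m0 _ i0) ≫ g)]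
  simp only [Category.assoc] at r1 ⊢
  rw [r1]
  simp

end CircleCocycle

variable {X : Type u} [TopologicalSpace X] [LocallyConnectedSpace X] {O : Orbispace X}

/-- Under `ofGrp` the maps h ↦ h ∘ t that define the topology of `Tran U U` are right translations
of G_U, and these are continuous. -/
lemma Orbispace.isOpen_image_ofGrp {U : O.basic} {W : Set (O.Grp U)} (hW : IsOpen W) :
    IsOpen (O.ofGrp U '' W) := by
  refine isOpen_iSup_iff.2 fun t => isOpen_coinduced.2 ?_
  obtain ⟨k, rfl⟩ := O.ofGrp_surjective U t
  have : (fun h : O.Grp U => O.act h (O.ofGrp U k) 1) ⁻¹' (O.ofGrp U '' W) =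
      (fun h => h * k) ⁻¹' W := by
    ext h
    simp only [mem_preimage, O.act_ofGrp]
    exact (O.ofGrp_injective U).mem_set_image
  rw [this]
  exact hW.preimage (continuous_mul_const k)

/-- Every fixed loop near a constant loop is given by a point and a holonomy near those of the
constant loop. -/
lemma exists_isOpen_of_constLoop (hfin : ∀ U : O.basic, Finite (O.Grp U))
    (hT1 : ∀ U : O.basic, T1Space (O.Cov U)) (U : O.basic) (x₀ : O.Cov U) (g₀ : O.Grp U)
    (hg₀ : g₀ • x₀ = x₀) {W : Set (O.Cov U × O.Grp U)} (hW : IsOpen W) (h₀ : (x₀, g₀) ∈ W) :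
    ∃ S : Set (FreeLoopSpace O), IsOpen S ∧ constLoop U x₀ g₀ hg₀ ∈ S ∧
      ∀ γ ∈ S, γ ∈ AddAction.fixedPoints UnitAddCircle (FreeLoopSpace O) →
        ∃ (y : O.Cov U) (h : O.Grp U) (hh : h • y = y), (y, h) ∈ W ∧ γ = constLoop U y h hh := by
  have := hfin U
  obtain ⟨V, W', hV, hW', hxV, hgW, hVW⟩ := isOpen_prod_iff.1 hW x₀ g₀ h₀
  choose l hl hl' hla using fun k : Fin 3 => exists_section_arcAt ((k : ℕ) / 3)
  -- One test point in each arc suffices as a compact set, because the maps of systems for fixed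
  -- loops are constant.
  choose p hp using fun k => (trivial_isConnected (threeArcs k)).nonempty
  choose q hq using fun k =>
    Orbispace.exists_proj_eq (trivialOrbispace UnitAddCircle) (threeArcs k) (p k) (hp k)
  -- The exponents of g₀ in `constSystem` for arcs with these centres. Going once around, they are
  -- 0, 0 and −1: the full holonomy sits in the passage from the last arc to the first.
  let n : Fin 3 → Fin 3 → ℤ := fun k m => round (((m : ℕ) / 3 : ℝ) - (k : ℕ) / 3)
  let S : Set (FreeLoopSpace O) :=
    {γ | ∃ σ : OrbiSystem (trivialOrbispace UnitAddCircle) O threeArcs fun _ => U,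
      γ = Quot.mk _ ⟨Fin 3, threeArcs, fun _ => U, σ⟩ ∧
      (∀ k, MapsTo (σ.f k) {q k} V) ∧
      ∀ k m t, σ.rho k m t ∈ O.ofGrp U '' nhdsKer {g₀ ^ n k m}}
  refine ⟨S, ?_, ?_, ?_⟩
  · refine isOpen_generateFrom_of_mem ⟨2, threeArcs, fun _ => U, fun k => {q k}, fun _ => V,
      fun k m _ => O.ofGrp U '' nhdsKer {g₀ ^ n k m}, fun k => arcAt_ne_univ _, ?_,
      fun k => isCompact_singleton, fun _ => hV,
      fun k m _ => Orbispace.isOpen_image_ofGrp isOpen_nhdsKer, rfl⟩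
    -- Any two of three cyclically ordered arcs are neighbours, so the condition on the chain is
    -- void here.
    have : ∀ k m : Fin 3, m = k ∨ m = k + 1 ∨ k = m + 1 := by decide
    exact fun k m _ => this k m
  · let c := CircleCocycle.ofSections (fun k => trivial_isOpen (threeArcs k))
      (fun z => mem_iUnion.1 (iUnion_threeArcs ▸ mem_univ z)) l hl hl'
      (fun _ => 𝟙 (⟨U, x₀⟩ : LocalPoint O)) (LocalPoint.ofStab ⟨U, x₀⟩ g₀ hg₀)
    refine ⟨OrbiSystem.ofCocycle c threeArcs fun _ => rfl, ?_, ?_, ?_⟩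
    · exact ((mk_eq_constLoop_iff hfin hT1 _ ⟨U, x₀⟩ g₀ hg₀).2
        (SomeSystem.hasHolonomy_ofCocycle_ofSections threeArcs iUnion_threeArcs l hl hl'
          (fun k => (⟨U, x₀⟩ : LocalPoint O)) (fun _ => 𝟙 _) hg₀)).symm
    · exact fun k _ _ => hxV
    · intro k m t
      obtain ⟨z, hz, h⟩ := trivialComponent_spec t
      have hzt : z ∈ trivialComponent t := h ▸ mem_connectedComponentIn hz
      refine ⟨g₀ ^ n k m, subset_nhdsKer rfl, ?_⟩
      have hr : round (l m z - l k z) = n k m :=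
        round_eq_round_of_arcAt ((hl' k z).trans (hl' m z).symm) (hla k z hz.1) (hla m z hz.2)
      refine Eq.trans ?_ (OrbiSystem.rho_ofCocycle c threeArcs (fun _ => rfl) t hzt hz.1 hz.2).symm
      change _ = LocalPoint.Hom.tran (inv (𝟙 (⟨U, x₀⟩ : LocalPoint O)) ≫
        CircleCocycle.autPow (LocalPoint.ofStab ⟨U, x₀⟩ g₀ hg₀) (round (l m z - l k z)) ≫ 𝟙 _)
      rw [hr, LocalPoint.autPow_ofStab, IsIso.inv_id, Category.id_comp, Category.comp_id]
      rfl
  · rintro _ ⟨σ, rfl, hσV, hσA⟩ hfix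
    obtain ⟨g, hg, (y : ∀ k : Fin 3, O.Cov U), (hy : σ.IsConst y), ⟨T⟩⟩ :=
      exists_hasHolonomy_of_fixed hfin hT1
      ⟨Fin 3, threeArcs, fun _ => U, σ⟩ hfix (0 : Fin 3) (q 0)
    obtain ⟨z₁, z₂, z₃, h₁, h₂, h₃, k, hk⟩ := T.exists_conj_threeArcs fun _ => rfl
    obtain ⟨a, ha, ha'⟩ := hσA 0 1 (trivialTran _ _ z₁ h₁)
    obtain ⟨b, hb, hb'⟩ := hσA 1 2 (trivialTran _ _ z₂ h₂)
    obtain ⟨d, hd, hd'⟩ := hσA 2 0 (trivialTran _ _ z₃ h₃)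
    have hP : ∀ i j z hi hj, LocalPoint.Hom.tran (hy.cocycle.rho i j z hi hj) =
        σ.rho i j (trivialTran _ _ z ⟨hi, hj⟩) := fun _ _ _ _ _ => rfl
    -- All charts are U, so each transition map is an element of G_U, and composition around the
    -- circle is multiplication in G_U.
    have hact : ∀ (i j : Fin 3) (e : O.Grp U) (f : hy.cocycle.P 0 ⟶ hy.cocycle.P i)
        (f' : hy.cocycle.P i ⟶ hy.cocycle.P j), LocalPoint.Hom.tran f' = O.ofGrp U e →
        LocalPoint.Hom.tran (f ≫ f') = O.act e (LocalPoint.Hom.tran f) 1 := by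
      intro i j e f f' he
      have hei : e • y i = y j := by
        rw [← O.app_ofGrp, ← he]
        exact LocalPoint.Hom.app_eq f'
      have : f' = LocalPoint.ofGrp e hei := LocalPoint.hom_ext he
      rw [this]
      exact LocalPoint.tran_comp_ofGrp e hei f
    obtain ⟨(m : O.Grp U), (hm₀ : m • y 0 = y 0), hm'⟩ := LocalPoint.ofStab_surjective _
      ((hy.cocycle.rho 0 1 z₁ h₁.1 h₁.2 ≫
      hy.cocycle.rho 1 2 z₂ h₂.1 h₂.2) ≫ hy.cocycle.rho 2 0 z₃ h₃.1 h₃.2)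
    have hmabd : m = d * (b * a) := by
      apply O.ofGrp_injective U
      have h1 := congrArg LocalPoint.Hom.tran hm'
      rw [hact 2 0 d _ _ hd'.symm, hact 1 2 b _ _ hb'.symm] at h1
      refine h1.symm.trans ?_
      rw [hP, ← ha']
      exact (congrArg (fun t : O.Tran U U => O.act d t 1) (O.act_ofGrp a b)).trans (O.act_ofGrp _ _)
    have hminv : m⁻¹ • y 0 = y 0 := inv_smul_eq_iff.2 hm₀.symm
    -- From k = (g ≫ k) ≫ m it follows that k conjugates g to m⁻¹, so m⁻¹ is a holonomy of the loop
    -- at the point `y 0`.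
    have hk' : LocalPoint.ofStab _ g hg ≫ k = k ≫ LocalPoint.ofStab ⟨U, y 0⟩ m⁻¹ hminv := by
      have h1 : k = (LocalPoint.ofStab _ g hg ≫ k) ≫ LocalPoint.ofStab ⟨U, y 0⟩ m hm₀ := by
        have h2 := hm'
        rw [Category.assoc] at h2
        exact hk.trans (congrArg (_ ≫ ·) h2)
      have h3 : LocalPoint.ofStab (⟨U, y 0⟩ : LocalPoint O) m hm₀ ≫
          LocalPoint.ofStab ⟨U, y 0⟩ m⁻¹ hminv = 𝟙 _ := by
        rw [LocalPoint.ofStab_comp, ← LocalPoint.ofStab_one]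
        congr 1
        simp
      have h4 := congrArg (· ≫ LocalPoint.ofStab ⟨U, y 0⟩ m⁻¹ hminv) h1
      exact (h4.trans ((Category.assoc _ _ _).trans
        ((congrArg (_ ≫ ·) h3).trans (Category.comp_id _)))).symm
    have hol : (⟨Fin 3, threeArcs, fun _ => U, σ⟩ :
        SomeSystem (trivialOrbispace UnitAddCircle) O).HasHolonomy
          (LocalPoint.ofStab ⟨U, y 0⟩ m⁻¹ hminv) :=
      SomeSystem.HasHolonomy.conj ⟨y, hy, ⟨T⟩⟩ k hk'
    refine ⟨y 0, m⁻¹, hminv, hVW ⟨?_, ?_⟩, (mk_eq_constLoop_iff hfin hT1 _ ⟨U, y 0⟩ _ _).2 hol⟩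
    · have := hσV 0 (mem_singleton (q 0))
      rwa [hy] at this
    · have n1 : n 0 1 = 0 := by
        simp only [n, round_eq, Int.floor_eq_iff]
        norm_num
      have n2 : n 1 2 = 0 := by
        simp only [n, round_eq, Int.floor_eq_iff]
        norm_num
      have n3 : n 2 0 = -1 := by
        simp only [n, round_eq, Int.floor_eq_iff]
        norm_num
      rw [n1, zpow_zero, mem_nhdsKer_singleton] at ha
      rw [n2, zpow_zero, mem_nhdsKer_singleton] at hb
      rw [n3, zpow_neg_one, mem_nhdsKer_singleton] at hd
      -- Membership in `nhdsKer` is specialization, which is compatible with products and inverses.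
      -- Thus m⁻¹ = (d b a)⁻¹ specializes to (g₀⁻¹ · 1 · 1)⁻¹ = g₀ and lies in every open set that
      -- contains g₀.
      have hs := (hd.mul (hb.mul ha)).inv
      rw [one_mul, mul_one, inv_inv, ← hmabd] at hs
      exact hs.mem_open hW' hgW

/-! ### Two quotient maps with the same fibres -/

/-- The constant loop of a point of a local cover with an element of its stabilizer. -/
noncomputable def fixedConstLoop (O : Orbispace X)
    (q : Σ U : O.basic, {a : O.Cov U × O.Grp U // a.2 • a.1 = a.1}) :
    AddAction.fixedPoints UnitAddCircle (FreeLoopSpace O) :=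
  ⟨constLoop q.1 q.2.1.1 q.2.1.2 q.2.2, constLoop_mem_fixedPoints _ _ _ _⟩

/-- If the preimage of S is open and contains (x, g), then `exists_isOpen_of_constLoop` yields a
neighbourhood of the loop in which every fixed loop comes from a pair in that preimage, so S is a
neighbourhood of the loop. -/
lemma isQuotientMap_fixedConstLoop (hfin : ∀ U : O.basic, Finite (O.Grp U))
    (hT1 : ∀ U : O.basic, T1Space (O.Cov U)) : IsQuotientMap (fixedConstLoop O) := by
  have hcont : Continuous (fixedConstLoop O) :=
    (continuous_sigma fun U => continuous_constLoop hfin hT1 U).subtype_mk _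
  refine ⟨isCoinducing_iff.2 fun S => ⟨fun hS => ?_, fun hS => hS.preimage hcont⟩, ?_⟩
  rotate_left
  · rintro ⟨γ, hγ⟩
    obtain ⟨U, x, g, hg, rfl⟩ := exists_eq_constLoop hfin hT1 hγ
    exact ⟨⟨U, (x, g), hg⟩, rfl⟩
  · rw [isOpen_iff_mem_nhds]
    rintro ⟨γ, hγ⟩ hγS
    obtain ⟨U, x, g, hg, rfl⟩ := exists_eq_constLoop hfin hT1 hγ
    obtain ⟨W, hW, hWS⟩ := isOpen_induced_iff.1 (isOpen_sigma_iff.1 hS U)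
    have h0 : (⟨(x, g), hg⟩ : {a : O.Cov U × O.Grp U // a.2 • a.1 = a.1}) ∈ Subtype.val ⁻¹' W :=
      hWS ▸ hγS
    obtain ⟨N, hN, hxN, hNW⟩ := exists_isOpen_of_constLoop hfin hT1 U x g hg hW h0
    refine Filter.mem_of_superset ((hN.preimage continuous_subtype_val).mem_nhds hxN) ?_
    rintro ⟨γ, hγ⟩ hγN
    obtain ⟨y, h, hh, hyW, rfl⟩ := hNW γ hγN hγ
    have h1 : (⟨(y, h), hh⟩ : {a : O.Cov U × O.Grp U // a.2 • a.1 = a.1}) ∈ Subtype.val ⁻¹' W := hyW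
    rw [hWS] at h1
    exact h1

/-- The point of the space of twisted sectors of a point of a local cover with an element of its
stabilizer. -/
noncomputable def sigmaToSector (O : Orbispace X)
    (q : Σ U : O.basic, {a : O.Cov U × O.Grp U // a.2 • a.1 = a.1}) : O.TwistedSectors :=
  Orbispace.toSector q.1 q.2.1.1 q.2.1.2 q.2.2

lemma isQuotientMap_sigmaToSector (O : Orbispace X) : IsQuotientMap (sigmaToSector O) := by
  refine ⟨⟨rfl⟩, ?_⟩
  rintro ⟨p, c⟩
  obtain ⟨k, rfl⟩ := ConjClasses.mk_surjective c
  refine ⟨⟨O.basicAt p, (O.liftAt p, k), k.2⟩, ?_⟩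
  exact LocalPoint.toSector_eq_mk (P := LocalPoint.base p) k.2 (𝟙 _)
    ((Category.comp_id _).trans (Category.id_comp _).symm)

lemma sigmaToSector_eq_iff (hfin : ∀ U : O.basic, Finite (O.Grp U))
    (hT1 : ∀ U : O.basic, T1Space (O.Cov U)) (a b) :
    sigmaToSector O a = sigmaToSector O b ↔ fixedConstLoop O a = fixedConstLoop O b :=
  (constLoop_eq_iff hfin hT1 ⟨a.1, a.2.1.1⟩ ⟨b.1, b.2.1.1⟩ _ a.2.2 _ b.2.2).symm.trans
    ⟨fun h => Subtype.ext h, fun h => congrArg Subtype.val h⟩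

end

end

theorem proposition3p5p3 {X : Type u} [TopologicalSpace X] [LocallyConnectedSpace X]
    (O : Orbispace X) (hfin : ∀ U : O.basic, Finite (O.Grp U))
    (hT1 : ∀ U : O.basic, T1Space (O.Cov U)) :
    ∃ Φ : O.TwistedSectors ≃ₜ AddAction.fixedPoints UnitAddCircle (FreeLoopSpace O),
      ∀ (U : O.basic) (x : O.Cov U) (g : O.Grp U) (hg : g • x = x),
        (Φ (Orbispace.toSector U x g hg) : FreeLoopSpace O) = constLoop U x g hg := by
  -- The two quotient maps start from the same space and have the same fibres, so each factors
  -- continuously through the other, and the two factorizations are mutually inverse.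
  have hq := isQuotientMap_sigmaToSector O
  have hF := isQuotientMap_fixedConstLoop hfin hT1
  let f : C(_, O.TwistedSectors) := ⟨sigmaToSector O, hq.continuous⟩
  let f' : C(_, AddAction.fixedPoints UnitAddCircle (FreeLoopSpace O)) :=
    ⟨fixedConstLoop O, hF.continuous⟩
  have hf : IsQuotientMap f := hq
  have hf' : IsQuotientMap f' := hF
  have h : Function.FactorsThrough f' f := fun a b => (sigmaToSector_eq_iff hfin hT1 a b).1
  have h' : Function.FactorsThrough f f' := fun a b => (sigmaToSector_eq_iff hfin hT1 a b).2
  let F := hf.lift f' h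
  let G := hf'.lift f h'
  have hFq : ∀ a, F (sigmaToSector O a) = fixedConstLoop O a := fun a =>
    congrArg (fun f => f a) (hf.lift_comp f' h)
  have hGF : ∀ a, G (fixedConstLoop O a) = sigmaToSector O a := fun a =>
    congrArg (fun f => f a) (hf'.lift_comp f h')
  refine ⟨⟨⟨F, G, fun s => ?_, fun γ => ?_⟩, F.continuous, G.continuous⟩, fun U x g hg => ?_⟩
  · obtain ⟨a, rfl⟩ := hq.surjective s
    rw [hFq, hGF]
  · obtain ⟨a, rfl⟩ := hF.surjective γ
    rw [hGF, hFq]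
  · exact congrArg Subtype.val (hFq ⟨U, (x, g), hg⟩)
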